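/- **Setting.** Let $F:\mathbb R\to\mathbb R$ be real analytic in a neighbourhood of $-c$, where $c\in\mathbb R$, with $F'(-c)>0$. Put $\alpha_k=F^{(k)}(-c)$, and let $\rho_F$ be the minimum of $1$ and the radius of convergence of $\sum_k \frac{\alpha_k}{k!}(x+c)^k$. Let $\gamma>0$ be non-resonant: $\frac{(m\gamma)^2}{F'(-c)}\ne 4$ for all $m\in\mathbb Z$. Let $w:\mathbb Z\to\mathbb R$ be an admissible weight, i.e. $w(m)\ge 1$ and $w(m)\le w(m-n)w(n)$ for all $m,n\in\mathbb Z$, and let $(b_m)_{m\in\mathbb Z}$ be complex numbers with $\sum_m w(m)|b_m|=1$. For $\sigma\in\mathbb R$ let $\mathcal L_{\sigma,w}$ be the space of all $u:\mathbb N_0\times\mathbb Z\to\mathbb C$ with $\|u\|_{\sigma,w}=\sum_{m}w(m)\sup_{n\ge0}e^{\sigma n}|u(n,m)|<\infty$. Write $\triangle u(n,m)=u(n-1,m)-u(n,m)$ for $n\ge 1$, let $f^{*k}$ be the $k$-fold convolution of a sequence $f$ on $\mathbb Z$, and for $n\ge1$ put $$Y(u,v)(n,m)=\frac1{\alpha_1}\sum_{k=2}^\infty\frac{\alpha_k}{k!}\Big((\triangle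 (u+v))(n,\cdot)^{*k}-(\triangle u)(n,\cdot)^{*k}\Big)(m),\qquad W(u,v)(n,m)=Y(u,v)(n,m)-Y(u,v)(n+1,m).$$ Put $\delta_m=-2+\frac{(m\gamma)^2}{F'(-c)}$ and $m_0=\max\{m\in\mathbb Z: 0\le\frac{(m\gamma)^2}{F'(-c)}\le4\}$. For $|m|>m_0$ put $z_m=-\frac{\delta_m}2+\sqrt{\frac{\delta_m^2}4-1}$, and for $0<|m|\le m_0$ put $\beta_m=-\operatorname{sgn}(m)\arccos(-\frac{\delta_m}2)$. Let $\sigma_0=\min(1,-\frac12\ln|z_{m_0+1}|)$, $\sigma_1=\frac14\sigma_0$, $$C_K=\max\Big[\frac{1+e^{-2\sigma_0}}{1-e^{-4\sigma_0}}\Big(\frac1{e^{\sigma_0}-1}+\frac1{1-e^{-2\sigma_0}}\Big),\ \frac{2}{1-e^{-\sigma_1}}\max\Big\{\frac1{|\sin\beta_m|}:0<m\le m_0\Big\}\Big]$$ (the second term being absent if $m_0=0$), and $\rho_u=\sum_{|m|>m_0}w(m)|u(0,m)|$. **Theorem.** There is a constant $C_F>0$, depending only on $F$ and $c$, such that the following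 holds for all $\gamma,w,(b_m)$ as above, with $c_1=\min\big(\frac1{4C_KC_F},\frac{\rho_F}8\big)$. Let $N\in\mathbb N$, $c_0>0$, $C_0>1$, and let $q\mapsto u(q)$ be a map from $\{q\in\mathbb R^N:|q|\le c_0\}$ to $\mathcal L_{0,w}$ such that 1. $\|u(q)\|_{0,w}\le c_1$ and $\rho_{u(q)}\le \frac{c_1}4$ for all $|q|\le c_0$; 2. $q\mapsto u(q)$ is $C^1$ as a map from $\{|q|\le c_0\}$ to $\mathcal L_{-\sigma_1,w}$, and $\big\|\frac{\partial}{\partial q_j}u(q)\big\|_{-\sigma_1,w}\le C_0$ for all $|q|\le c_0$, $1\le j\le N$; 3. $u(q)(n,-m)=\overline{u(q)(n,m)}$ for all $|q|\le c_0$, $n\ge0$, $m\in\mathbb Z$. Then for all $(q,\epsilon)\in\mathbb R^N\times\mathbb R$ with $|q|,|\epsilon|\le\min\big(c_0,\frac{c_1}{4C_0}\big)$ there is a unique $v\in\mathcal L_{\sigma_0,w}$ with the properties * (i) $v(n-1,m)+\delta_mv(n,m)+v(n+1,m)+W(u(q),v)(n,m)=0$ for all $m\in\mathbb Z$, $n\ge1$;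 * (ii) $\|v\|_{\sigma_0,w}\le 2(\rho_{u(q)}+|\epsilon|)\le c_1\le\frac{\rho_F}8$; * (iii) $v(0,m)=\epsilon b_m-u(q)(0,m)$ for all $|m|>m_0$. Furthermore: * (iv) if the driver is real, i.e. $b_{-m}=\overline{b_m}$ for all $m$, then $v(n,-m)=\overline{v(n,m)}$ for all $n\ge0$, $m\in\mathbb Z$; * (v) the map $(q,\epsilon)\mapsto v$ is a $C^1$ map from $\{|q|,|\epsilon|\le\min(c_0,\frac{c_1}{4C_0})\}$ into $\mathcal L_{\sigma_1,w}$. -/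

import Mathlib

namespace DrivenLattice

noncomputable section

/-! ### Weighted sequence spaces -/

/-- Admissible weight functions on the integers. -/
structure AdmissibleWeight where
  toFun : ℤ → ℝ
  one_le' : ∀ m, 1 ≤ toFun m
  submul' : ∀ m n, toFun m ≤ toFun (m - n) * toFun n

instance : CoeFun AdmissibleWeight (fun _ => ℤ → ℝ) := ⟨AdmissibleWeight.toFun⟩

/-- The weighted supremum over the lattice variable: `sup_{n ≥ 0} e^{σ n} |u(n,m)|`. -/
def rowSup (σ : ℝ) (u : ℕ → ℤ → ℂ) (m : ℤ) : ℝ :=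
  ⨆ n : ℕ, Real.exp (σ * n) * ‖u n m‖

/-- Membership in the weighted space: all the weighted suprema are finite, and they form a
sequence in the weighted `ℓ¹` space. -/
def MemSeq (σ : ℝ) (w : AdmissibleWeight) (u : ℕ → ℤ → ℂ) : Prop :=
  (∀ m : ℤ, BddAbove (Set.range fun n : ℕ => Real.exp (σ * n) * ‖u n m‖)) ∧
    Summable fun m : ℤ => w m * rowSup σ u m

theorem AdmissibleWeight.pos (w : AdmissibleWeight) (m : ℤ) : 0 < w m :=
  lt_of_lt_of_le one_pos (w.one_le' m)

theorem rowSup_nonneg (σ : ℝ) (u : ℕ → ℤ → ℂ) (m : ℤ) : 0 ≤ rowSup σ u m :=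
  Real.iSup_nonneg fun _ => by positivity

theorem rowSup_smul (σ : ℝ) (a : ℂ) (u : ℕ → ℤ → ℂ) (m : ℤ) :
    rowSup σ (a • u) m = ‖a‖ * rowSup σ u m := by
  unfold rowSup
  rw [Real.mul_iSup_of_nonneg (norm_nonneg a)]
  congr 1
  funext n
  simp only [Pi.smul_apply, smul_eq_mul, norm_mul]
  ring

theorem exp_norm_add_le (σ : ℝ) (u v : ℕ → ℤ → ℂ) (n : ℕ) (m : ℤ) :
    Real.exp (σ * n) * ‖(u + v) n m‖ ≤
      Real.exp (σ * n) * ‖u n m‖ + Real.exp (σ * n) * ‖v n m‖ := by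
  rw [← mul_add]
  exact mul_le_mul_of_nonneg_left (norm_add_le _ _) (Real.exp_pos _).le

theorem rowSup_add_le {σ : ℝ} {w : AdmissibleWeight} {u v : ℕ → ℤ → ℂ}
    (hu : MemSeq σ w u) (hv : MemSeq σ w v) (m : ℤ) :
    rowSup σ (u + v) m ≤ rowSup σ u m + rowSup σ v m :=
  ciSup_le fun n => (exp_norm_add_le σ u v n m).trans
    (add_le_add (le_ciSup (hu.1 m) n) (le_ciSup (hv.1 m) n))

theorem MemSeq.add {σ : ℝ} {w : AdmissibleWeight} {u v : ℕ → ℤ → ℂ}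
    (hu : MemSeq σ w u) (hv : MemSeq σ w v) : MemSeq σ w (u + v) := by
  refine ⟨fun m => ?_, ?_⟩
  · obtain ⟨A, hA⟩ := hu.1 m
    obtain ⟨B, hB⟩ := hv.1 m
    refine ⟨A + B, ?_⟩
    rintro _ ⟨n, rfl⟩
    exact (exp_norm_add_le σ u v n m).trans (add_le_add (hA ⟨n, rfl⟩) (hB ⟨n, rfl⟩))
  · refine Summable.of_nonneg_of_le
      (fun m => mul_nonneg (w.pos m).le (rowSup_nonneg _ _ _)) (fun m => ?_) (hu.2.add hv.2)
    rw [← mul_add]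
    exact mul_le_mul_of_nonneg_left (rowSup_add_le hu hv m) (w.pos m).le

theorem MemSeq.smul {σ : ℝ} {w : AdmissibleWeight} {u : ℕ → ℤ → ℂ} (a : ℂ)
    (hu : MemSeq σ w u) : MemSeq σ w (a • u) := by
  refine ⟨fun m => ?_, ?_⟩
  · obtain ⟨A, hA⟩ := hu.1 m
    refine ⟨‖a‖ * A, ?_⟩
    rintro _ ⟨n, rfl⟩
    have h := mul_le_mul_of_nonneg_left (hA ⟨n, rfl⟩) (norm_nonneg a)
    simp only [Pi.smul_apply, smul_eq_mul, norm_mul] at h ⊢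
    linarith
  · simp only [rowSup_smul]
    refine (hu.2.mul_left ‖a‖).congr fun m => ?_
    ring

/-- The weighted sequences, as a linear subspace of all maps `ℕ₀ × ℤ → ℂ`. -/
def seqSubmodule (σ : ℝ) (w : AdmissibleWeight) : Submodule ℂ (ℕ → ℤ → ℂ) where
  carrier := {u | MemSeq σ w u}
  add_mem' hu hv := MemSeq.add hu hv
  zero_mem' := by
    refine ⟨fun m => ⟨0, ?_⟩, ?_⟩
    · rintro _ ⟨n, rfl⟩
      simp
    · simp [rowSup, summable_zero]
  smul_mem' a _ hu := MemSeq.smul a hu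

/-- The space `𝓛_{σ,w}`.  (A separate type, so that its topology is that of the norm below and
not the one of pointwise convergence.) -/
def SeqSpace (σ : ℝ) (w : AdmissibleWeight) : Type := ↥(seqSubmodule σ w)

namespace SeqSpace

variable {σ : ℝ} {w : AdmissibleWeight}

instance : AddCommGroup (SeqSpace σ w) := inferInstanceAs (AddCommGroup ↥(seqSubmodule σ w))

instance : Module ℂ (SeqSpace σ w) := inferInstanceAs (Module ℂ ↥(seqSubmodule σ w))

instance : CoeFun (SeqSpace σ w) (fun _ => ℕ → ℤ → ℂ) := ⟨fun u => u.1⟩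

/-- `‖u‖_{σ,w} = ∑_m w(m) sup_{n ≥ 0} e^{σ n} |u(n,m)|`. -/
instance : Norm (SeqSpace σ w) := ⟨fun u => ∑' m : ℤ, w m * rowSup σ u m⟩

theorem norm_def (u : SeqSpace σ w) : ‖u‖ = ∑' m : ℤ, w m * rowSup σ u m := rfl

theorem normCore : NormedSpace.Core ℂ (SeqSpace σ w) where
  norm_nonneg u := tsum_nonneg fun m => mul_nonneg (w.pos m).le (rowSup_nonneg _ _ _)
  norm_smul a u := by
    have h : ((a • u : SeqSpace σ w) : ℕ → ℤ → ℂ) = a • (u : ℕ → ℤ → ℂ) := rfl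
    rw [norm_def, norm_def, ← tsum_mul_left, h]
    refine tsum_congr fun m => ?_
    rw [rowSup_smul]
    ring
  norm_triangle u v := by
    have h : ((u + v : SeqSpace σ w) : ℕ → ℤ → ℂ) = (u : ℕ → ℤ → ℂ) + (v : ℕ → ℤ → ℂ) := rfl
    rw [norm_def, norm_def, norm_def, ← u.2.2.tsum_add v.2.2, h]
    refine (MemSeq.add u.2 v.2).2.tsum_le_tsum (fun m => ?_) (u.2.2.add v.2.2)
    rw [← mul_add]
    exact mul_le_mul_of_nonneg_left (rowSup_add_le u.2 v.2 m) (w.pos m).le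
  norm_eq_zero_iff u := by
    constructor
    · intro h
      rw [norm_def] at h
      have h0 : ∀ m : ℤ, 0 ≤ w m * rowSup σ u m := fun m =>
        mul_nonneg (w.pos m).le (rowSup_nonneg _ _ _)
      have h1 := (hasSum_zero_iff_of_nonneg h0).1 (h ▸ u.2.2.hasSum)
      apply Subtype.ext
      funext n m
      have h2 : rowSup σ u m = 0 :=
        (mul_eq_zero.1 (congrFun h1 m)).resolve_left (w.pos m).ne'
      have h3 : Real.exp (σ * n) * ‖u.1 n m‖ ≤ 0 := h2 ▸ le_ciSup (u.2.1 m) n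
      exact norm_le_zero_iff.1 (nonpos_of_mul_nonpos_right h3 (Real.exp_pos _))
    · rintro rfl
      have h : ((0 : SeqSpace σ w) : ℕ → ℤ → ℂ) = 0 := rfl
      rw [norm_def, h]
      simp [rowSup]

instance : NormedAddCommGroup (SeqSpace σ w) := NormedAddCommGroup.ofCore normCore

instance : NormedSpace ℂ (SeqSpace σ w) := NormedSpace.ofCore normCore

end SeqSpace

/-! ### The force function and the nonlinear terms -/

/-- The Taylor coefficients (without factorials) of the force at `-c`. -/
def alpha (F : ℝ → ℝ) (c : ℝ) (k : ℕ) : ℝ := iteratedDeriv k F (-c)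

/-- The minimum of `1` and the radius of convergence of the Taylor series of `F` at `-c`. -/
def rhoF (F : ℝ → ℝ) (c : ℝ) : ℝ :=
  (min 1 (FormalMultilinearSeries.ofScalars ℝ
    (fun k : ℕ => alpha F c k / (k.factorial : ℝ))).radius).toReal

/-- Convolution of sequences indexed by the integers. -/
def conv (f g : ℤ → ℂ) (m : ℤ) : ℂ := ∑' l : ℤ, f (m - l) * g l

/-- The `k`-fold convolution of `f` with itself. -/
def convPow (f : ℤ → ℂ) : ℕ → ℤ → ℂ
  | 0 => fun m => if m = 0 then 1 else 0
  | k + 1 => conv (convPow f k) f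

/-- `(△u)(n,m) = u(n-1,m) - u(n,m)` for `n ≥ 1`, and `(△u)(0,m) = 0`. -/
def diff (u : ℕ → ℤ → ℂ) : ℕ → ℤ → ℂ
  | 0 => fun _ => 0
  | n + 1 => fun m => u n m - u (n + 1) m

/-- The nonlinear term `Y(u,v)`.  The sum runs over the powers `k + 2 ≥ 2`. -/
def nonlinY (F : ℝ → ℝ) (c : ℝ) (u v : ℕ → ℤ → ℂ) (n : ℕ) (m : ℤ) : ℂ :=
  if n = 0 then 0 else
    (1 / (alpha F c 1 : ℂ)) * ∑' k : ℕ,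
      ((alpha F c (k + 2) : ℂ) / ((k + 2).factorial : ℂ)) *
        (convPow (diff (u + v) n) (k + 2) m - convPow (diff u n) (k + 2) m)

/-- The nonlinear term `W(u,v)`. -/
def nonlinW (F : ℝ → ℝ) (c : ℝ) (u v : ℕ → ℤ → ℂ) (n : ℕ) (m : ℤ) : ℂ :=
  if n = 0 then 0 else nonlinY F c u v n m - nonlinY F c u v (n + 1) m

/-! ### The linearized lattice and the constants -/

/-- `δ_m = -2 + (mγ)² / F'(-c)`. -/
def delta (F : ℝ → ℝ) (c γ : ℝ) (m : ℤ) : ℝ := -2 + ((m : ℝ) * γ) ^ 2 / deriv F (-c)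

/-- The largest resonant Fourier mode `m₀`. -/
def m0 (F : ℝ → ℝ) (c γ : ℝ) : ℤ :=
  sSup {m : ℤ | 0 ≤ (γ * (m : ℝ)) ^ 2 / deriv F (-c) ∧ (γ * (m : ℝ)) ^ 2 / deriv F (-c) ≤ 4}

/-- The root of `z² + δ_m z + 1 = 0` with `|z| < 1`, when `δ_m > 2`, that is for `|m| > m₀`. -/
def zRoot (F : ℝ → ℝ) (c γ : ℝ) (m : ℤ) : ℝ :=
  -(delta F c γ m / 2) + Real.sqrt (delta F c γ m ^ 2 / 4 - 1)

/-- The phases of the resonant modes, `0 < |m| ≤ m₀`. -/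
def beta (F : ℝ → ℝ) (c γ : ℝ) (m : ℤ) : ℝ :=
  -((m.sign : ℤ) : ℝ) * Real.arccos (-(delta F c γ m / 2))

/-- The decay rate `σ₀`. -/
def sigma0 (F : ℝ → ℝ) (c γ : ℝ) : ℝ :=
  min 1 (-(1 / 2) * Real.log |zRoot F c γ (m0 F c γ + 1)|)

/-- The decay rate `σ₁`. -/
def sigma1 (F : ℝ → ℝ) (c γ : ℝ) : ℝ := 1 / 4 * sigma0 F c γ

/-- The constant `C_K`.  If `m₀ = 0`, the inner maximum is over the empty set and equals `0`,
so that `C_K` is the first of the two terms. -/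
def CK (F : ℝ → ℝ) (c γ : ℝ) : ℝ :=
  max
    ((1 + Real.exp (-2 * sigma0 F c γ)) / (1 - Real.exp (-4 * sigma0 F c γ)) *
      (1 / (Real.exp (sigma0 F c γ) - 1) + 1 / (1 - Real.exp (-2 * sigma0 F c γ))))
    (2 / (1 - Real.exp (-sigma1 F c γ)) *
      sSup ((fun m : ℤ => 1 / |Real.sin (beta F c γ m)|) '' Set.Ioc 0 (m0 F c γ)))

/-- The smallness threshold `c₁ = min (1 / (4 C_K C_F), ρ_F / 8)`. -/
def c1 (F : ℝ → ℝ) (c γ CF : ℝ) : ℝ := min (1 / (4 * CK F c γ * CF)) (rhoF F c / 8)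

/-- `ρ_u = ∑_{|m| > m₀} w(m) |u(0,m)|`. -/
def rhoU (F : ℝ → ℝ) (c γ : ℝ) (w : AdmissibleWeight) (u : ℕ → ℤ → ℂ) : ℝ :=
  ∑' m : ℤ, if m0 F c γ < |m| then w m * ‖u 0 m‖ else 0

/-- The reality condition `u(n,-m) = conj u(n,m)`. -/
def IsRealSeq (u : ℕ → ℤ → ℂ) : Prop :=
  ∀ (n : ℕ) (m : ℤ), u n (-m) = (starRingEnd ℂ) (u n m)

/-- The three properties that determine `v`: the lattice equation for the Fourier coefficients,
the bound, and the boundary values at the non-resonant modes. -/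
structure IsSolution (F : ℝ → ℝ) (c γ CF : ℝ) (w : AdmissibleWeight) (b : ℤ → ℂ)
    (u : ℕ → ℤ → ℂ) (ε : ℝ) (v : SeqSpace (sigma0 F c γ) w) : Prop where
  equation : ∀ (m : ℤ) (n : ℕ), 1 ≤ n →
    v (n - 1) m + (delta F c γ m : ℂ) * v n m + v (n + 1) m + nonlinW F c u v n m = 0
  bound : ‖v‖ ≤ 2 * (rhoU F c γ w u + |ε|) ∧
    2 * (rhoU F c γ w u + |ε|) ≤ c1 F c γ CF ∧ c1 F c γ CF ≤ rhoF F c / 8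
  boundary : ∀ m : ℤ, m0 F c γ < |m| → v 0 m = (ε : ℂ) * b m - u 0 m

end

end DrivenLattice

open DrivenLattice

/-! The linear part of the lattice equation is diagonal in m, and W is a difference, Y(n) - Y(n+1).
In each mode the recurrence is governed by the roots of ζ² + δ_m ζ + 1 = 0. If |m| > m₀, the roots
are z_m and 1/z_m with |z_m| < 1, and a decaying solution is fixed by its value at n = 0. If |m| ≤
m₀, the roots lie on the unit circle, no nonzero homogeneous solution decays, and the decaying
inhomogeneous solution is a sum from n to infinity with no boundary datum. For m = 0 the root 1 is
double, and only the difference form of W keeps the kernel of that sum bounded. Hence the problem is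
equivalent to the fixed point equation v = B + K Y(u,v) (`eq_fix_iff`), where B carries the boundary
values and K is bounded by 8 C_K at every decay rate between σ₁ and σ₀ (`eN_linSol_le`).

Decay rates add under products, because w is submultiplicative (`nrm_mul_le`). Up to notation,
Y(u,v) is △v times a divided difference of the nonlinear part of the force. The factor △v alone
supplies the decay. The divided difference needs none, and it is small because the power series
starts at order two. With C_F a fixed multiple of a weighted sum of Taylor coefficients, v ↦ K
Y(u,v) contracts by 1/2 on the ball of radius c₁, and the ball of radius 2(ρ_u + |ε|) is mapped into
itself. This gives existence and uniqueness. Reality follows from uniqueness, since the reflected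
conjugate of v solves the same problem.

The obstacle to differentiability is that u is C¹ only into a space of growing sequences, of rate -s
with s = σ₁. In every variation of Y with respect to u, however, a factor △v of rate σ₀ = 4s
survives. So the linearized equation is solved at rate 3s, while the Taylor remainder and the
variation of the tangent, where two growing factors can meet, are controlled at rate 2s, which
embeds into rate s. The estimates rest on exact divided difference identities and on absorbing the
contraction term (`le_of_add_half`), which is possible at every rate in [s, 4s]. The bounds
`exists_remainder_bound` and `exists_tangent_sub_bound` then feed the criterion
`contDiffOn_of_bounds`. -/

namespace DrivenLattice
noncomputable section
open scoped ENNReal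

/-! ### Extended-valued weighted norms -/

/-- Extended-valued version of `rowSup`. -/
def rowE (σ : ℝ) (x : ℕ → ℤ → ℂ) (m : ℤ) : ℝ≥0∞ :=
  ⨆ n : ℕ, ENNReal.ofReal (Real.exp (σ * n)) * ‖x n m‖ₑ

/-- Extended-valued version of the norm of `𝓛_{σ,w}`, defined for all sequences. -/
def eN (σ : ℝ) (w : AdmissibleWeight) (x : ℕ → ℤ → ℂ) : ℝ≥0∞ :=
  ∑' m : ℤ, ENNReal.ofReal (w m) * rowE σ x m

theorem le_rowE (σ : ℝ) (x : ℕ → ℤ → ℂ) (n : ℕ) (m : ℤ) :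
    ENNReal.ofReal (Real.exp (σ * n)) * ‖x n m‖ₑ ≤ rowE σ x m :=
  le_iSup (fun n : ℕ => ENNReal.ofReal (Real.exp (σ * n)) * ‖x n m‖ₑ) n

theorem ofReal_weight_ge (w : AdmissibleWeight) (m : ℤ) : 1 ≤ ENNReal.ofReal (w m) := by
  rw [← ENNReal.ofReal_one]
  exact ENNReal.ofReal_le_ofReal (w.one_le' m)

theorem rowE_le_eN (σ : ℝ) (w : AdmissibleWeight) (x : ℕ → ℤ → ℂ) (m : ℤ) :
    rowE σ x m ≤ eN σ w x := by
  refine le_trans ?_ (ENNReal.le_tsum m)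
  exact le_mul_of_one_le_left zero_le (ofReal_weight_ge w m)

theorem exp_mul_enorm_le_eN (σ : ℝ) (w : AdmissibleWeight) (x : ℕ → ℤ → ℂ) (n : ℕ) (m : ℤ) :
    ENNReal.ofReal (Real.exp (σ * n)) * ‖x n m‖ₑ ≤ eN σ w x :=
  (le_rowE σ x n m).trans (rowE_le_eN σ w x m)

theorem eN_le_of_rowE_le {σ τ : ℝ} {w : AdmissibleWeight} {x y : ℕ → ℤ → ℂ} {C : ℝ≥0∞}
    (h : ∀ m, rowE σ x m ≤ C * rowE τ y m) : eN σ w x ≤ C * eN τ w y := by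
  unfold eN
  rw [← ENNReal.tsum_mul_left]
  refine ENNReal.tsum_le_tsum fun m => ?_
  calc _ ≤ ENNReal.ofReal (w m) * (C * rowE τ y m) := by gcongr; exact h m
    _ = _ := by ring

theorem rowE_le_of_le {σ : ℝ} {x : ℕ → ℤ → ℂ} {m : ℤ} {C : ℝ≥0∞}
    (h : ∀ n : ℕ, ENNReal.ofReal (Real.exp (σ * n)) * ‖x n m‖ₑ ≤ C) : rowE σ x m ≤ C :=
  iSup_le h

theorem rowE_add_le (σ : ℝ) (x y : ℕ → ℤ → ℂ) (m : ℤ) :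
    rowE σ (x + y) m ≤ rowE σ x m + rowE σ y m := by
  refine rowE_le_of_le fun n => ?_
  calc _ ≤ ENNReal.ofReal (Real.exp (σ * n)) * (‖x n m‖ₑ + ‖y n m‖ₑ) := by
        gcongr; exact enorm_add_le _ _
    _ = ENNReal.ofReal (Real.exp (σ * n)) * ‖x n m‖ₑ
        + ENNReal.ofReal (Real.exp (σ * n)) * ‖y n m‖ₑ := mul_add _ _ _
    _ ≤ _ := add_le_add (le_rowE _ _ _ _) (le_rowE _ _ _ _)

theorem eN_add_le (σ : ℝ) (w : AdmissibleWeight) (x y : ℕ → ℤ → ℂ) :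
    eN σ w (x + y) ≤ eN σ w x + eN σ w y := by
  unfold eN
  rw [← ENNReal.tsum_add]
  refine ENNReal.tsum_le_tsum fun m => ?_
  rw [← mul_add]
  gcongr
  exact rowE_add_le σ x y m

theorem eN_smul_le (σ : ℝ) (w : AdmissibleWeight) (c : ℂ) (x : ℕ → ℤ → ℂ) :
    eN σ w (c • x) ≤ ‖c‖ₑ * eN σ w x := by
  refine eN_le_of_rowE_le fun m => rowE_le_of_le fun n => ?_
  calc _ = ‖c‖ₑ * (ENNReal.ofReal (Real.exp (σ * n)) * ‖x n m‖ₑ) := by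
        simp only [Pi.smul_apply, smul_eq_mul, enorm_mul]; ring
    _ ≤ _ := by gcongr; exact le_rowE _ _ _ _

theorem eN_neg (σ : ℝ) (w : AdmissibleWeight) (x : ℕ → ℤ → ℂ) : eN σ w (-x) = eN σ w x := by
  simp [eN, rowE]

theorem eN_sub_le (σ : ℝ) (w : AdmissibleWeight) (x y : ℕ → ℤ → ℂ) :
    eN σ w (x - y) ≤ eN σ w x + eN σ w y := by
  rw [sub_eq_add_neg, ← eN_neg σ w y]
  exact eN_add_le _ _ _ _

@[simp] theorem eN_zero (σ : ℝ) (w : AdmissibleWeight) : eN σ w 0 = 0 := by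
  simp [eN, rowE]

theorem eN_mono {σ τ : ℝ} (h : σ ≤ τ) (w : AdmissibleWeight) (x : ℕ → ℤ → ℂ) :
    eN σ w x ≤ eN τ w x := by
  rw [← one_mul (eN τ w x)]
  refine eN_le_of_rowE_le fun m => rowE_le_of_le fun n => ?_
  rw [one_mul]
  refine le_trans ?_ (le_rowE τ x n m)
  gcongr

/-- Allows passage to the constant weight in the reality argument, where w need not be symmetric. -/
theorem eN_mono_weight {w₁ w₂ : AdmissibleWeight} (h : ∀ m, w₁ m ≤ w₂ m) (σ : ℝ)
    (x : ℕ → ℤ → ℂ) : eN σ w₁ x ≤ eN σ w₂ x := by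
  refine ENNReal.tsum_le_tsum fun m => ?_
  gcongr
  exact h m

theorem eq_zero_of_eN_eq_zero {σ : ℝ} {w : AdmissibleWeight} {x : ℕ → ℤ → ℂ}
    (h : eN σ w x = 0) : x = 0 := by
  funext n m
  have h1 := exp_mul_enorm_le_eN σ w x n m
  rw [h, nonpos_iff_eq_zero, mul_eq_zero] at h1
  rcases h1 with h1 | h1
  · exact absurd h1 (by simp [Real.exp_pos])
  · simpa using h1

/-- Countable subadditivity. No summability is assumed: a divergent scalar series has `tsum` zero,
so the triangle inequality is only easier there. -/
theorem eN_tsum_le {ι : Type*} (σ : ℝ) (w : AdmissibleWeight) (f : ι → ℕ → ℤ → ℂ) :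
    eN σ w (fun n m => ∑' k, f k n m) ≤ ∑' k, eN σ w (f k) := by
  unfold eN
  rw [ENNReal.tsum_comm]
  refine ENNReal.tsum_le_tsum fun m => ?_
  rw [ENNReal.tsum_mul_left]
  gcongr
  refine rowE_le_of_le fun n => ?_
  calc _ ≤ ENNReal.ofReal (Real.exp (σ * n)) * ∑' k, ‖f k n m‖ₑ := by
        gcongr; exact enorm_tsum_le_tsum_enorm
    _ = ∑' k, ENNReal.ofReal (Real.exp (σ * n)) * ‖f k n m‖ₑ := ENNReal.tsum_mul_left.symm
    _ ≤ _ := ENNReal.tsum_le_tsum fun k => le_rowE _ _ _ _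

theorem rowE_eq_ofReal {σ : ℝ} {x : ℕ → ℤ → ℂ} {m : ℤ}
    (h : BddAbove (Set.range fun n : ℕ => Real.exp (σ * n) * ‖x n m‖)) :
    rowE σ x m = ENNReal.ofReal (rowSup σ x m) := by
  have e : ∀ n : ℕ, ENNReal.ofReal (Real.exp (σ * n)) * ‖x n m‖ₑ
      = ENNReal.ofReal (Real.exp (σ * n) * ‖x n m‖) := fun n => by
    rw [ENNReal.ofReal_mul (Real.exp_pos _).le, ofReal_norm]
  apply le_antisymm
  · refine rowE_le_of_le fun n => ?_
    rw [e]
    exact ENNReal.ofReal_le_ofReal (le_ciSup h n)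
  · by_cases ht : rowE σ x m = ⊤
    · simp [ht]
    · refine ENNReal.ofReal_le_of_le_toReal (ciSup_le fun n => ?_)
      rw [← ENNReal.ofReal_le_iff_le_toReal ht, ← e]
      exact le_rowE _ _ _ _

theorem bddAbove_of_rowE_ne_top {σ : ℝ} {x : ℕ → ℤ → ℂ} {m : ℤ} (h : rowE σ x m ≠ ⊤) :
    BddAbove (Set.range fun n : ℕ => Real.exp (σ * n) * ‖x n m‖) := by
  refine ⟨(rowE σ x m).toReal, ?_⟩
  rintro _ ⟨n, rfl⟩
  dsimp only
  rw [← ENNReal.ofReal_le_iff_le_toReal h, ENNReal.ofReal_mul (Real.exp_pos _).le, ofReal_norm]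
  exact le_rowE _ _ _ _

theorem eN_eq_ofReal {σ : ℝ} {w : AdmissibleWeight} {x : ℕ → ℤ → ℂ} (h : MemSeq σ w x) :
    eN σ w x = ENNReal.ofReal (∑' m : ℤ, w m * rowSup σ x m) := by
  rw [ENNReal.ofReal_tsum_of_nonneg
    (fun m => mul_nonneg (w.pos m).le (rowSup_nonneg _ _ _)) h.2]
  refine tsum_congr fun m => ?_
  rw [ENNReal.ofReal_mul (w.pos m).le, rowE_eq_ofReal (h.1 m)]

theorem memSeq_of_eN_ne_top {σ : ℝ} {w : AdmissibleWeight} {x : ℕ → ℤ → ℂ}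
    (h : eN σ w x ≠ ⊤) : MemSeq σ w x := by
  have hr : ∀ m, rowE σ x m ≠ ⊤ := fun m => ne_top_of_le_ne_top h (rowE_le_eN σ w x m)
  refine ⟨fun m => bddAbove_of_rowE_ne_top (hr m), ?_⟩
  refine (ENNReal.summable_toReal h).congr fun m => ?_
  rw [rowE_eq_ofReal (bddAbove_of_rowE_ne_top (hr m)), ENNReal.toReal_mul,
    ENNReal.toReal_ofReal (w.pos m).le, ENNReal.toReal_ofReal (rowSup_nonneg _ _ _)]

theorem SeqSpace.enorm_eq_eN {σ : ℝ} {w : AdmissibleWeight} (u : SeqSpace σ w) :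
    ‖u‖ₑ = eN σ w u := by
  rw [eN_eq_ofReal u.2, ← SeqSpace.norm_def, ofReal_norm]

theorem SeqSpace.eN_ne_top {σ : ℝ} {w : AdmissibleWeight} (u : SeqSpace σ w) :
    eN σ w u ≠ ⊤ := by
  rw [← SeqSpace.enorm_eq_eN]
  exact enorm_ne_top

/-- A sequence of finite norm, as an element of the space. -/
def SeqSpace.mk {σ : ℝ} {w : AdmissibleWeight} (x : ℕ → ℤ → ℂ) (h : eN σ w x ≠ ⊤) :
    SeqSpace σ w := ⟨x, memSeq_of_eN_ne_top h⟩

end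
end DrivenLattice

namespace DrivenLattice
noncomputable section
open scoped ENNReal

/-! ### The Wiener algebra -/

theorem tsum_conv_eq (p q : ℤ → ℝ≥0∞) :
    ∑' m : ℤ, ∑' l : ℤ, p (m - l) * q l = (∑' m, p m) * ∑' l, q l := by
  rw [ENNReal.tsum_comm, ← ENNReal.tsum_mul_left]
  refine tsum_congr fun l => ?_
  rw [ENNReal.tsum_mul_right]
  congr 1
  exact (Equiv.subRight l).tsum_eq p

theorem enorm_conv_le (f g : ℤ → ℂ) (m : ℤ) :
    ‖conv f g m‖ₑ ≤ ∑' l : ℤ, ‖f (m - l)‖ₑ * ‖g l‖ₑ := by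
  refine enorm_tsum_le_tsum_enorm.trans (le_of_eq (tsum_congr fun l => ?_))
  rw [enorm_mul]

/-- The absolutely summable sequences indexed by the integers, as an algebra under convolution. -/
def Wiener : Type := lp (fun _ : ℤ => ℂ) 1

namespace Wiener

instance : NormedAddCommGroup Wiener := inferInstanceAs (NormedAddCommGroup (lp (fun _ : ℤ => ℂ) 1))
instance : NormedSpace ℂ Wiener := inferInstanceAs (NormedSpace ℂ (lp (fun _ : ℤ => ℂ) 1))
instance : CompleteSpace Wiener := inferInstanceAs (CompleteSpace (lp (fun _ : ℤ => ℂ) 1))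

/-- The underlying sequence. -/
def toFun (f : Wiener) : ℤ → ℂ := Subtype.val (show lp (fun _ : ℤ => ℂ) 1 from f)

instance : CoeFun Wiener (fun _ => ℤ → ℂ) := ⟨toFun⟩

@[ext] theorem ext {f g : Wiener} (h : ∀ m, f m = g m) : f = g := Subtype.ext (funext h)

theorem memℓp_iff (f : ℤ → ℂ) : Memℓp f 1 ↔ Summable fun m => ‖f m‖ := by
  rw [memℓp_gen_iff (by simp)]
  simp

theorem summable_norm (f : Wiener) : Summable fun m => ‖f m‖ := (memℓp_iff _).1 f.2

/-- An absolutely summable sequence as an element of the Wiener algebra. -/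
def of (f : ℤ → ℂ) (h : Summable fun m => ‖f m‖) : Wiener := ⟨f, (memℓp_iff f).2 h⟩

@[simp] theorem of_apply (f : ℤ → ℂ) (h : Summable fun m => ‖f m‖) (m : ℤ) : of f h m = f m := rfl

theorem norm_eq (f : Wiener) : ‖f‖ = ∑' m, ‖f m‖ := by
  have := lp.norm_eq_tsum_rpow (p := 1) (by simp) (show lp (fun _ : ℤ => ℂ) 1 from f)
  simp only [ENNReal.toReal_one, Real.rpow_one, div_one] at this
  exact this

theorem tsum_enorm_ne_top (f : Wiener) : ∑' m, ‖f m‖ₑ ≠ ⊤ :=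
  tsum_enorm_ne_top_iff_summable_norm.2 f.summable_norm

theorem enorm_eq (f : Wiener) : ‖f‖ₑ = ∑' m, ‖f m‖ₑ := by
  rw [← ofReal_norm, norm_eq, ENNReal.ofReal_tsum_of_nonneg (fun _ => norm_nonneg _)
    f.summable_norm]
  simp

@[simp] theorem add_apply (f g : Wiener) (m : ℤ) : (f + g) m = f m + g m := rfl
@[simp] theorem sub_apply (f g : Wiener) (m : ℤ) : (f - g) m = f m - g m := rfl
@[simp] theorem zero_apply (m : ℤ) : (0 : Wiener) m = 0 := rfl
@[simp] theorem smul_apply (c : ℂ) (f : Wiener) (m : ℤ) : (c • f) m = c * f m := rfl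

theorem conv_tsum_enorm_le (f g : ℤ → ℂ) :
    ∑' m, ‖conv f g m‖ₑ ≤ (∑' m, ‖f m‖ₑ) * ∑' m, ‖g m‖ₑ :=
  (ENNReal.tsum_le_tsum fun m => enorm_conv_le f g m).trans
    (tsum_conv_eq (fun m => ‖f m‖ₑ) (fun m => ‖g m‖ₑ)).le

instance : Mul Wiener := ⟨fun f g => of (conv f g) (by
  rw [← tsum_enorm_ne_top_iff_summable_norm]
  exact ne_top_of_le_ne_top (ENNReal.mul_ne_top f.tsum_enorm_ne_top g.tsum_enorm_ne_top)
    (conv_tsum_enorm_le f g))⟩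

theorem mul_apply (f g : Wiener) (m : ℤ) :
    (f * g) m = ∑' l : ℤ, f (m - l) * g l := rfl

instance : One Wiener := ⟨of (fun m => if m = 0 then 1 else 0) (by
  refine summable_of_ne_finset_zero (s := {0}) fun m hm => ?_
  simp at hm
  simp [hm])⟩

theorem one_apply (m : ℤ) : (1 : Wiener) m = if m = 0 then 1 else 0 := rfl

theorem norm_apply_le (f : Wiener) (m : ℤ) : ‖f m‖ ≤ ‖f‖ := by
  rw [norm_eq]
  exact f.summable_norm.le_tsum m fun _ _ => norm_nonneg _

theorem summable_conv (f g : Wiener) (m : ℤ) : Summable fun l => f (m - l) * g l := by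
  refine Summable.of_norm_bounded (g.summable_norm.mul_left ‖f‖) fun l => ?_
  rw [norm_mul]
  gcongr
  exact norm_apply_le _ _

protected theorem mul_comm (f g : Wiener) : f * g = g * f := by
  ext m
  rw [mul_apply, mul_apply, ← (Equiv.subLeft m).tsum_eq]
  refine tsum_congr fun l => ?_
  simp [mul_comm]

protected theorem mul_add (f g h : Wiener) : f * (g + h) = f * g + f * h := by
  ext m
  simp only [mul_apply, add_apply]
  rw [← (summable_conv f g m).tsum_add (summable_conv f h m)]
  exact tsum_congr fun l => mul_add _ _ _

protected theorem mul_one (f : Wiener) : f * 1 = f := by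
  ext m
  rw [mul_apply, tsum_eq_single 0]
  · simp [one_apply]
  · intro l hl
    simp [one_apply, hl]

protected theorem mul_assoc (f g h : Wiener) : f * g * h = f * (g * h) := by
  ext m
  have key : Summable fun p : ℤ × ℤ => f (m - p.2) * (g (p.2 - p.1) * h p.1) := by
    have h1 : Summable fun p : ℤ × ℤ => ‖h p.1‖ * ‖g p.2‖ :=
      h.summable_norm.mul_of_nonneg g.summable_norm (fun _ => norm_nonneg _)
        (fun _ => norm_nonneg _)
    -- The shear (l, j) ↦ (l, j - l) turns the summable product ‖h l‖ ‖g j‖ into the double series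
    -- that justifies exchanging the two sums.
    let e : ℤ × ℤ ≃ ℤ × ℤ :=
      { toFun := fun p => (p.1, p.2 - p.1), invFun := fun p => (p.1, p.2 + p.1),
        left_inv := fun p => by simp, right_inv := fun p => by simp }
    refine Summable.of_norm_bounded ((e.summable_iff.2 h1).mul_left ‖f‖) fun p => ?_
    rw [norm_mul, norm_mul, mul_comm ‖g _‖]
    exact mul_le_mul_of_nonneg_right (norm_apply_le _ _) (by positivity)
  have e1 : (f * g * h) m = ∑' l, ∑' j, f (m - j) * (g (j - l) * h l) := by
    rw [mul_apply]
    refine tsum_congr fun l => ?_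
    rw [mul_apply, ← tsum_mul_right, ← (Equiv.subRight l).tsum_eq]
    refine tsum_congr fun j => ?_
    simp only [Equiv.subRight_apply]
    rw [show m - l - (j - l) = m - j by ring]
    ring
  have e2 : (f * (g * h)) m = ∑' j, ∑' l, f (m - j) * (g (j - l) * h l) := by
    rw [mul_apply]
    refine tsum_congr fun j => ?_
    rw [mul_apply, ← tsum_mul_left]
  rw [e1, e2]
  exact (Summable.tsum_comm (f := fun j l => f (m - j) * (g (j - l) * h l)) key.prod_symm)

instance : NormedCommRing Wiener :=
  { (inferInstance : NormedAddCommGroup Wiener) with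
    mul_assoc := Wiener.mul_assoc
    mul_comm := Wiener.mul_comm
    left_distrib := Wiener.mul_add
    right_distrib := fun f g h => by
      rw [Wiener.mul_comm, Wiener.mul_add, Wiener.mul_comm f, Wiener.mul_comm g]
    one_mul := fun f => by rw [Wiener.mul_comm, Wiener.mul_one]
    mul_one := Wiener.mul_one
    zero_mul := fun f => by ext m; simp [mul_apply]
    mul_zero := fun f => by ext m; simp [mul_apply]
    norm_mul_le := fun f g => by
      have h := conv_tsum_enorm_le f g
      rw [← enorm_eq, ← enorm_eq] at h
      have h2 : ‖f * g‖ₑ ≤ ‖f‖ₑ * ‖g‖ₑ := by rw [enorm_eq (f * g)]; exact h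
      have h3 := ENNReal.toReal_mono (ENNReal.mul_ne_top enorm_ne_top enorm_ne_top) h2
      simpa using h3 }

theorem smul_mul' (c : ℂ) (f g : Wiener) : c • f * g = c • (f * g) := by
  ext m
  simp only [mul_apply, smul_apply, ← tsum_mul_left]
  exact tsum_congr fun l => mul_assoc _ _ _

instance : Algebra ℂ Wiener := Algebra.ofModule smul_mul' (fun c f g => by
  rw [mul_comm, smul_mul', mul_comm])

/-- Evaluation of a coefficient, as a continuous linear map. -/
def coeff (m : ℤ) : Wiener →L[ℂ] ℂ :=
  LinearMap.mkContinuous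
    { toFun := fun f => f m, map_add' := fun _ _ => rfl, map_smul' := fun _ _ => rfl } 1
    (fun f => by rw [one_mul]; exact norm_apply_le f m)

theorem convPow_eq (f : Wiener) (k : ℕ) : convPow f k = ((f ^ k : Wiener) : ℤ → ℂ) := by
  induction k with
  | zero => rw [pow_zero]; rfl
  | succ k ih => rw [pow_succ]; change conv (convPow f k) f = _; rw [ih]; rfl

end Wiener

end
end DrivenLattice

namespace DrivenLattice
noncomputable section
open scoped ENNReal
open Finset

/-! ### Sequences in the Wiener algebra -/

/-- Sequences on the lattice with values in the Wiener algebra, a commutative ring. -/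
abbrev WSeq : Type := ℕ → Wiener

/-- The underlying map `ℕ₀ × ℤ → ℂ`. -/
def raw (x : WSeq) : ℕ → ℤ → ℂ := fun n m => x n m

@[simp] theorem raw_apply (x : WSeq) (n : ℕ) (m : ℤ) : raw x n m = x n m := rfl

theorem raw_injective : Function.Injective raw := fun _ _ h =>
  funext fun n => Wiener.ext fun m => congrFun (congrFun h n) m

/-- The weighted norm of a sequence in the Wiener algebra. -/
def nrm (σ : ℝ) (w : AdmissibleWeight) (x : WSeq) : ℝ≥0∞ := eN σ w (raw x)

section Norm
variable {σ τ : ℝ} {w : AdmissibleWeight}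

theorem nrm_add_le (x y : WSeq) : nrm σ w (x + y) ≤ nrm σ w x + nrm σ w y := eN_add_le _ _ _ _
theorem nrm_sub_le (x y : WSeq) : nrm σ w (x - y) ≤ nrm σ w x + nrm σ w y := eN_sub_le _ _ _ _
theorem nrm_smul_le (c : ℂ) (x : WSeq) : nrm σ w (c • x) ≤ ‖c‖ₑ * nrm σ w x := eN_smul_le _ _ _ _
@[simp] theorem nrm_zero : nrm σ w 0 = 0 := eN_zero _ _
theorem nrm_mono (h : σ ≤ τ) (x : WSeq) : nrm σ w x ≤ nrm τ w x := eN_mono h _ _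

theorem eq_zero_of_nrm_eq_zero {x : WSeq} (h : nrm σ w x = 0) : x = 0 :=
  raw_injective (eq_zero_of_eN_eq_zero h)

/-- The exponential splits as e^{(σ+τ)n} = e^{σn} e^{τn}, the weight as w(m) ≤ w(m-l) w(l), and the
double sum factors by Tonelli. The rates may be negative: multiplying by a growing sequence costs
exactly its growth rate. -/
theorem nrm_mul_le (x y : WSeq) : nrm (σ + τ) w (x * y) ≤ nrm σ w x * nrm τ w y := by
  unfold nrm eN
  rw [← tsum_conv_eq]
  refine ENNReal.tsum_le_tsum fun m => ?_
  have h : rowE (σ + τ) (raw (x * y)) m ≤ ∑' l : ℤ, rowE σ (raw x) (m - l) * rowE τ (raw y) l := by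
    refine rowE_le_of_le fun n => ?_
    have hm : raw (x * y) n m = conv (x n) (y n) m := rfl
    rw [hm]
    calc _ ≤ ENNReal.ofReal (Real.exp ((σ + τ) * n)) * ∑' l : ℤ, ‖x n (m - l)‖ₑ * ‖y n l‖ₑ := by
          gcongr; exact enorm_conv_le _ _ _
      _ = ∑' l : ℤ, (ENNReal.ofReal (Real.exp (σ * n)) * ‖x n (m - l)‖ₑ)
            * (ENNReal.ofReal (Real.exp (τ * n)) * ‖y n l‖ₑ) := by
          rw [← ENNReal.tsum_mul_left, add_mul, Real.exp_add,
            ENNReal.ofReal_mul (Real.exp_pos _).le]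
          exact tsum_congr fun l => by ring
      _ ≤ _ := ENNReal.tsum_le_tsum fun l =>
          mul_le_mul' (le_rowE σ (raw x) n (m - l)) (le_rowE τ (raw y) n l)
  calc _ ≤ ENNReal.ofReal (w m) * ∑' l : ℤ, rowE σ (raw x) (m - l) * rowE τ (raw y) l := by gcongr
    _ ≤ _ := by
      rw [← ENNReal.tsum_mul_left]
      refine ENNReal.tsum_le_tsum fun l => ?_
      calc _ ≤ ENNReal.ofReal (w (m - l) * w l)
            * (rowE σ (raw x) (m - l) * rowE τ (raw y) l) := by
            gcongr; exact w.submul' m l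
        _ = _ := by rw [ENNReal.ofReal_mul (w.pos _).le]; ring

theorem enorm_apply_le_nrm (x : WSeq) (n : ℕ) : ‖x n‖ₑ ≤ nrm 0 w x := by
  rw [Wiener.enorm_eq]
  refine ENNReal.tsum_le_tsum fun m => ?_
  have h := le_rowE 0 (raw x) n m
  simp only [zero_mul, Real.exp_zero, ENNReal.ofReal_one, one_mul] at h
  exact h.trans (le_mul_of_one_le_left zero_le (ofReal_weight_ge w m))

/-- The unit is constant in n and supported at m = 0. It serves as a test sequence that recovers
pointwise norms from multiplication bounds. -/
theorem nrm_one_ne_top : nrm 0 w 1 ≠ ⊤ := by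
  unfold nrm eN
  rw [tsum_eq_single 0]
  · refine ENNReal.mul_ne_top ENNReal.ofReal_ne_top (ne_top_of_le_ne_top ENNReal.one_ne_top ?_)
    refine rowE_le_of_le fun n => ?_
    have h : (1 : Wiener) 0 = 1 := by rw [Wiener.one_apply, if_pos rfl]
    simp [h]
  · intro m hm
    have h : rowE 0 (raw 1) m = 0 := by
      refine nonpos_iff_eq_zero.1 (rowE_le_of_le fun n => ?_)
      have h : (1 : Wiener) m = 0 := by rw [Wiener.one_apply, if_neg hm]
      simp [h]
    rw [h, mul_zero]

end Norm

/-- The sequence in the Wiener algebra given by a map `ℕ₀ × ℤ → ℂ`, with the rows that are not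
summable replaced by zero. -/
def lift (f : ℕ → ℤ → ℂ) : WSeq := fun n =>
  open Classical in if h : Summable fun m => ‖f n m‖ then Wiener.of (f n) h else 0

theorem nrm_lift_le (σ : ℝ) (w : AdmissibleWeight) (f : ℕ → ℤ → ℂ) :
    nrm σ w (lift f) ≤ eN σ w f := by
  rw [← one_mul (eN σ w f)]
  refine eN_le_of_rowE_le fun m => rowE_le_of_le fun n => ?_
  rw [one_mul]
  refine le_trans ?_ (le_rowE σ f n m)
  gcongr
  rw [raw_apply, lift]
  split_ifs
  · rfl
  · simp

/-- Since w ≥ 1 and the exponential factor is positive, a finite norm makes every row absolutely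
summable, so the default branch of `lift` is never taken. -/
theorem raw_lift {σ : ℝ} {w : AdmissibleWeight} {f : ℕ → ℤ → ℂ} (h : eN σ w f ≠ ⊤) :
    raw (lift f) = f := by
  funext n m
  have hs : Summable fun m => ‖f n m‖ := by
    rw [← tsum_enorm_ne_top_iff_summable_norm]
    have h1 : ENNReal.ofReal (Real.exp (σ * n)) * ∑' m, ‖f n m‖ₑ ≤ eN σ w f := by
      rw [← ENNReal.tsum_mul_left]
      refine ENNReal.tsum_le_tsum fun m => (le_rowE σ f n m).trans ?_
      exact le_mul_of_one_le_left zero_le (ofReal_weight_ge w m)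
    intro ht
    rw [ht, ENNReal.mul_top (by simp [Real.exp_pos])] at h1
    exact h (top_le_iff.1 h1)
  rw [raw_apply, lift, dif_pos hs, Wiener.of_apply]

/-- Multiplication by `h` shifts the decay rate by `σ` and is bounded by `C`. -/
def MulBound (w : AdmissibleWeight) (σ : ℝ) (C : ℝ≥0∞) (h : WSeq) : Prop :=
  ∀ (τ : ℝ) (z : WSeq), nrm (τ + σ) w (z * h) ≤ C * nrm τ w z

namespace MulBound
variable {w : AdmissibleWeight} {σ σ' : ℝ} {C C' : ℝ≥0∞} {h h' : WSeq}

theorem of_nrm (w : AdmissibleWeight) (σ : ℝ) (h : WSeq) : MulBound w σ (nrm σ w h) h :=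
  fun _ z => (nrm_mul_le z h).trans (mul_comm _ _).le

theorem of_nrm_le (hC : nrm σ w h ≤ C) : MulBound w σ C h :=
  fun τ z => (of_nrm w σ h τ z).trans (by gcongr)

theorem mono (H : MulBound w σ C h) (hC : C ≤ C') : MulBound w σ C' h :=
  fun τ z => (H τ z).trans (by gcongr)

/-- The reason for operator bounds instead of norms: the norm of the unit is w(0), which may exceed
1, whereas multiplication by it costs nothing. Powers then have bound C^i for every i, including i =
0. -/
theorem one : MulBound w 0 1 1 := fun _ z => by simp

theorem zero : MulBound w σ 0 0 := fun _ z => by simp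

theorem add (H : MulBound w σ C h) (H' : MulBound w σ C' h') : MulBound w σ (C + C') (h + h') :=
  fun τ z => by
    rw [mul_add, add_mul]
    exact (nrm_add_le _ _).trans (add_le_add (H τ z) (H' τ z))

theorem mul (H : MulBound w σ C h) (H' : MulBound w 0 C' h') : MulBound w σ (C * C') (h * h') :=
  fun τ z => by
    have := H' (τ + σ) (z * h)
    rw [add_zero] at this
    rw [← mul_assoc]
    refine this.trans ?_
    calc _ ≤ C' * (C * nrm τ w z) := by gcongr; exact H τ z
      _ = _ := by ring

theorem mul' (H : MulBound w 0 C h) (H' : MulBound w σ C' h') : MulBound w σ (C * C') (h * h') := by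
  rw [mul_comm h, mul_comm C]
  exact H'.mul H

theorem smul (c : ℂ) (H : MulBound w σ C h) : MulBound w σ (‖c‖ₑ * C) (c • h) := fun τ z => by
  rw [mul_smul_comm, mul_assoc]
  exact (nrm_smul_le _ _).trans (by gcongr; exact H τ z)

theorem sum {ι : Type*} {s : Finset ι} {C : ι → ℝ≥0∞} {h : ι → WSeq}
    (H : ∀ i ∈ s, MulBound w σ (C i) (h i)) : MulBound w σ (∑ i ∈ s, C i) (∑ i ∈ s, h i) := by
  classical
  induction s using Finset.induction_on with
  | empty => simpa using zero
  | insert a s ha ih =>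
    rw [Finset.sum_insert ha, Finset.sum_insert ha]
    exact (H a (by simp)).add (ih fun i hi => H i (by simp [hi]))

theorem pow (H : MulBound w 0 C h) (i : ℕ) : MulBound w 0 (C ^ i) (h ^ i) := by
  induction i with
  | zero => simpa using one
  | succ i ih => rw [pow_succ, pow_succ]; exact ih.mul H

/-- The sum converges only componentwise in n. The coefficient functionals are continuous, so it can
be evaluated entrywise, and countable subadditivity of `eN` does the rest. -/
theorem tsum {C : ℕ → ℝ≥0∞} {h : ℕ → WSeq} (hs : Summable h)
    (H : ∀ k, MulBound w σ (C k) (h k)) : MulBound w σ (∑' k, C k) (∑' k, h k) := fun τ z => by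
  have e : raw (z * ∑' k, h k) = fun n m => ∑' k, raw (z * h k) n m := by
    funext n m
    have hn : Summable fun k => h k n := Pi.summable.1 hs n
    have e1 : (z * ∑' k, h k) n = ∑' k, z n * h k n := by
      rw [hn.tsum_mul_left, Pi.mul_apply, tsum_apply hs]
    rw [raw_apply, e1]
    exact (Wiener.coeff m).map_tsum (hn.mul_left (z n))
  unfold nrm
  rw [e]
  refine (eN_tsum_le _ _ _).trans ?_
  rw [← ENNReal.tsum_mul_right]
  exact ENNReal.tsum_le_tsum fun k => H k τ z

/-- Testing each bound on z = 1 at rate 0 controls every component of h k by C k times a fixed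
finite number. -/
theorem summable {C : ℕ → ℝ≥0∞} {h : ℕ → WSeq} (H : ∀ k, MulBound w 0 (C k) (h k))
    (hC : ∑' k, C k ≠ ⊤) : Summable h := by
  rw [Pi.summable]
  intro n
  apply Summable.of_norm
  rw [← tsum_enorm_ne_top_iff_summable_norm]
  refine ne_top_of_le_ne_top (ENNReal.mul_ne_top hC (nrm_one_ne_top (w := w))) ?_
  rw [← ENNReal.tsum_mul_right]
  refine ENNReal.tsum_le_tsum fun k => (enorm_apply_le_nrm (w := w) (h k) n).trans ?_
  have := H k 0 1
  rwa [one_mul, add_zero] at this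

end MulBound

/-! ### Divided differences of powers and of power series -/

/-- The complete homogeneous polynomial of degree `k` in two variables. -/
def hom₂ (k : ℕ) (x y : WSeq) : WSeq := ∑ p ∈ antidiagonal k, x ^ p.1 * y ^ p.2

/-- The complete homogeneous polynomial of degree `k` in three variables. -/
def hom₃ (k : ℕ) (x y z : WSeq) : WSeq := ∑ p ∈ antidiagonal k, hom₂ p.1 x y * z ^ p.2

theorem hom₂_comm (k : ℕ) (x y : WSeq) : hom₂ k x y = hom₂ k y x := by
  unfold hom₂
  rw [← Finset.Nat.sum_antidiagonal_swap]
  exact Finset.sum_congr rfl fun p _ => mul_comm _ _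

theorem sub_mul_hom₂ (k : ℕ) (x y : WSeq) :
    (x - y) * hom₂ k x y = x ^ (k + 1) - y ^ (k + 1) := by
  induction k with
  | zero => simp [hom₂]
  | succ k ih =>
    have h : hom₂ (k + 1) x y = y ^ (k + 1) + x * hom₂ k x y := by
      unfold hom₂
      rw [Finset.Nat.sum_antidiagonal_succ, Finset.mul_sum]
      simp [pow_succ', mul_assoc]
    rw [h, mul_add, mul_left_comm, ih]
    ring

theorem sub_mul_hom₃ (k : ℕ) (x y z : WSeq) :
    (x - y) * hom₃ k x y z = hom₂ (k + 1) x z - hom₂ (k + 1) y z := by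
  unfold hom₃ hom₂
  rw [Finset.Nat.sum_antidiagonal_succ, Finset.Nat.sum_antidiagonal_succ, Finset.mul_sum,
    pow_zero, pow_zero, add_sub_add_left_eq_sub, ← Finset.sum_sub_distrib]
  refine Finset.sum_congr rfl fun p _ => ?_
  rw [← mul_assoc, ← sub_mul, ← sub_mul_hom₂]
  rfl

/-- The two arguments are changed one at a time, through the intermediate value at (x', y). -/
theorem hom₂_sub_hom₂ (k : ℕ) (x y x' y' : WSeq) :
    hom₂ (k + 1) x y - hom₂ (k + 1) x' y'
      = (x - x') * hom₃ k x x' y + (y - y') * hom₃ k y y' x' := by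
  rw [sub_mul_hom₃, sub_mul_hom₃, hom₂_comm _ y x', hom₂_comm _ y' x']
  ring

section HomBounds
variable {w : AdmissibleWeight} {σ : ℝ} {r L : ℝ≥0∞} {x y z x' y' z' : WSeq}

theorem mulBound_hom₂ (hx : MulBound w 0 r x) (hy : MulBound w 0 r y) (k : ℕ) :
    MulBound w 0 ((k + 1) * r ^ k) (hom₂ k x y) := by
  unfold hom₂
  refine MulBound.mono (C := ∑ p ∈ antidiagonal k, r ^ k) (MulBound.sum fun p hp => ?_)
    (le_of_eq (by simp))
  rw [← Finset.HasAntidiagonal.mem_antidiagonal.1 hp, pow_add]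
  exact (hx.pow p.1).mul (hy.pow p.2)

theorem mulBound_hom₃ (hx : MulBound w 0 r x) (hy : MulBound w 0 r y) (hz : MulBound w 0 r z)
    (k : ℕ) : MulBound w 0 ((k + 1) * ((k + 1) * r ^ k)) (hom₃ k x y z) := by
  unfold hom₃
  refine MulBound.mono (C := ∑ p ∈ antidiagonal k, (k + 1) * r ^ k)
    (MulBound.sum fun p hp => ?_) (le_of_eq (by simp))
  refine ((mulBound_hom₂ hx hy p.1).mul (hz.pow p.2)).mono ?_
  rw [mul_assoc, ← pow_add, Finset.HasAntidiagonal.mem_antidiagonal.1 hp]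
  gcongr
  exact le_of_add_le_left (Finset.HasAntidiagonal.mem_antidiagonal.1 hp).le

/-- Exactly one factor of each telescoped monomial is the difference, so the rate σ occurs once.
Writing its bound as r * L turns i r^(i-1) (r L) into i r^i L and avoids the exponent i - 1. -/
theorem mulBound_pow_sub (hx : MulBound w 0 r x) (hx' : MulBound w 0 r x')
    (h : MulBound w σ (r * L) (x - x')) (i : ℕ) :
    MulBound w σ (i * (r ^ i * L)) (x ^ i - x' ^ i) := by
  induction i with
  | zero => simpa using MulBound.zero
  | succ i ih =>
    have e : x ^ (i + 1) - x' ^ (i + 1) = x * (x ^ i - x' ^ i) + (x - x') * x' ^ i := by ring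
    rw [e]
    refine ((hx.mul' ih).add (h.mul (hx'.pow i))).mono (le_of_eq ?_)
    push_cast
    ring

theorem mulBound_hom₂_sub (hx : MulBound w 0 r x) (hx' : MulBound w 0 r x')
    (hy : MulBound w 0 r y) (hy' : MulBound w 0 r y')
    (h : MulBound w σ (r * L) (x - x')) (h' : MulBound w σ (r * L) (y - y')) (k : ℕ) :
    MulBound w σ ((k + 1) * (k * (r ^ k * L))) (hom₂ k x y - hom₂ k x' y') := by
  unfold hom₂
  rw [← Finset.sum_sub_distrib]
  have e : ∀ p : ℕ × ℕ, x ^ p.1 * y ^ p.2 - x' ^ p.1 * y' ^ p.2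
      = (x ^ p.1 - x' ^ p.1) * y ^ p.2 + x' ^ p.1 * (y ^ p.2 - y' ^ p.2) := fun p => by ring
  refine MulBound.mono (C := ∑ p ∈ antidiagonal k, k * (r ^ k * L))
    (MulBound.sum fun p hp => ?_) (le_of_eq (by simp))
  rw [e]
  refine (((mulBound_pow_sub hx hx' h p.1).mul (hy.pow p.2)).add
    ((hx'.pow p.1).mul' (mulBound_pow_sub hy hy' h' p.2))).mono (le_of_eq ?_)
  rw [← Finset.HasAntidiagonal.mem_antidiagonal.1 hp, pow_add]
  push_cast
  ring

theorem mulBound_hom₃_sub (hx : MulBound w 0 r x) (hx' : MulBound w 0 r x')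
    (hy : MulBound w 0 r y) (hy' : MulBound w 0 r y') (hz : MulBound w 0 r z)
    (hz' : MulBound w 0 r z') (h : MulBound w σ (r * L) (x - x'))
    (h' : MulBound w σ (r * L) (y - y')) (h'' : MulBound w σ (r * L) (z - z')) (k : ℕ) :
    MulBound w σ ((k + 1) * ((k + 1) * (k * (r ^ k * L)))) (hom₃ k x y z - hom₃ k x' y' z') := by
  unfold hom₃
  rw [← Finset.sum_sub_distrib]
  have e : ∀ p : ℕ × ℕ, hom₂ p.1 x y * z ^ p.2 - hom₂ p.1 x' y' * z' ^ p.2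
      = (hom₂ p.1 x y - hom₂ p.1 x' y') * z ^ p.2
        + hom₂ p.1 x' y' * (z ^ p.2 - z' ^ p.2) := fun p => by ring
  refine MulBound.mono (C := ∑ p ∈ antidiagonal k, (k + 1) * (k * (r ^ k * L)))
    (MulBound.sum fun p hp => ?_) (le_of_eq (by simp))
  rw [e]
  refine (((mulBound_hom₂_sub hx hx' hy hy' h h' p.1).mul (hz.pow p.2)).add
    ((mulBound_hom₂ hx' hy' p.1).mul' (mulBound_pow_sub hz hz' h'' p.2))).mono ?_
  calc _ = (p.1 + 1) * (((p.1 + p.2 : ℕ) : ℝ≥0∞) * (r ^ (p.1 + p.2) * L)) := by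
        rw [pow_add]; push_cast; ring
    _ ≤ _ := by
        rw [Finset.HasAntidiagonal.mem_antidiagonal.1 hp]
        gcongr
        exact le_of_add_le_left (Finset.HasAntidiagonal.mem_antidiagonal.1 hp).le

end HomBounds

end
end DrivenLattice

namespace DrivenLattice
noncomputable section
open scoped ENNReal

/-! ### Power series and their divided differences -/

/-- The weighted sum of the moduli of the coefficients that controls the power series and its
divided differences on the ball of radius `r`. -/
def coefSum (c : ℕ → ℂ) (r : ℝ≥0∞) : ℝ≥0∞ := ∑' k : ℕ, ‖c k‖ₑ * ((k + 2) ^ 3 * r ^ k)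

/-- The power series `∑ c_k x^{k+2}`. -/
def ser (c : ℕ → ℂ) (x : WSeq) : WSeq := ∑' k : ℕ, c k • x ^ (k + 2)

/-- The divided difference of `ser c`. -/
def serDiv (c : ℕ → ℂ) (x y : WSeq) : WSeq := ∑' k : ℕ, c k • hom₂ (k + 1) x y

/-- The divided difference of `a ↦ serDiv c (a + b) a`. -/
def serMix (c : ℕ → ℂ) (a a' b : WSeq) : WSeq :=
  ∑' k : ℕ, c k • (hom₃ k (a' + b) (a + b) a' + hom₃ k a' a (a + b))

section
variable {w : AdmissibleWeight} {σ : ℝ} {c : ℕ → ℂ} {r s L : ℝ≥0∞}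

/-- Every term estimate is brought into the form of a constant times the k-th term of `coefSum`, so
that a single convergent series majorizes all the power series that occur. -/
theorem mulBound_coef {C : ℝ≥0∞} {f : WSeq} {k : ℕ} {B : ℝ≥0∞}
    (H : MulBound w σ C f) (hC : C ≤ (k + 2) ^ 3 * r ^ k * B) :
    MulBound w σ (B * (‖c k‖ₑ * ((k + 2) ^ 3 * r ^ k))) (c k • f) := by
  refine (H.smul (c k)).mono ?_
  calc _ ≤ ‖c k‖ₑ * ((k + 2) ^ 3 * r ^ k * B) := by gcongr
    _ = _ := by ring

theorem one_le_natCast_add (k : ℕ) : (1 : ℝ≥0∞) ≤ k + 2 :=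
  le_add_left (by norm_num)

theorem mulBound_ser_term {x : WSeq} (hx : MulBound w 0 r x) (k : ℕ) :
    MulBound w 0 (r ^ 2 * (‖c k‖ₑ * ((k + 2) ^ 3 * r ^ k))) (c k • x ^ (k + 2)) := by
  refine mulBound_coef (hx.pow _) ?_
  rw [pow_add, mul_assoc]
  exact le_mul_of_one_le_left zero_le (one_le_pow₀ (one_le_natCast_add k))

/-- The degree k + 1 is at least one, so a factor s can be kept outside while the other powers are
enlarged to r^k. This linear factor makes the nonlinearity small on small balls. -/
theorem mulBound_serDiv_term {x y : WSeq} (hs : s ≤ r) (hx : MulBound w 0 s x)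
    (hy : MulBound w 0 s y) (k : ℕ) :
    MulBound w 0 (s * (‖c k‖ₑ * ((k + 2) ^ 3 * r ^ k))) (c k • hom₂ (k + 1) x y) := by
  refine mulBound_coef (mulBound_hom₂ hx hy _) ?_
  have h1 := one_le_natCast_add k
  calc (((k + 1 : ℕ) : ℝ≥0∞) + 1) * s ^ (k + 1) = (k + 2) * 1 * (s ^ k * s) := by
        push_cast; ring
    _ ≤ (k + 2) * (k + 2) ^ 2 * (r ^ k * s) := by gcongr; exact one_le_pow₀ h1
    _ = _ := by ring

theorem mulBound_serMix_term {x y z x' y' z' : WSeq} (hx : MulBound w 0 r x)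
    (hy : MulBound w 0 r y) (hz : MulBound w 0 r z) (hx' : MulBound w 0 r x')
    (hy' : MulBound w 0 r y') (hz' : MulBound w 0 r z') (k : ℕ) :
    MulBound w 0 (2 * (‖c k‖ₑ * ((k + 2) ^ 3 * r ^ k)))
      (c k • (hom₃ k x y z + hom₃ k x' y' z')) := by
  refine mulBound_coef ((mulBound_hom₃ hx hy hz k).add (mulBound_hom₃ hx' hy' hz' k)) ?_
  have h1 := one_le_natCast_add k
  calc _ = (((k : ℝ≥0∞) + 1) * (k + 1) * 1) * r ^ k * 2 := by ring
    _ ≤ ((k + 2) * (k + 2) * (k + 2)) * r ^ k * 2 := by gcongr <;> norm_num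
    _ = _ := by ring

theorem tsum_coef_ne_top {B : ℝ≥0∞} (hB : B ≠ ⊤) (hA : coefSum c r ≠ ⊤) :
    ∑' k : ℕ, B * (‖c k‖ₑ * ((k + 2) ^ 3 * r ^ k)) ≠ ⊤ := by
  rw [ENNReal.tsum_mul_left]
  exact ENNReal.mul_ne_top hB hA

theorem summable_ser (hr : r ≠ ⊤) (hA : coefSum c r ≠ ⊤) {x : WSeq} (hx : MulBound w 0 r x) :
    Summable fun k => c k • x ^ (k + 2) :=
  MulBound.summable (mulBound_ser_term hx) (tsum_coef_ne_top (by simp [hr]) hA)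

theorem summable_serDiv (hr : r ≠ ⊤) (hA : coefSum c r ≠ ⊤) {x y : WSeq} (hx : MulBound w 0 r x)
    (hy : MulBound w 0 r y) : Summable fun k => c k • hom₂ (k + 1) x y :=
  MulBound.summable (mulBound_serDiv_term le_rfl hx hy) (tsum_coef_ne_top hr hA)

theorem summable_serMix (hA : coefSum c r ≠ ⊤) {a a' b : WSeq}
    (ha : MulBound w 0 r a) (ha' : MulBound w 0 r a') (hb : MulBound w 0 r (a + b))
    (hb' : MulBound w 0 r (a' + b)) :
    Summable fun k => c k • (hom₃ k (a' + b) (a + b) a' + hom₃ k a' a (a + b)) :=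
  MulBound.summable (mulBound_serMix_term hb' hb ha' ha' ha hb) (tsum_coef_ne_top (by simp) hA)

theorem WSeq.tsum_mul_left {f : ℕ → WSeq} (hf : Summable f) (z : WSeq) :
    ∑' k, z * f k = z * ∑' k, f k := by
  have hs : ∀ n, Summable fun k => f k n := fun n => Pi.summable.1 hf n
  have hz : Summable fun k => z * f k := Pi.summable.2 fun n => (hs n).mul_left (z n)
  funext n
  rw [tsum_apply hz, Pi.mul_apply, tsum_apply hf, ← (hs n).tsum_mul_left]
  rfl

theorem ser_sub_ser (hr : r ≠ ⊤) (hA : coefSum c r ≠ ⊤) {x y : WSeq} (hx : MulBound w 0 r x)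
    (hy : MulBound w 0 r y) : ser c x - ser c y = (x - y) * serDiv c x y := by
  unfold ser serDiv
  rw [← (summable_ser hr hA hx).tsum_sub (summable_ser hr hA hy),
    ← WSeq.tsum_mul_left (summable_serDiv hr hA hx hy)]
  refine tsum_congr fun k => ?_
  rw [mul_smul_comm, sub_mul_hom₂, smul_sub]

/-- Both arguments of the divided difference move by the same amount a' - a, so it factors out of
the two pieces of `hom₂_sub_hom₂`. -/
theorem serDiv_sub_serDiv (hr : r ≠ ⊤) (hA : coefSum c r ≠ ⊤) {a a' b : WSeq}
    (ha : MulBound w 0 r a) (ha' : MulBound w 0 r a') (hb : MulBound w 0 r (a + b))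
    (hb' : MulBound w 0 r (a' + b)) :
    serDiv c (a' + b) a' - serDiv c (a + b) a = (a' - a) * serMix c a a' b := by
  unfold serDiv serMix
  rw [← (summable_serDiv hr hA hb' ha').tsum_sub (summable_serDiv hr hA hb ha),
    ← WSeq.tsum_mul_left (summable_serMix hA ha ha' hb hb')]
  refine tsum_congr fun k => ?_
  rw [← smul_sub, hom₂_sub_hom₂, mul_smul_comm, add_sub_add_right_eq_sub, mul_add]

theorem mulBound_serDiv (hr : r ≠ ⊤) (hA : coefSum c r ≠ ⊤) (hs : s ≤ r) {x y : WSeq}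
    (hx : MulBound w 0 s x) (hy : MulBound w 0 s y) :
    MulBound w 0 (s * coefSum c r) (serDiv c x y) := by
  unfold coefSum
  rw [← ENNReal.tsum_mul_left]
  exact MulBound.tsum (summable_serDiv hr hA (hx.mono hs) (hy.mono hs))
    (mulBound_serDiv_term hs hx hy)

theorem mulBound_serMix (hA : coefSum c r ≠ ⊤) {a a' b : WSeq}
    (ha : MulBound w 0 r a) (ha' : MulBound w 0 r a') (hb : MulBound w 0 r (a + b))
    (hb' : MulBound w 0 r (a' + b)) : MulBound w 0 (2 * coefSum c r) (serMix c a a' b) := by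
  unfold coefSum
  rw [← ENNReal.tsum_mul_left]
  exact MulBound.tsum (summable_serMix hA ha ha' hb hb')
    (mulBound_serMix_term hb' hb ha' ha' ha hb)

theorem mulBound_serDiv_sub (hr : r ≠ ⊤) (hA : coefSum c r ≠ ⊤) {x y x' y' : WSeq}
    (hx : MulBound w 0 r x) (hx' : MulBound w 0 r x')
    (hy : MulBound w 0 r y) (hy' : MulBound w 0 r y')
    (h : MulBound w σ (r * L) (x - x')) (h' : MulBound w σ (r * L) (y - y')) :
    MulBound w σ (r * L * coefSum c r) (serDiv c x y - serDiv c x' y') := by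
  unfold coefSum serDiv
  have hS := summable_serDiv hr hA hx hy
  have hS' := summable_serDiv hr hA hx' hy'
  rw [← ENNReal.tsum_mul_left, ← hS.tsum_sub hS']
  refine MulBound.tsum (hS.sub hS') fun k => ?_
  rw [← smul_sub]
  refine mulBound_coef (mulBound_hom₂_sub hx hx' hy hy' h h' (k + 1)) ?_
  have h1 := one_le_natCast_add k
  calc _ = (k + 2) * ((k : ℝ≥0∞) + 1) * 1 * (r ^ k * (r * L)) := by push_cast; ring
    _ ≤ (k + 2) * (k + 2) * (k + 2) * (r ^ k * (r * L)) := by gcongr; norm_num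
    _ = _ := by ring

theorem mulBound_serMix_sub (hA : coefSum c r ≠ ⊤) {a₁ a₁' b₁ a₂ a₂' b₂ : WSeq}
    (ha : MulBound w 0 r a₁) (ha' : MulBound w 0 r a₁') (hb : MulBound w 0 r (a₁ + b₁))
    (hb' : MulBound w 0 r (a₁' + b₁))
    (ga : MulBound w 0 r a₂) (ga' : MulBound w 0 r a₂') (gb : MulBound w 0 r (a₂ + b₂))
    (gb' : MulBound w 0 r (a₂' + b₂))
    (d : MulBound w σ (r * L) (a₁ - a₂)) (d' : MulBound w σ (r * L) (a₁' - a₂'))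
    (e : MulBound w σ (r * L) (a₁ + b₁ - (a₂ + b₂)))
    (e' : MulBound w σ (r * L) (a₁' + b₁ - (a₂' + b₂))) :
    MulBound w σ (2 * L * coefSum c r) (serMix c a₁ a₁' b₁ - serMix c a₂ a₂' b₂) := by
  unfold coefSum serMix
  have hS := summable_serMix (c := c) hA ha ha' hb hb'
  have hS' := summable_serMix (c := c) hA ga ga' gb gb'
  rw [← ENNReal.tsum_mul_left, ← hS.tsum_sub hS']
  refine MulBound.tsum (hS.sub hS') fun k => ?_
  rw [← smul_sub, add_sub_add_comm]
  refine mulBound_coef ((mulBound_hom₃_sub hb' gb' hb gb ha' ga' e' e d' k).add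
    (mulBound_hom₃_sub ha' ga' ha ga hb gb d' d e k)) ?_
  -- This count of monomials times degree is cubic in k; it is what requires the exponent 3 in
  -- `coefSum`.
  calc _ = ((k : ℝ≥0∞) + 1) * (k + 1) * k * (r ^ k * (2 * L)) := by ring
    _ ≤ (k + 2) * (k + 2) * (k + 2) * (r ^ k * (2 * L)) := by
      gcongr
      · norm_num
      · norm_num
      · exact le_self_add
    _ = _ := by ring

end

/-! ### The difference operator -/

/-- The difference operator on sequences in the Wiener algebra. -/
def wdiff (x : WSeq) : WSeq
  | 0 => 0
  | n + 1 => x n - x (n + 1)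

theorem raw_wdiff (x : WSeq) : raw (wdiff x) = diff (raw x) := by
  funext n m
  cases n <;> rfl

theorem wdiff_add (x y : WSeq) : wdiff (x + y) = wdiff x + wdiff y := by
  funext n
  cases n with
  | zero => exact (add_zero (0 : Wiener)).symm
  | succ n => exact add_sub_add_comm _ _ _ _

theorem wdiff_sub (x y : WSeq) : wdiff (x - y) = wdiff x - wdiff y := by
  funext n
  cases n with
  | zero => exact (sub_zero (0 : Wiener)).symm
  | succ n => exact sub_sub_sub_comm _ _ _ _

theorem wdiff_smul (c : ℂ) (x : WSeq) : wdiff (c • x) = c • wdiff x := by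
  funext n
  cases n with
  | zero => exact (smul_zero c).symm
  | succ n => exact (smul_sub c _ _).symm

/-- The shift from n to n + 1 costs one factor e^σ; at n = 0 the difference vanishes by convention.
-/
theorem nrm_wdiff_le_exp (σ : ℝ) (w : AdmissibleWeight) (x : WSeq) :
    nrm σ w (wdiff x) ≤ (ENNReal.ofReal (Real.exp σ) + 1) * nrm σ w x := by
  refine eN_le_of_rowE_le fun m => rowE_le_of_le fun n => ?_
  cases n with
  | zero =>
    have : raw (wdiff x) 0 m = 0 := rfl
    rw [this]
    simp
  | succ n =>
    have e : raw (wdiff x) (n + 1) m = raw x n m - raw x (n + 1) m := rfl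
    have e2 : Real.exp (σ * (n + 1 : ℕ)) = Real.exp σ * Real.exp (σ * n) := by
      rw [← Real.exp_add]; congr 1; push_cast; ring
    rw [e, add_mul, one_mul]
    calc _ ≤ ENNReal.ofReal (Real.exp (σ * (n + 1 : ℕ)))
          * (‖raw x n m‖ₑ + ‖raw x (n + 1) m‖ₑ) := by gcongr; exact enorm_sub_le
      _ = ENNReal.ofReal (Real.exp σ) * (ENNReal.ofReal (Real.exp (σ * n)) * ‖raw x n m‖ₑ)
          + ENNReal.ofReal (Real.exp (σ * (n + 1 : ℕ))) * ‖raw x (n + 1) m‖ₑ := by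
        rw [mul_add]
        congr 1
        rw [e2, ENNReal.ofReal_mul (Real.exp_pos _).le, mul_assoc]
      _ ≤ _ := by gcongr <;> exact le_rowE _ _ _ _

theorem nrm_wdiff_le {σ : ℝ} (hσ : σ ≤ 1) (w : AdmissibleWeight) (x : WSeq) :
    nrm σ w (wdiff x) ≤ 4 * nrm σ w x := by
  refine (nrm_wdiff_le_exp σ w x).trans ?_
  gcongr
  have : Real.exp σ ≤ 3 :=
    (Real.exp_le_exp.2 hσ).trans (Real.exp_one_lt_d9.le.trans (by norm_num))
  calc _ ≤ ENNReal.ofReal 3 + 1 := by gcongr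
    _ = 4 := by norm_num

theorem nrm_wdiff_le_two {σ : ℝ} (hσ : σ ≤ 0) (w : AdmissibleWeight) (x : WSeq) :
    nrm σ w (wdiff x) ≤ 2 * nrm σ w x := by
  refine (nrm_wdiff_le_exp σ w x).trans ?_
  gcongr
  have : Real.exp σ ≤ 1 := Real.exp_le_one_iff.2 hσ
  calc _ ≤ ENNReal.ofReal 1 + 1 := by gcongr
    _ = 2 := by norm_num

end
end DrivenLattice

namespace DrivenLattice
noncomputable section
open scoped ENNReal

/-! ### Decaying solutions of the scalar three-term recurrence -/

/-- `y` decays at the rate `τ`, with constant `A`. -/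
def Decays (τ A : ℝ) (y : ℕ → ℂ) : Prop := ∀ n : ℕ, Real.exp (τ * n) * ‖y n‖ ≤ A

theorem Decays.nonneg {τ A : ℝ} {y : ℕ → ℂ} (h : Decays τ A y) : 0 ≤ A :=
  le_trans (by positivity) (h 0)

theorem Decays.norm_le {τ A : ℝ} {y : ℕ → ℂ} (h : Decays τ A y) (n : ℕ) :
    ‖y n‖ ≤ A * Real.exp (-τ) ^ n := by
  have e : Real.exp (-τ) ^ n = (Real.exp (τ * n))⁻¹ := by
    rw [← Real.exp_nat_mul, ← Real.exp_neg]; congr 1; ring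
  rw [e, ← div_eq_mul_inv, le_div_iff₀ (Real.exp_pos _), mul_comm]
  exact h n

theorem decays_of_norm_le {τ A : ℝ} {y : ℕ → ℂ} (h : ∀ n, ‖y n‖ ≤ A * Real.exp (-τ) ^ n) :
    Decays τ A y := fun n => by
  have e : Real.exp (-τ) ^ n = (Real.exp (τ * n))⁻¹ := by
    rw [← Real.exp_nat_mul, ← Real.exp_neg]; congr 1; ring
  have := h n
  rw [e, ← div_eq_mul_inv, le_div_iff₀ (Real.exp_pos _)] at this
  rwa [mul_comm]

theorem exp_neg_lt_one {τ : ℝ} (h : 0 < τ) : Real.exp (-τ) < 1 := by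
  rw [Real.exp_lt_one_iff]; linarith

theorem Decays.tendsto {τ A : ℝ} {y : ℕ → ℂ} (h : Decays τ A y) (hτ : 0 < τ) :
    Filter.Tendsto y Filter.atTop (nhds 0) := by
  refine squeeze_zero_norm h.norm_le ?_
  simpa using (tendsto_pow_atTop_nhds_zero_of_lt_one (Real.exp_pos _).le
    (exp_neg_lt_one hτ)).const_mul A

/-- The coefficients of the decaying fundamental solution for the modes on the unit circle. -/
def resCoef (δ : ℝ) : ℕ → ℝ
  | 0 => 1
  | 1 => -δ - 1
  | n + 2 => -δ * resCoef δ (n + 1) - resCoef δ n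

/-- The decaying solution of `v(n-1) + δ v(n) + v(n+1) + y(n) - y(n+1) = 0` for `|δ| ≤ 2`. -/
def resRow (δ : ℝ) (y : ℕ → ℂ) (n : ℕ) : ℂ := -∑' j : ℕ, (resCoef δ j : ℂ) * y (n + 1 + j)

/-- An auxiliary solution of a first order recurrence. -/
def auxRow (z : ℝ) (y : ℕ → ℂ) (n : ℕ) : ℂ :=
  ∑' j : ℕ, (z : ℂ) ^ (j + 1) * (y (n + j) - y (n + j + 1))

/-- The decaying solution of `v(n-1) + δ v(n) + v(n+1) + y(n) - y(n+1) = 0` with `v(0) = 0`,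
where `z² + δ z + 1 = 0` and `|z| < 1`. -/
def nonresRow (z : ℝ) (y : ℕ → ℂ) : ℕ → ℂ
  | 0 => 0
  | n + 1 => z * nonresRow z y n + auxRow z y (n + 1)

/-! ### Modes with characteristic roots on the unit circle -/

section Res
variable {τ A T δ : ℝ} {y y' : ℕ → ℂ}

theorem resRow_term_le (hT : ∀ j, |resCoef δ j| ≤ T) (hy : Decays τ A y) (n j : ℕ) :
    ‖(resCoef δ j : ℂ) * y (n + j)‖ ≤ T * A * Real.exp (-τ) ^ n * Real.exp (-τ) ^ j := by
  have hT0 : 0 ≤ T := (abs_nonneg _).trans (hT 0)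
  rw [norm_mul, Complex.norm_real, Real.norm_eq_abs]
  calc _ ≤ T * (A * Real.exp (-τ) ^ (n + j)) :=
        mul_le_mul (hT j) (hy.norm_le _) (norm_nonneg _) hT0
    _ = _ := by rw [pow_add]; ring

theorem summable_resRow (hτ : 0 < τ) (hT : ∀ j, |resCoef δ j| ≤ T) (hy : Decays τ A y) (n : ℕ) :
    Summable fun j : ℕ => (resCoef δ j : ℂ) * y (n + j) :=
  Summable.of_norm_bounded ((summable_geometric_of_lt_one (Real.exp_pos _).le
    (exp_neg_lt_one hτ)).mul_left _) (resRow_term_le hT hy n)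

theorem decays_resRow (hτ : 0 < τ) (hT : ∀ j, |resCoef δ j| ≤ T) (hy : Decays τ A y) :
    Decays τ (T / (1 - Real.exp (-τ)) * A) (resRow δ y) := by
  have hT0 : 0 ≤ T := (abs_nonneg _).trans (hT 0)
  have hA := hy.nonneg
  have h1 := exp_neg_lt_one hτ
  refine decays_of_norm_le fun n => ?_
  have h := tsum_of_norm_bounded ((hasSum_geometric_of_lt_one (Real.exp_pos (-τ)).le h1).mul_left
    (T * A * Real.exp (-τ) ^ (n + 1))) (resRow_term_le hT hy (n + 1))
  rw [resRow, norm_neg]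
  refine h.trans ?_
  have h2 : 0 < (1 - Real.exp (-τ))⁻¹ := inv_pos.2 (by linarith)
  calc _ ≤ T * A * Real.exp (-τ) ^ n * (1 - Real.exp (-τ))⁻¹ := by
        rw [pow_succ]
        refine mul_le_mul_of_nonneg_right (mul_le_mul_of_nonneg_left ?_ (by positivity)) h2.le
        exact mul_le_of_le_one_right (by positivity) h1.le
    _ = _ := by rw [div_eq_mul_inv]; ring

theorem resRow_add {A' : ℝ} (hτ : 0 < τ) (hT : ∀ j, |resCoef δ j| ≤ T) (hy : Decays τ A y)
    (hy' : Decays τ A' y') : resRow δ (y + y') = resRow δ y + resRow δ y' := by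
  funext n
  simp only [resRow, Pi.add_apply, mul_add]
  rw [(summable_resRow hτ hT hy (n + 1)).tsum_add (summable_resRow hτ hT hy' (n + 1)), neg_add]

theorem resRow_smul (c : ℂ) : resRow δ (c • y) = c • resRow δ y := by
  funext n
  simp only [resRow, Pi.smul_apply, smul_eq_mul, mul_neg, ← tsum_mul_left]
  congr 1
  exact tsum_congr fun j => by ring

/-- The recursion of `resCoef` cancels the coefficient of every y(n+3+j), and its two initial values
are those that cancel y(n+1) and y(n+2). -/
theorem resRow_eq (hτ : 0 < τ) (hT : ∀ j, |resCoef δ j| ≤ T) (hy : Decays τ A y) (n : ℕ) :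
    resRow δ y n + δ * resRow δ y (n + 1) + resRow δ y (n + 2) + (y (n + 1) - y (n + 2)) = 0 := by
  have s0 := summable_resRow hτ hT hy (n + 1)
  have s1 := summable_resRow hτ hT hy (n + 2)
  have s2 := summable_resRow hτ hT hy (n + 3)
  have e0 := s0.tsum_eq_zero_add
  have e0' := ((summable_nat_add_iff 1).2 s0).tsum_eq_zero_add
  have e1 := s1.tsum_eq_zero_add
  have t0 := (summable_nat_add_iff 2).2 s0
  have t1 := (summable_nat_add_iff 1).2 s1
  have key : ∑' j : ℕ, (((resCoef δ (j + 2) : ℂ) * y (n + 1 + (j + 2))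
      + δ * ((resCoef δ (j + 1) : ℂ) * y (n + 2 + (j + 1))))
      + (resCoef δ j : ℂ) * y (n + 3 + j)) = 0 := by
    rw [← tsum_zero (α := ℂ) (β := ℕ)]
    refine tsum_congr fun j => ?_
    rw [show n + 1 + (j + 2) = n + 3 + j by ring, show n + 2 + (j + 1) = n + 3 + j by ring]
    simp only [resCoef]
    push_cast
    ring
  rw [(t0.add (t1.mul_left _)).tsum_add s2, t0.tsum_add (t1.mul_left _), tsum_mul_left] at key
  simp only [resRow]
  rw [e0, e0', e1]
  have c0 : resCoef δ 0 = 1 := rfl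
  have c1 : resCoef δ 1 = -δ - 1 := rfl
  simp only [add_assoc, Nat.reduceAdd, add_zero, zero_add] at key ⊢
  rw [c0, c1]
  push_cast
  linear_combination -key

end Res

/-! ### Modes with a characteristic root inside the unit disc -/

section Nonres
variable {τ A z δ : ℝ} {y y' : ℕ → ℂ}

theorem auxRow_term_le (hτ : 0 < τ) (hy : Decays τ A y) (n j : ℕ) :
    ‖(z : ℂ) ^ (j + 1) * (y (n + j) - y (n + j + 1))‖
      ≤ 2 * A * |z| * Real.exp (-τ) ^ n * |z| ^ j := by
  have hA := hy.nonneg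
  have h1 := (exp_neg_lt_one hτ).le
  have h0 := (Real.exp_pos (-τ)).le
  have e : ∀ k, ‖y (n + k)‖ ≤ A * Real.exp (-τ) ^ n := fun k => by
    refine (hy.norm_le _).trans (mul_le_mul_of_nonneg_left ?_ hA)
    exact pow_le_pow_of_le_one h0 h1 (by omega)
  rw [norm_mul, norm_pow, Complex.norm_real, Real.norm_eq_abs]
  calc _ ≤ |z| ^ (j + 1) * (A * Real.exp (-τ) ^ n + A * Real.exp (-τ) ^ n) := by
        gcongr
        exact (norm_sub_le _ _).trans (add_le_add (e j) (by simpa [add_assoc] using e (j + 1)))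
    _ = _ := by ring

theorem summable_auxRow (hτ : 0 < τ) (hz : |z| < 1) (hy : Decays τ A y) (n : ℕ) :
    Summable fun j : ℕ => (z : ℂ) ^ (j + 1) * (y (n + j) - y (n + j + 1)) :=
  Summable.of_norm_bounded ((summable_geometric_of_lt_one (abs_nonneg z) hz).mul_left _)
    (auxRow_term_le hτ hy n)

theorem norm_auxRow_le (hτ : 0 < τ) (hz : |z| < 1) (hy : Decays τ A y) (n : ℕ) :
    ‖auxRow z y n‖ ≤ 2 * A * |z| / (1 - |z|) * Real.exp (-τ) ^ n := by
  refine (tsum_of_norm_bounded ((hasSum_geometric_of_lt_one (abs_nonneg z) hz).mul_left _)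
    (auxRow_term_le hτ hy n)).trans (le_of_eq ?_)
  rw [div_eq_mul_inv]; ring

/-- Induction on v(n+1) = z v(n) + aux(n+1). The constant B is the solution of B = q B +
2A|z|/(1-|z|), where the last term bounds the auxiliary sequence and q < 1 is what |z| gains over
e^{-τ}. -/
theorem decays_nonresRow (hτ : 0 < τ) (hz : |z| < 1) {q : ℝ} (hq : q < 1)
    (hzq : |z| ≤ q * Real.exp (-τ)) (hy : Decays τ A y) :
    Decays τ (2 * |z| / ((1 - |z|) * (1 - q)) * A) (nonresRow z y) := by
  have hA := hy.nonneg
  refine decays_of_norm_le fun n => ?_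
  have hz' : 0 < 1 - |z| := by linarith
  have hq' : 0 < 1 - q := by linarith
  induction n with
  | zero => simp only [nonresRow, norm_zero]; positivity
  | succ n ih =>
    rw [nonresRow]
    refine (norm_add_le _ _).trans ?_
    rw [norm_mul, Complex.norm_real, Real.norm_eq_abs]
    calc _ ≤ (q * Real.exp (-τ)) * (2 * |z| / ((1 - |z|) * (1 - q)) * A * Real.exp (-τ) ^ n)
          + 2 * A * |z| / (1 - |z|) * Real.exp (-τ) ^ (n + 1) :=
          add_le_add (mul_le_mul hzq ih (norm_nonneg _) ((abs_nonneg z).trans hzq))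
            (norm_auxRow_le hτ hz hy _)
      _ = _ := by field_simp; ring

theorem auxRow_add {A' : ℝ} (hτ : 0 < τ) (hz : |z| < 1) (hy : Decays τ A y)
    (hy' : Decays τ A' y') (n : ℕ) : auxRow z (y + y') n = auxRow z y n + auxRow z y' n := by
  simp only [auxRow]
  rw [← (summable_auxRow hτ hz hy n).tsum_add (summable_auxRow hτ hz hy' n)]
  exact tsum_congr fun j => by simp only [Pi.add_apply]; ring

theorem nonresRow_add {A' : ℝ} (hτ : 0 < τ) (hz : |z| < 1) (hy : Decays τ A y)
    (hy' : Decays τ A' y') : nonresRow z (y + y') = nonresRow z y + nonresRow z y' := by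
  funext n
  induction n with
  | zero => simp [nonresRow]
  | succ n ih =>
    simp only [nonresRow, Pi.add_apply] at ih ⊢
    rw [ih, auxRow_add hτ hz hy hy']
    ring

theorem nonresRow_smul (c : ℂ) : nonresRow z (c • y) = c • nonresRow z y := by
  funext n
  induction n with
  | zero => simp [nonresRow]
  | succ n ih =>
    have : auxRow z (c • y) (n + 1) = c * auxRow z y (n + 1) := by
      simp only [auxRow, Pi.smul_apply, smul_eq_mul, ← tsum_mul_left]
      exact tsum_congr fun j => by ring
    simp only [nonresRow, Pi.smul_apply, smul_eq_mul] at ih ⊢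
    rw [ih, this]
    ring

theorem auxRow_eq (hτ : 0 < τ) (hz : |z| < 1) (hy : Decays τ A y) (n : ℕ) :
    auxRow z y n = z * (y n - y (n + 1)) + z * auxRow z y (n + 1) := by
  simp only [auxRow]
  rw [(summable_auxRow hτ hz hy n).tsum_eq_zero_add, ← tsum_mul_left]
  congr 1
  · simp
  · refine tsum_congr fun j => ?_
    rw [show n + (j + 1) = n + 1 + j by ring]
    ring

/-- The second order operator factors through the roots z and 1/z: the auxiliary sequence is p(n) =
v(n) - z v(n-1), and it satisfies p(n) = z p(n+1) + z (y(n) - y(n+1)). Multiplying the equation by z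
clears the root 1/z. -/
theorem nonresRow_eq (hτ : 0 < τ) (hz : |z| < 1) (hz0 : z ≠ 0) (hδ : z ^ 2 + δ * z + 1 = 0)
    (hy : Decays τ A y) (n : ℕ) :
    nonresRow z y n + δ * nonresRow z y (n + 1) + nonresRow z y (n + 2)
      + (y (n + 1) - y (n + 2)) = 0 := by
  have hz0' : (z : ℂ) ≠ 0 := by exact_mod_cast hz0
  have hδ' : (z : ℂ) ^ 2 + δ * z + 1 = 0 := by exact_mod_cast hδ
  have h := auxRow_eq hτ hz hy (n + 1)
  have h1 : nonresRow z y (n + 1) = z * nonresRow z y n + auxRow z y (n + 1) := rfl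
  have h2 : nonresRow z y (n + 2) = z * nonresRow z y (n + 1) + auxRow z y (n + 2) := rfl
  refine (mul_eq_zero.1 (?_ : (z : ℂ) * _ = 0)).resolve_left hz0'
  rw [h2]
  linear_combination -h1 - h + nonresRow z y (n + 1) * hδ'

end Nonres

/-- A decaying solution of the homogeneous recurrence solves the first order recurrence given by
a characteristic root of modulus at most one. -/
theorem eq_mul_of_tendsto_zero {δ : ℝ} {ζ : ℂ} (hζ : ‖ζ‖ ≤ 1)
    (hδ : ζ ^ 2 + δ * ζ + 1 = 0) {d : ℕ → ℂ} (hd : Filter.Tendsto d Filter.atTop (nhds 0))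
    (h : ∀ n, d n + δ * d (n + 1) + d (n + 2) = 0) (n : ℕ) : d (n + 1) = ζ * d n := by
  -- Subtracting ζ d(n) removes the root ζ, so what remains follows the other root 1/ζ, whose
  -- modulus is at least one. Its moduli cannot decrease, yet they tend to zero.
  have hp : ∀ n, d (n + 1) - ζ * d n = ζ * (d (n + 2) - ζ * d (n + 1)) := fun n => by
    linear_combination (-ζ) * h n + hδ * d (n + 1)
  have hmono : ∀ k, ‖d (n + 1) - ζ * d n‖ ≤ ‖d (n + k + 1) - ζ * d (n + k)‖ := fun k => by
    induction k with
    | zero => rfl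
    | succ k ih =>
      refine ih.trans ?_
      rw [hp (n + k), norm_mul]
      exact mul_le_of_le_one_left (norm_nonneg _) hζ
  have hlim : Filter.Tendsto (fun k => ‖d (n + k + 1) - ζ * d (n + k)‖) Filter.atTop (nhds 0) := by
    have h1 : Filter.Tendsto (fun k => d (n + k)) Filter.atTop (nhds 0) := by
      refine ((Filter.tendsto_add_atTop_iff_nat n).2 hd).congr fun k => by rw [add_comm]
    have h2 : Filter.Tendsto (fun k => d (n + k + 1)) Filter.atTop (nhds 0) :=
      (Filter.tendsto_add_atTop_iff_nat 1).2 h1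
    simpa using (h2.sub (h1.const_mul ζ)).norm
  have := ge_of_tendsto' hlim hmono
  exact sub_eq_zero.1 (norm_le_zero_iff.1 this)

/-- The first order recurrence with |ζ| = 1 keeps |d n| constant. Only one root enters, so the
double root of the mode m = 0 is covered. -/
theorem eq_zero_of_unit_root {δ : ℝ} {ζ : ℂ} (hζ : ‖ζ‖ = 1)
    (hδ : ζ ^ 2 + δ * ζ + 1 = 0) {d : ℕ → ℂ} (hd : Filter.Tendsto d Filter.atTop (nhds 0))
    (h : ∀ n, d n + δ * d (n + 1) + d (n + 2) = 0) : d = 0 := by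
  have h1 := eq_mul_of_tendsto_zero hζ.le hδ hd h
  have h2 : ∀ n k, ‖d (k + n)‖ = ‖d n‖ := fun n k => by
    induction k with
    | zero => simp
    | succ k ih => rw [show k + 1 + n = k + n + 1 by ring, h1, norm_mul, hζ, one_mul, ih]
  funext n
  have h3 := ((Filter.tendsto_add_atTop_iff_nat n).2 hd).norm
  simp only [h2, norm_zero] at h3
  exact norm_eq_zero.1 (tendsto_nhds_unique tendsto_const_nhds h3)

theorem eq_zero_of_small_root {δ : ℝ} {ζ : ℂ} (hζ : ‖ζ‖ ≤ 1)
    (hδ : ζ ^ 2 + δ * ζ + 1 = 0) {d : ℕ → ℂ} (hd : Filter.Tendsto d Filter.atTop (nhds 0))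
    (h : ∀ n, d n + δ * d (n + 1) + d (n + 2) = 0) (h0 : d 0 = 0) : d = 0 := by
  funext n
  induction n with
  | zero => exact h0
  | succ n ih => rw [eq_mul_of_tendsto_zero hζ hδ hd h, ih]; simp

end
end DrivenLattice

namespace DrivenLattice
noncomputable section
open scoped ENNReal

/-! ### The modes of the linearized lattice -/

theorem exists_unit_root {δ : ℝ} (h1 : -2 ≤ δ) (h2 : δ ≤ 2) :
    ∃ ζ : ℂ, ‖ζ‖ = 1 ∧ ζ ^ 2 + δ * ζ + 1 = 0 := by
  obtain ⟨S, hS⟩ : ∃ S : ℝ, S ^ 2 = 1 - (δ / 2) ^ 2 := ⟨_, Real.sq_sqrt (by nlinarith)⟩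
  refine ⟨⟨-(δ / 2), S⟩, ?_, ?_⟩
  · have : Complex.normSq ⟨-(δ / 2), S⟩ = 1 := by
      rw [Complex.normSq_mk]; nlinarith
    rw [Complex.norm_def, this, Real.sqrt_one]
  · apply Complex.ext
    · simp [pow_two]; nlinarith
    · simp [pow_two]; ring_nf

/-- For the mode m = 0 the fundamental solution of the second order recurrence grows linearly;
summation by parts against Y(n) - Y(n+1) leaves its increments, which are constant. -/
theorem resCoef_neg_two (j : ℕ) : resCoef (-2) j = 1 := by
  induction j using Nat.strong_induction_on with
  | _ j ih =>
    match j with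
    | 0 => rfl
    | 1 => norm_num [resCoef]
    | j + 2 => rw [resCoef, ih (j + 1) (by omega), ih j (by omega)]; norm_num

/-- These are the increments of the Chebyshev values sin(jθ)/sin θ, by the addition formula for
sin(x + θ) + sin(x - θ). -/
theorem resCoef_eq {θ : ℝ} (hθ : Real.sin θ ≠ 0) (j : ℕ) :
    resCoef (-2 * Real.cos θ) j = (Real.sin ((j + 1) * θ) - Real.sin (j * θ)) / Real.sin θ := by
  induction j using Nat.strong_induction_on with
  | _ j ih =>
    match j with
    | 0 => simp [resCoef, hθ]
    | 1 =>
      have : Real.sin ((1 + 1) * θ) = 2 * Real.sin θ * Real.cos θ := by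
        rw [← Real.sin_two_mul]; norm_num
      simp only [resCoef, Nat.cast_one, one_mul, this]
      field_simp
    | j + 2 =>
      rw [resCoef, ih (j + 1) (by omega), ih j (by omega)]
      have e : ∀ x : ℝ, Real.sin (x + θ) = 2 * Real.cos θ * Real.sin x - Real.sin (x - θ) :=
        fun x => by rw [Real.sin_add, Real.sin_sub]; ring
      have e1 := e (((j : ℝ) + 2) * θ)
      have e2 := e (((j : ℝ) + 1) * θ)
      push_cast
      rw [show ((j : ℝ) + 2 + 1) * θ = (j + 2) * θ + θ by ring, e1,
        show ((j : ℝ) + 2) * θ - θ = (j + 1) * θ by ring,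
        show ((j : ℝ) + 1 + 1) * θ = (j + 2) * θ by ring]
      rw [show ((j : ℝ) + 1) * θ + θ = (j + 2) * θ by ring,
        show ((j : ℝ) + 1) * θ - θ = j * θ by ring] at e2
      field_simp
      rw [e2]
      ring_nf

theorem abs_resCoef_le {θ : ℝ} (hθ : Real.sin θ ≠ 0) (j : ℕ) :
    |resCoef (-2 * Real.cos θ) j| ≤ 2 / |Real.sin θ| := by
  rw [resCoef_eq hθ, abs_div]
  gcongr
  refine (abs_sub _ _).trans ?_
  linarith [Real.abs_sin_le_one ((j + 1) * θ), Real.abs_sin_le_one (j * θ)]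

section Modes
variable {F : ℝ → ℝ} {c γ : ℝ}

theorem delta_zero : delta F c γ 0 = -2 := by simp [delta]

theorem delta_neg (m : ℤ) : delta F c γ (-m) = delta F c γ m := by simp [delta]

theorem delta_abs (m : ℤ) : delta F c γ |m| = delta F c γ m := by
  rcases abs_choice m with h | h <;> rw [h]
  exact delta_neg m

theorem delta_mono (hF' : 0 < deriv F (-c)) {m m' : ℤ} (h : |m| ≤ |m'|) :
    delta F c γ m ≤ delta F c γ m' := by
  unfold delta
  have h1 : ((m : ℝ)) ^ 2 ≤ (m' : ℝ) ^ 2 := by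
    exact_mod_cast sq_le_sq.2 h
  have h2 : ((m : ℝ) * γ) ^ 2 ≤ ((m' : ℝ) * γ) ^ 2 := by
    rw [mul_pow, mul_pow]; gcongr
  gcongr

theorem neg_two_lt_delta (hF' : 0 < deriv F (-c)) (hγ : 0 < γ) {m : ℤ} (hm : m ≠ 0) :
    -2 < delta F c γ m := by
  have : (m : ℝ) ≠ 0 := by exact_mod_cast hm
  unfold delta
  have : 0 < ((m : ℝ) * γ) ^ 2 / deriv F (-c) := by positivity
  linarith

theorem neg_two_le_delta (hF' : 0 < deriv F (-c)) (m : ℤ) : -2 ≤ delta F c γ m := by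
  unfold delta
  have : 0 ≤ ((m : ℝ) * γ) ^ 2 / deriv F (-c) := by positivity
  linarith

theorem mem_m0_set_iff (hF' : 0 < deriv F (-c)) (m : ℤ) :
    (0 ≤ (γ * (m : ℝ)) ^ 2 / deriv F (-c) ∧ (γ * (m : ℝ)) ^ 2 / deriv F (-c) ≤ 4)
      ↔ delta F c γ m ≤ 2 := by
  unfold delta
  rw [mul_comm γ]
  have : 0 ≤ ((m : ℝ) * γ) ^ 2 / deriv F (-c) := by positivity
  constructor
  · rintro ⟨_, h⟩; linarith
  · intro h; exact ⟨this, by linarith⟩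

theorem m0_eq (hF' : 0 < deriv F (-c)) : m0 F c γ = sSup {m : ℤ | delta F c γ m ≤ 2} := by
  unfold m0
  congr 1
  ext m
  exact mem_m0_set_iff hF' m

theorem bddAbove_m0_set (hF' : 0 < deriv F (-c)) (hγ : 0 < γ) :
    BddAbove {m : ℤ | delta F c γ m ≤ 2} := by
  refine ⟨⌈4 * deriv F (-c) / γ ^ 2⌉, fun m hm => ?_⟩
  have hm' : delta F c γ m ≤ 2 := hm
  unfold delta at hm'
  have h1 : ((m : ℝ) * γ) ^ 2 / deriv F (-c) ≤ 4 := by linarith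
  rw [div_le_iff₀ hF', mul_pow, ← le_div_iff₀ (by positivity)] at h1
  -- For integers m ≤ m², so the bound on m² bounds m without a square root.
  have h2 : (m : ℝ) ≤ (m : ℝ) ^ 2 := by exact_mod_cast Int.le_self_sq m
  exact Int.cast_le.1 ((h2.trans h1).trans (Int.le_ceil _))

/-- The set defining m₀ contains 0 and is bounded, so its supremum is attained; since δ depends
monotonically on |m|, the set consists of all m with |m| ≤ m₀. -/
theorem delta_le_two_iff (hF' : 0 < deriv F (-c)) (hγ : 0 < γ) (m : ℤ) :
    delta F c γ m ≤ 2 ↔ |m| ≤ m0 F c γ := by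
  rw [m0_eq hF']
  have hb := bddAbove_m0_set (F := F) (c := c) hF' hγ
  constructor
  · intro h
    refine le_csSup hb ?_
    rw [Set.mem_ofPred_eq, delta_abs]
    exact h
  · intro h
    have hn : {m : ℤ | delta F c γ m ≤ 2}.Nonempty := ⟨0, by simp [delta_zero]⟩
    exact (delta_mono hF' (h.trans (le_abs_self _))).trans (Int.csSup_mem hn hb)

theorem two_lt_delta (hF' : 0 < deriv F (-c)) (hγ : 0 < γ) {m : ℤ} (hm : m0 F c γ < |m|) :
    2 < delta F c γ m := by
  by_contra! h
  exact absurd ((delta_le_two_iff hF' hγ m).1 h) (not_le.2 hm)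

theorem m0_nonneg (hF' : 0 < deriv F (-c)) (hγ : 0 < γ) : 0 ≤ m0 F c γ := by
  have := (delta_le_two_iff (c := c) (γ := γ) hF' hγ 0).1 (by simp [delta_zero])
  simpa using this

theorem delta_lt_two (hF' : 0 < deriv F (-c)) (hγ : 0 < γ)
    (hres : ∀ m : ℤ, ((m : ℝ) * γ) ^ 2 / deriv F (-c) ≠ 4) {m : ℤ} (hm : |m| ≤ m0 F c γ) :
    delta F c γ m < 2 := by
  refine lt_of_le_of_ne ((delta_le_two_iff hF' hγ m).2 hm) fun h => hres m ?_
  unfold delta at h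
  linarith

/-- The two roots have product 1. The reciprocal form shows at once that |z_m| < 1 and that |z_m|
decreases as δ_m grows. -/
theorem abs_zRoot {m : ℤ} (h : 2 < delta F c γ m) :
    |zRoot F c γ m| = (delta F c γ m / 2 + Real.sqrt (delta F c γ m ^ 2 / 4 - 1))⁻¹ := by
  have hs : Real.sqrt (delta F c γ m ^ 2 / 4 - 1) ^ 2 = delta F c γ m ^ 2 / 4 - 1 :=
    Real.sq_sqrt (by nlinarith)
  have h0 := Real.sqrt_nonneg (delta F c γ m ^ 2 / 4 - 1)
  have h1 : zRoot F c γ m < 0 := by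
    unfold zRoot
    nlinarith
  rw [abs_of_neg h1]
  apply eq_inv_of_mul_eq_one_left
  unfold zRoot
  nlinarith

theorem zRoot_sq {m : ℤ} (h : 2 < delta F c γ m) :
    zRoot F c γ m ^ 2 + delta F c γ m * zRoot F c γ m + 1 = 0 := by
  have hs : Real.sqrt (delta F c γ m ^ 2 / 4 - 1) ^ 2 = delta F c γ m ^ 2 / 4 - 1 :=
    Real.sq_sqrt (by nlinarith)
  unfold zRoot
  nlinarith

theorem zRoot_ne_zero {m : ℤ} (h : 2 < delta F c γ m) : zRoot F c γ m ≠ 0 := by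
  intro h0
  have := zRoot_sq h
  rw [h0] at this
  norm_num at this

theorem abs_zRoot_lt_one {m : ℤ} (h : 2 < delta F c γ m) : |zRoot F c γ m| < 1 := by
  rw [abs_zRoot h]
  have h0 := Real.sqrt_nonneg (delta F c γ m ^ 2 / 4 - 1)
  exact inv_lt_one_of_one_lt₀ (by linarith)

theorem abs_zRoot_anti {m m' : ℤ} (h : 2 < delta F c γ m)
    (h' : delta F c γ m ≤ delta F c γ m') : |zRoot F c γ m'| ≤ |zRoot F c γ m| := by
  rw [abs_zRoot h, abs_zRoot (h.trans_le h')]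
  have h0 := Real.sqrt_nonneg (delta F c γ m ^ 2 / 4 - 1)
  have h1 : Real.sqrt (delta F c γ m ^ 2 / 4 - 1) ≤ Real.sqrt (delta F c γ m' ^ 2 / 4 - 1) := by
    apply Real.sqrt_le_sqrt
    have : delta F c γ m ^ 2 ≤ delta F c γ m' ^ 2 := by gcongr
    linarith
  exact inv_anti₀ (by positivity) (by linarith)

theorem m0_lt_abs_succ (hF' : 0 < deriv F (-c)) (hγ : 0 < γ) : m0 F c γ < |m0 F c γ + 1| := by
  have := m0_nonneg (c := c) hF' hγ
  rw [abs_of_nonneg (by omega)]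
  omega

theorem sigma0_pos (hF' : 0 < deriv F (-c)) (hγ : 0 < γ) : 0 < sigma0 F c γ := by
  have h := two_lt_delta hF' hγ (m0_lt_abs_succ (c := c) hF' hγ)
  have := Real.log_neg (abs_pos.2 (zRoot_ne_zero h)) (abs_zRoot_lt_one h)
  exact lt_min one_pos (by linarith)

theorem sigma1_pos (hF' : 0 < deriv F (-c)) (hγ : 0 < γ) : 0 < sigma1 F c γ := by
  have := sigma0_pos (c := c) hF' hγ
  unfold sigma1
  linarith

theorem sigma0_le_one : sigma0 F c γ ≤ 1 := min_le_left _ _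

theorem sigma0_eq : sigma0 F c γ = 4 * sigma1 F c γ := by unfold sigma1; ring

/-- By monotonicity the worst mode is m₀ + 1, and for it the bound is the second entry of the
minimum defining σ₀. -/
theorem abs_zRoot_le (hF' : 0 < deriv F (-c)) (hγ : 0 < γ) {m : ℤ} (hm : m0 F c γ < |m|) :
    |zRoot F c γ m| ≤ Real.exp (-2 * sigma0 F c γ) := by
  have h := two_lt_delta hF' hγ (m0_lt_abs_succ (c := c) hF' hγ)
  have h0 := m0_nonneg (c := c) hF' hγ
  refine (abs_zRoot_anti h (delta_mono hF' ?_)).trans ?_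
  · rw [abs_of_nonneg (by omega)]
    exact hm
  · rw [← Real.log_le_iff_le_exp (abs_pos.2 (zRoot_ne_zero h))]
    have : sigma0 F c γ ≤ -(1 / 2) * Real.log |zRoot F c γ (m0 F c γ + 1)| := min_le_right _ _
    linarith

/-- The first of the two terms in the definition of `CK`, in terms of `x = exp (-σ₀)`. -/
theorem firstTerm_le_CK (hF' : 0 < deriv F (-c)) (hγ : 0 < γ) :
    1 / (1 - Real.exp (-sigma0 F c γ) ^ 2) *
      (Real.exp (-sigma0 F c γ) / (1 - Real.exp (-sigma0 F c γ))
        + 1 / (1 - Real.exp (-sigma0 F c γ) ^ 2)) ≤ CK F c γ := by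
  have h0 := sigma0_pos (c := c) hF' hγ
  have hx0 := Real.exp_pos (-sigma0 F c γ)
  have hx1 := exp_neg_lt_one h0
  refine le_trans (le_of_eq ?_) (le_max_left _ _)
  have e2 : Real.exp (-2 * sigma0 F c γ) = Real.exp (-sigma0 F c γ) ^ 2 := by
    rw [← Real.exp_nat_mul]; congr 1; push_cast; ring
  have e4 : Real.exp (-4 * sigma0 F c γ) = Real.exp (-sigma0 F c γ) ^ 4 := by
    rw [← Real.exp_nat_mul]; congr 1; push_cast; ring
  have e1 : Real.exp (sigma0 F c γ) = (Real.exp (-sigma0 F c γ))⁻¹ := by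
    rw [← Real.exp_neg, neg_neg]
  rw [e2, e4, e1]
  generalize Real.exp (-sigma0 F c γ) = x at hx0 hx1
  have h1 : 0 < 1 - x := by linarith
  have h2 : 0 < 1 - x ^ 2 := by nlinarith
  have h3 : x⁻¹ - 1 = (1 - x) / x := by field_simp
  have h4 : 1 - x ^ 4 = (1 - x ^ 2) * (1 + x ^ 2) := by ring
  rw [h3, h4]
  field_simp

/-- Needed for the mode m = 0, which the second term of C_K does not see. With y = e^{-σ₁} and x =
y⁴ = e^{-σ₀}, one has 1 - x² ≤ 2(1 - x) ≤ 8(1 - y), while 1/(1 - x²) is at most the first term of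
C_K. This is the origin of the factor 8. -/
theorem one_div_le_CK (hF' : 0 < deriv F (-c)) (hγ : 0 < γ) :
    1 / (1 - Real.exp (-sigma1 F c γ)) ≤ 8 * CK F c γ := by
  have h0 := sigma0_pos (c := c) hF' hγ
  have hs := sigma1_pos (c := c) hF' hγ
  have hy0 := Real.exp_pos (-sigma1 F c γ)
  have hy1 := exp_neg_lt_one hs
  have h := firstTerm_le_CK (c := c) hF' hγ
  have e : Real.exp (-sigma0 F c γ) = Real.exp (-sigma1 F c γ) ^ 4 := by
    rw [← Real.exp_nat_mul, sigma0_eq]; congr 1; push_cast; ring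
  rw [e] at h
  generalize Real.exp (-sigma1 F c γ) = y at *
  have hx1 : y ^ 4 < 1 := pow_lt_one₀ hy0.le hy1 (by norm_num)
  have hx0 : 0 < y ^ 4 := by positivity
  have hd : 1 - y ^ 4 ≤ 4 * (1 - y) := by nlinarith [sq_nonneg (y ^ 2 - 1), sq_nonneg (y - 1)]
  generalize y ^ 4 = x at *
  have h1 : 0 < 1 - x := by linarith
  have h2 : 0 < 1 - x ^ 2 := by nlinarith
  have h5 : 1 ≤ 1 / (1 - x ^ 2) := by rw [le_div_iff₀ h2]; nlinarith
  have h6 : 0 ≤ x / (1 - x) := by positivity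
  have h7 : 1 / (1 - x ^ 2) ≤ CK F c γ := by
    refine le_trans ?_ h
    nlinarith
  refine le_trans ?_ (mul_le_mul_of_nonneg_left h7 (by norm_num : (0 : ℝ) ≤ 8))
  rw [mul_one_div, div_le_div_iff₀ (by linarith) h2]
  nlinarith

theorem CK_pos (hF' : 0 < deriv F (-c)) (hγ : 0 < γ) : 0 < CK F c γ := by
  have h1 := one_div_le_CK (c := c) hF' hγ
  have hy1 := exp_neg_lt_one (sigma1_pos (c := c) hF' hγ)
  have : 0 < 1 / (1 - Real.exp (-sigma1 F c γ)) := one_div_pos.2 (by linarith)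
  linarith

/-- With x = e^{-σ₀} and |z| ≤ x², the left side is at most twice the first term of C_K; the larger
factor 8 is taken to match the other modes. -/
theorem nonres_const_le (hF' : 0 < deriv F (-c)) (hγ : 0 < γ) {m : ℤ} (hm : m0 F c γ < |m|) :
    2 * |zRoot F c γ m| / ((1 - |zRoot F c γ m|) * (1 - Real.exp (-sigma0 F c γ)))
      ≤ 8 * CK F c γ := by
  have h0 := sigma0_pos (c := c) hF' hγ
  have hx0 := Real.exp_pos (-sigma0 F c γ)
  have hx1 := exp_neg_lt_one h0
  have h := firstTerm_le_CK (c := c) hF' hγ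
  have hz := abs_zRoot_le hF' hγ hm
  have e2 : Real.exp (-2 * sigma0 F c γ) = Real.exp (-sigma0 F c γ) ^ 2 := by
    rw [← Real.exp_nat_mul]; congr 1; push_cast; ring
  rw [e2] at hz
  have hz0 := abs_nonneg (zRoot F c γ m)
  generalize |zRoot F c γ m| = z at *
  generalize Real.exp (-sigma0 F c γ) = x at *
  have h1 : 0 < 1 - x := by linarith
  have h2 : 0 < 1 - x ^ 2 := by nlinarith
  have h3 : 0 < 1 - z := by linarith
  calc 2 * z / ((1 - z) * (1 - x)) ≤ 2 * x / ((1 - x ^ 2) * (1 - x)) := by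
        gcongr
        nlinarith
    _ = 2 * (1 / (1 - x ^ 2) * (x / (1 - x))) := by field_simp
    _ ≤ 2 * (1 / (1 - x ^ 2) * (x / (1 - x) + 1 / (1 - x ^ 2))) := by
        gcongr
        exact le_add_of_nonneg_right (by positivity)
    _ ≤ 8 * CK F c γ := by
        have : 0 < 1 / (1 - x ^ 2) * (x / (1 - x) + 1 / (1 - x ^ 2)) := by positivity
        linarith

/-- For m ≠ 0, cos β = -δ_m/2 and non-resonance gives sin β ≠ 0, so 2/|sin β| bounds the kernel. The
phase is taken at |m| because the maximum in C_K runs over positive modes. For m = 0 the kernel is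
constantly 1. -/
theorem exists_resCoef_bound (hF' : 0 < deriv F (-c)) (hγ : 0 < γ)
    (hres : ∀ m : ℤ, ((m : ℝ) * γ) ^ 2 / deriv F (-c) ≠ 4) {m : ℤ} (hm : |m| ≤ m0 F c γ) :
    ∃ T : ℝ, (∀ j, |resCoef (delta F c γ m) j| ≤ T) ∧
      T / (1 - Real.exp (-sigma1 F c γ)) ≤ 8 * CK F c γ := by
  rcases eq_or_ne m 0 with rfl | hm0
  · refine ⟨1, fun j => ?_, one_div_le_CK hF' hγ⟩
    rw [delta_zero, resCoef_neg_two, abs_one]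
  · have hlt := delta_lt_two hF' hγ hres hm
    have hgt := neg_two_lt_delta (c := c) hF' hγ hm0
    have hpos : 0 < |m| := abs_pos.2 hm0
    have hcos : Real.cos (beta F c γ |m|) = -(delta F c γ m / 2) := by
      unfold beta
      rw [Int.sign_eq_one_of_pos hpos, delta_abs, Int.cast_one, neg_one_mul, Real.cos_neg,
        Real.cos_arccos (by linarith) (by linarith)]
    have hsin : Real.sin (beta F c γ |m|) ≠ 0 := by
      intro h
      have := Real.sin_sq_add_cos_sq (beta F c γ |m|)
      rw [h, hcos] at this
      nlinarith
    have hd : delta F c γ m = -2 * Real.cos (beta F c γ |m|) := by rw [hcos]; ring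
    refine ⟨2 / |Real.sin (beta F c γ |m|)|, fun j => ?_, ?_⟩
    · rw [hd]
      exact abs_resCoef_le hsin j
    · have hy1 := exp_neg_lt_one (sigma1_pos (c := c) hF' hγ)
      have hle : 1 / |Real.sin (beta F c γ |m|)| ≤
          sSup ((fun m : ℤ => 1 / |Real.sin (beta F c γ m)|) '' Set.Ioc 0 (m0 F c γ)) :=
        le_csSup ((Set.finite_Ioc _ _).image _).bddAbove ⟨|m|, ⟨hpos, hm⟩, rfl⟩
      have h2 : 0 < 2 / (1 - Real.exp (-sigma1 F c γ)) := div_pos two_pos (by linarith)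
      have h3 : 2 / (1 - Real.exp (-sigma1 F c γ)) *
          sSup ((fun m : ℤ => 1 / |Real.sin (beta F c γ m)|) '' Set.Ioc 0 (m0 F c γ))
          ≤ CK F c γ := le_max_right _ _
      have h4 := mul_le_mul_of_nonneg_left hle h2.le
      have h5 := CK_pos (c := c) hF' hγ
      calc _ = 2 / (1 - Real.exp (-sigma1 F c γ)) * (1 / |Real.sin (beta F c γ |m|)|) := by
            field_simp
        _ ≤ 8 * CK F c γ := by linarith

end Modes

end
end DrivenLattice

namespace DrivenLattice
noncomputable section
open scoped ENNReal

/-! ### The solution operator of the linearized lattice -/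

/-- The decaying solution of the inhomogeneous linearized equation, with vanishing boundary values
at the non-resonant modes. -/
def linSol (F : ℝ → ℝ) (c γ : ℝ) (y : ℕ → ℤ → ℂ) (n : ℕ) (m : ℤ) : ℂ :=
  if m0 F c γ < |m| then nonresRow (zRoot F c γ m) (fun n => y n m) n
  else resRow (delta F c γ m) (fun n => y n m) n

/-- The decaying solution of the homogeneous linearized equation with boundary values `f` at the
non-resonant modes. -/
def bdrySol (F : ℝ → ℝ) (c γ : ℝ) (f : ℤ → ℂ) (n : ℕ) (m : ℤ) : ℂ :=
  if m0 F c γ < |m| then (zRoot F c γ m : ℂ) ^ n * f m else 0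

theorem decays_of_rowE {σ : ℝ} {y : ℕ → ℤ → ℂ} {m : ℤ} (h : rowE σ y m ≠ ⊤) :
    Decays σ (rowE σ y m).toReal fun n => y n m := fun n => by
  rw [← ENNReal.ofReal_le_iff_le_toReal h, ENNReal.ofReal_mul (Real.exp_pos _).le, ofReal_norm]
  exact le_rowE _ _ _ _

theorem decays_of_eN {σ : ℝ} {w : AdmissibleWeight} {y : ℕ → ℤ → ℂ} (h : eN σ w y ≠ ⊤) (m : ℤ) :
    Decays σ (rowE σ y m).toReal fun n => y n m :=
  decays_of_rowE (ne_top_of_le_ne_top h (rowE_le_eN σ w y m))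

theorem rowE_le_of_decays {σ A : ℝ} {y : ℕ → ℤ → ℂ} {m : ℤ} (h : Decays σ A fun n => y n m) :
    rowE σ y m ≤ ENNReal.ofReal A := by
  refine rowE_le_of_le fun n => ?_
  rw [← ofReal_norm, ← ENNReal.ofReal_mul (Real.exp_pos _).le]
  exact ENNReal.ofReal_le_ofReal (h n)

section
variable {F : ℝ → ℝ} {c γ τ : ℝ} {w : AdmissibleWeight}

theorem eN_linSol_le (hF' : 0 < deriv F (-c)) (hγ : 0 < γ)
    (hres : ∀ m : ℤ, ((m : ℝ) * γ) ^ 2 / deriv F (-c) ≠ 4) (h1 : sigma1 F c γ ≤ τ)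
    (h2 : τ ≤ sigma0 F c γ) (w : AdmissibleWeight) (y : ℕ → ℤ → ℂ) :
    eN τ w (linSol F c γ y) ≤ ENNReal.ofReal (8 * CK F c γ) * eN τ w y := by
  have hCK := CK_pos (c := c) hF' hγ
  have hτ : 0 < τ := (sigma1_pos hF' hγ).trans_le h1
  refine eN_le_of_rowE_le fun m => ?_
  -- On a row of infinite norm the right side is infinite because C_K > 0, so nothing has to be
  -- known about the series there.
  by_cases ht : rowE τ y m = ⊤
  · rw [ht, ENNReal.mul_top (by simpa using hCK)]
    exact le_top
  have hd := decays_of_rowE ht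
  have hA := hd.nonneg
  rw [← ENNReal.ofReal_toReal ht, ← ENNReal.ofReal_mul (by positivity)]
  refine rowE_le_of_decays ?_
  by_cases hm : m0 F c γ < |m|
  · have hz := abs_zRoot_lt_one (two_lt_delta hF' hγ hm)
    have hq := exp_neg_lt_one (sigma0_pos (c := c) hF' hγ)
    -- The rate 2σ₀ of z_m is split: one σ₀ pays for the decay τ ≤ σ₀, the other leaves the ratio q
    -- = e^{-σ₀}.
    have hzq : |zRoot F c γ m| ≤ Real.exp (-sigma0 F c γ) * Real.exp (-τ) := by
      refine (abs_zRoot_le hF' hγ hm).trans ?_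
      rw [← Real.exp_add]
      exact Real.exp_le_exp.2 (by linarith)
    have := decays_nonresRow hτ hz hq hzq hd
    intro n
    simp only [linSol, if_pos hm]
    exact (this n).trans (mul_le_mul_of_nonneg_right (nonres_const_le hF' hγ hm) hA)
  · obtain ⟨T, hT, hTC⟩ := exists_resCoef_bound hF' hγ hres (not_lt.1 hm)
    have hT0 : 0 ≤ T := (abs_nonneg _).trans (hT 0)
    intro n
    simp only [linSol, if_neg hm]
    refine (decays_resRow hτ hT hd n).trans (mul_le_mul_of_nonneg_right (le_trans ?_ hTC) hA)
    have h3 := exp_neg_lt_one (sigma1_pos (c := c) hF' hγ)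
    -- The lower limit τ ≥ σ₁ keeps the geometric sum uniformly bounded.
    have h4 : Real.exp (-τ) ≤ Real.exp (-sigma1 F c γ) := Real.exp_le_exp.2 (by linarith)
    exact div_le_div_of_nonneg_left hT0 (by linarith) (by linarith)

theorem linSol_add (hF' : 0 < deriv F (-c)) (hγ : 0 < γ)
    (hres : ∀ m : ℤ, ((m : ℝ) * γ) ^ 2 / deriv F (-c) ≠ 4) (hτ : 0 < τ) {y y' : ℕ → ℤ → ℂ}
    (hy : eN τ w y ≠ ⊤) (hy' : eN τ w y' ≠ ⊤) :
    linSol F c γ (y + y') = linSol F c γ y + linSol F c γ y' := by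
  funext n m
  have hd := decays_of_eN hy m
  have hd' := decays_of_eN hy' m
  simp only [linSol, Pi.add_apply]
  split_ifs with hm
  · exact congrFun (nonresRow_add hτ (abs_zRoot_lt_one (two_lt_delta hF' hγ hm)) hd hd') n
  · obtain ⟨T, hT, -⟩ := exists_resCoef_bound hF' hγ hres (not_lt.1 hm)
    exact congrFun (resRow_add hτ hT hd hd') n

theorem linSol_smul (a : ℂ) (y : ℕ → ℤ → ℂ) : linSol F c γ (a • y) = a • linSol F c γ y := by
  funext n m
  simp only [linSol, Pi.smul_apply]
  split_ifs with hm
  · exact congrFun (nonresRow_smul (y := fun n => y n m) a) n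
  · exact congrFun (resRow_smul (y := fun n => y n m) a) n

theorem linSol_eq (hF' : 0 < deriv F (-c)) (hγ : 0 < γ)
    (hres : ∀ m : ℤ, ((m : ℝ) * γ) ^ 2 / deriv F (-c) ≠ 4) (hτ : 0 < τ) {y : ℕ → ℤ → ℂ}
    (hy : eN τ w y ≠ ⊤) (n : ℕ) (m : ℤ) :
    linSol F c γ y n m + delta F c γ m * linSol F c γ y (n + 1) m + linSol F c γ y (n + 2) m
      + (y (n + 1) m - y (n + 2) m) = 0 := by
  have hd := decays_of_eN hy m
  simp only [linSol]
  split_ifs with hm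
  · have h := two_lt_delta hF' hγ hm
    exact nonresRow_eq hτ (abs_zRoot_lt_one h) (zRoot_ne_zero h) (zRoot_sq h) hd n
  · obtain ⟨T, hT, -⟩ := exists_resCoef_bound hF' hγ hres (not_lt.1 hm)
    exact resRow_eq hτ hT hd n

theorem linSol_zero_apply {m : ℤ} (hm : m0 F c γ < |m|) (y : ℕ → ℤ → ℂ) :
    linSol F c γ y 0 m = 0 := by
  simp only [linSol, if_pos hm, nonresRow]

/-- Since e^τ |z_m| ≤ e^{-σ₀} < 1, the weighted moduli along each row are at most the value at n =
0, and only boundary data are summed. -/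
theorem eN_bdrySol_le (hF' : 0 < deriv F (-c)) (hγ : 0 < γ) (h2 : τ ≤ sigma0 F c γ)
    (w : AdmissibleWeight) (f : ℤ → ℂ) :
    eN τ w (bdrySol F c γ f)
      ≤ ∑' m : ℤ, ENNReal.ofReal (w m) * if m0 F c γ < |m| then ‖f m‖ₑ else 0 := by
  refine ENNReal.tsum_le_tsum fun m => ?_
  gcongr
  refine rowE_le_of_le fun n => ?_
  simp only [bdrySol]
  split_ifs with hm
  · have hz := abs_zRoot_le hF' hγ hm
    have h0 := sigma0_pos (c := c) hF' hγ
    rw [enorm_mul, ← mul_assoc]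
    refine mul_le_of_le_one_left zero_le ?_
    rw [← ofReal_norm, ← ENNReal.ofReal_mul (Real.exp_pos _).le, ← ENNReal.ofReal_one]
    apply ENNReal.ofReal_le_ofReal
    rw [norm_pow, Complex.norm_real, Real.norm_eq_abs, mul_comm τ, Real.exp_nat_mul, ← mul_pow]
    refine pow_le_one₀ (by positivity) ?_
    calc _ ≤ Real.exp τ * Real.exp (-2 * sigma0 F c γ) := by gcongr
      _ ≤ 1 := by
        rw [← Real.exp_add]
        exact Real.exp_le_one_iff.2 (by linarith)
  · simp

theorem bdrySol_eq (hF' : 0 < deriv F (-c)) (hγ : 0 < γ) (f : ℤ → ℂ) (n : ℕ) (m : ℤ) :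
    bdrySol F c γ f n m + delta F c γ m * bdrySol F c γ f (n + 1) m + bdrySol F c γ f (n + 2) m
      = 0 := by
  simp only [bdrySol]
  split_ifs with hm
  · have h : (zRoot F c γ m : ℂ) ^ 2 + delta F c γ m * zRoot F c γ m + 1 = 0 := by
      exact_mod_cast zRoot_sq (two_lt_delta hF' hγ hm)
    linear_combination (zRoot F c γ m : ℂ) ^ n * f m * h
  · simp

theorem bdrySol_zero_apply {m : ℤ} (hm : m0 F c γ < |m|) (f : ℤ → ℂ) :
    bdrySol F c γ f 0 m = f m := by
  simp only [bdrySol, if_pos hm, pow_zero, one_mul]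

theorem bdrySol_add (f g : ℤ → ℂ) :
    bdrySol F c γ (f + g) = bdrySol F c γ f + bdrySol F c γ g := by
  funext n m
  simp only [bdrySol, Pi.add_apply]
  split_ifs
  · ring
  · simp

theorem bdrySol_smul (a : ℂ) (f : ℤ → ℂ) : bdrySol F c γ (a • f) = a • bdrySol F c γ f := by
  funext n m
  simp only [bdrySol, Pi.smul_apply, smul_eq_mul]
  split_ifs
  · ring
  · simp

theorem bdrySol_sub (f g : ℤ → ℂ) :
    bdrySol F c γ (f - g) = bdrySol F c γ f - bdrySol F c γ g := by
  rw [sub_eq_add_neg, sub_eq_add_neg, bdrySol_add, ← neg_one_smul ℂ g, bdrySol_smul, neg_one_smul]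

theorem eq_zero_of_homogeneous (hF' : 0 < deriv F (-c)) (hγ : 0 < γ)
    (hτ : 0 < τ) {d : ℕ → ℤ → ℂ} (hd : eN τ w d ≠ ⊤)
    (heq : ∀ n m, d n m + delta F c γ m * d (n + 1) m + d (n + 2) m = 0)
    (h0 : ∀ m, m0 F c γ < |m| → d 0 m = 0) : d = 0 := by
  have key : ∀ m, (fun n => d n m) = 0 := fun m => by
    have hlim := (decays_of_eN hd m).tendsto hτ
    by_cases hm : m0 F c γ < |m|
    · have h := two_lt_delta hF' hγ hm
      refine eq_zero_of_small_root (ζ := (zRoot F c γ m : ℂ)) ?_ ?_ hlim (fun n => heq n m)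
        (h0 m hm)
      · rw [Complex.norm_real]
        exact (abs_zRoot_lt_one h).le
      · exact_mod_cast zRoot_sq h
    · obtain ⟨ζ, hζ, hζ2⟩ := exists_unit_root (neg_two_le_delta (c := c) (γ := γ) hF' m)
        ((delta_le_two_iff hF' hγ m).2 (not_lt.1 hm))
      exact eq_zero_of_unit_root hζ hζ2 hlim fun n => heq n m
  funext n m
  exact congrFun (key m) n

end

/-- The solution operator on sequences in the Wiener algebra. -/
def linOp (F : ℝ → ℝ) (c γ : ℝ) (y : WSeq) : WSeq := lift (linSol F c γ (raw y))

section
variable {F : ℝ → ℝ} {c γ τ : ℝ} {w : AdmissibleWeight}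

theorem nrm_linOp_le (hF' : 0 < deriv F (-c)) (hγ : 0 < γ)
    (hres : ∀ m : ℤ, ((m : ℝ) * γ) ^ 2 / deriv F (-c) ≠ 4) (h1 : sigma1 F c γ ≤ τ)
    (h2 : τ ≤ sigma0 F c γ) (w : AdmissibleWeight) (y : WSeq) :
    nrm τ w (linOp F c γ y) ≤ ENNReal.ofReal (8 * CK F c γ) * nrm τ w y :=
  (nrm_lift_le _ _ _).trans (eN_linSol_le hF' hγ hres h1 h2 w _)

theorem raw_linOp (hF' : 0 < deriv F (-c)) (hγ : 0 < γ)
    (hres : ∀ m : ℤ, ((m : ℝ) * γ) ^ 2 / deriv F (-c) ≠ 4) (h1 : sigma1 F c γ ≤ τ)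
    (h2 : τ ≤ sigma0 F c γ) {y : WSeq} (hy : nrm τ w y ≠ ⊤) :
    raw (linOp F c γ y) = linSol F c γ (raw y) :=
  raw_lift (ne_top_of_le_ne_top (ENNReal.mul_ne_top ENNReal.ofReal_ne_top hy)
    (eN_linSol_le hF' hγ hres h1 h2 w (raw y)))

theorem linOp_add (hF' : 0 < deriv F (-c)) (hγ : 0 < γ)
    (hres : ∀ m : ℤ, ((m : ℝ) * γ) ^ 2 / deriv F (-c) ≠ 4) (h1 : sigma1 F c γ ≤ τ)
    (h2 : τ ≤ sigma0 F c γ) {y y' : WSeq} (hy : nrm τ w y ≠ ⊤) (hy' : nrm τ w y' ≠ ⊤) :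
    linOp F c γ (y + y') = linOp F c γ y + linOp F c γ y' := by
  have hyy : nrm τ w (y + y') ≠ ⊤ :=
    ne_top_of_le_ne_top (ENNReal.add_ne_top.2 ⟨hy, hy'⟩) (nrm_add_le y y')
  apply raw_injective
  rw [raw_linOp hF' hγ hres h1 h2 hyy]
  change linSol F c γ (raw y + raw y') = raw (linOp F c γ y) + raw (linOp F c γ y')
  rw [raw_linOp hF' hγ hres h1 h2 hy, raw_linOp hF' hγ hres h1 h2 hy',
    linSol_add hF' hγ hres ((sigma1_pos hF' hγ).trans_le h1) hy hy']

theorem linOp_smul (hF' : 0 < deriv F (-c)) (hγ : 0 < γ)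
    (hres : ∀ m : ℤ, ((m : ℝ) * γ) ^ 2 / deriv F (-c) ≠ 4) (h1 : sigma1 F c γ ≤ τ)
    (h2 : τ ≤ sigma0 F c γ) (a : ℂ) {y : WSeq} (hy : nrm τ w y ≠ ⊤) :
    linOp F c γ (a • y) = a • linOp F c γ y := by
  have hyy : nrm τ w (a • y) ≠ ⊤ :=
    ne_top_of_le_ne_top (ENNReal.mul_ne_top enorm_ne_top hy) (nrm_smul_le a y)
  apply raw_injective
  rw [raw_linOp hF' hγ hres h1 h2 hyy]
  change linSol F c γ (a • raw y) = a • raw (linOp F c γ y)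
  rw [raw_linOp hF' hγ hres h1 h2 hy, linSol_smul]

end

end
end DrivenLattice

namespace DrivenLattice
noncomputable section
open scoped ENNReal

/-! ### The contraction principle -/

/-- Absorption of the contraction term. Finiteness of a is essential, as the hypothesis holds
trivially for a = ∞. -/
theorem le_two_mul_of_le_add_half {a e : ℝ≥0∞} (ha : a ≠ ⊤) (h : a ≤ e + 2⁻¹ * a) :
    a ≤ 2 * e := by
  have h2 : 2⁻¹ * a ≠ ⊤ := ENNReal.mul_ne_top (by simp) ha
  have h3 : 2⁻¹ * a + 2⁻¹ * a = a := by
    rw [← add_mul, ENNReal.inv_two_add_inv_two, one_mul]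
  have h4 : 2⁻¹ * a ≤ e := by
    rw [← h3] at h
    rw [h3] at h
    have h5 : 2⁻¹ * a + 2⁻¹ * a ≤ e + 2⁻¹ * a := h3.le.trans h
    exact (ENNReal.add_le_add_iff_right h2).1 h5
  calc a = 2 * (2⁻¹ * a) := by
        rw [← mul_assoc, ENNReal.mul_inv_cancel (by simp) (by simp), one_mul]
    _ ≤ 2 * e := by gcongr

/-- The contraction principle on balls of the weighted spaces. -/
theorem exists_fixedPoint {σ : ℝ} {w : AdmissibleWeight} {Φ : WSeq → WSeq} {ρ : ℝ≥0∞}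
    (hρ : ρ ≠ ⊤) (hmap : ∀ x, nrm σ w x ≤ ρ → nrm σ w (Φ x) ≤ ρ)
    (hcontr : ∀ x y, nrm σ w x ≤ ρ → nrm σ w y ≤ ρ →
      nrm σ w (Φ x - Φ y) ≤ 2⁻¹ * nrm σ w (x - y)) :
    ∃ x, nrm σ w x ≤ ρ ∧ Φ x = x := by
  set X : ℕ → WSeq := fun k => Φ^[k] 0 with hX
  have hX1 : ∀ k, X (k + 1) = Φ (X k) := fun k => Function.iterate_succ_apply' Φ k 0
  have hXρ : ∀ k, nrm σ w (X k) ≤ ρ := fun k => by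
    induction k with
    | zero => simp [hX]
    | succ k ih => rw [hX1]; exact hmap _ ih
  set d : ℕ → WSeq := fun k => X (k + 1) - X k with hd
  have hdk : ∀ k, nrm σ w (d k) ≤ 2⁻¹ ^ k * ρ := fun k => by
    induction k with
    | zero => simpa [hd, hX] using hXρ 1
    | succ k ih =>
      calc nrm σ w (d (k + 1)) = nrm σ w (Φ (X (k + 1)) - Φ (X k)) := by
            simp only [hd]; rw [hX1 (k + 1), hX1 k]
        _ ≤ 2⁻¹ * nrm σ w (d k) := hcontr _ _ (hXρ _) (hXρ _)
        _ ≤ 2⁻¹ * (2⁻¹ ^ k * ρ) := by gcongr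
        _ = _ := by rw [pow_succ']; ring
  have htail : ∀ K, ∑' k, nrm σ w (d (k + K)) ≤ 2 * ρ * 2⁻¹ ^ K := fun K => by
    calc _ ≤ ∑' k : ℕ, 2⁻¹ ^ k * (2⁻¹ ^ K * ρ) := by
          refine ENNReal.tsum_le_tsum fun k => (hdk _).trans (le_of_eq ?_)
          rw [pow_add, mul_assoc]
      _ = _ := by
          rw [ENNReal.tsum_mul_right, ENNReal.tsum_geometric, ENNReal.one_sub_inv_two, inv_inv]
          ring
  have hsum : ∀ n m, Summable fun k => d k n m := fun n m => by
    apply Summable.of_norm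
    rw [← tsum_enorm_ne_top_iff_summable_norm]
    have h1 : ENNReal.ofReal (Real.exp (σ * n)) * ∑' k, ‖d k n m‖ₑ ≤ 2 * ρ * 2⁻¹ ^ 0 := by
      rw [← ENNReal.tsum_mul_left]
      exact (ENNReal.tsum_le_tsum fun k => exp_mul_enorm_le_eN σ w (raw (d k)) n m).trans (htail 0)
    intro ht
    rw [ht, ENNReal.mul_top (by simp [Real.exp_pos]), pow_zero, mul_one, top_le_iff] at h1
    exact ENNReal.mul_ne_top (by simp) hρ h1
  -- The limit is built entrywise as the telescoping sum of the increments. Countable subadditivity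
  -- turns the geometric tail bound into convergence in the weighted norm, without a separate
  -- completeness statement.
  set f : ℕ → ℤ → ℂ := fun n m => ∑' k, d k n m with hf
  have hfX : ∀ K, eN σ w (f - raw (X K)) ≤ 2 * ρ * 2⁻¹ ^ K := fun K => by
    have e : f - raw (X K) = fun n m => ∑' k, raw (d (k + K)) n m := by
      funext n m
      have h1 : ∑ k ∈ Finset.range K, d k n m = X K n m := by
        induction K with
        | zero => simp [hX]
        | succ K ih =>
          rw [Finset.sum_range_succ, ih]
          simp [hd]
      have h2 := (hsum n m).sum_add_tsum_nat_add K
      simp only [Pi.sub_apply, raw_apply, hf]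
      rw [← h2, h1]
      ring
    rw [e]
    exact (eN_tsum_le _ _ _).trans (htail K)
  have hlim : Filter.Tendsto (fun K : ℕ => 2 * ρ * (2⁻¹ : ℝ≥0∞) ^ K) Filter.atTop (nhds 0) := by
    have h := ENNReal.Tendsto.const_mul (a := 2 * ρ)
      (ENNReal.tendsto_pow_atTop_nhds_zero_of_lt_one (r := 2⁻¹) (by simp))
      (Or.inr (ENNReal.mul_ne_top (by simp) hρ))
    simpa using h
  have hfρ : eN σ w f ≤ ρ := by
    have h : ∀ K, eN σ w f ≤ 2 * ρ * 2⁻¹ ^ K + ρ := fun K => by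
      calc eN σ w f = eN σ w ((f - raw (X K)) + raw (X K)) := by rw [sub_add_cancel]
        _ ≤ _ := (eN_add_le _ _ _ _).trans (add_le_add (hfX K) (hXρ K))
    have := ge_of_tendsto' (hlim.add_const ρ) h
    simpa using this
  have hraw : raw (lift f) = f := raw_lift (ne_top_of_le_ne_top hρ hfρ)
  have hxρ : nrm σ w (lift f) ≤ ρ := by rw [nrm, hraw]; exact hfρ
  have hxX : ∀ K, nrm σ w (lift f - X K) ≤ 2 * ρ * 2⁻¹ ^ K := fun K => by
    have e : raw (lift f - X K) = f - raw (X K) := by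
      change raw (lift f) - raw (X K) = _
      rw [hraw]
    rw [nrm, e]
    exact hfX K
  refine ⟨lift f, hxρ, ?_⟩
  rw [← sub_eq_zero]
  refine eq_zero_of_nrm_eq_zero (σ := σ) (w := w) (nonpos_iff_eq_zero.1 ?_)
  -- Both Φ(f) - Φ(X_K) and f - X_{K+1} are bounded by the tail, so the defect of the fixed point
  -- equation is arbitrarily small.
  have h : ∀ K, nrm σ w (Φ (lift f) - lift f) ≤ 2 * (2 * ρ * 2⁻¹ ^ K) := fun K => by
    have e : Φ (lift f) - lift f = (Φ (lift f) - Φ (X K)) - (lift f - X (K + 1)) := by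
      rw [hX1]; abel
    rw [e]
    refine (nrm_sub_le _ _).trans ?_
    rw [two_mul]
    refine add_le_add ((hcontr _ _ hxρ (hXρ K)).trans ?_) ((hxX (K + 1)).trans ?_)
    · exact (mul_le_of_le_one_left zero_le (by simp)).trans (hxX K)
    · gcongr 2 * ρ * ?_
      rw [pow_succ]
      exact mul_le_of_le_one_right zero_le (by simp)
  have := ge_of_tendsto' (ENNReal.Tendsto.const_mul (a := 2) hlim (Or.inr (by simp))) h
  simpa using this

/-- The hypotheses on the linear solution operator `K` and the nonlinearity with coefficients `c`
under which the fixed point problem is a contraction. -/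
structure Contractive (w : AdmissibleWeight) (s : ℝ) (κ t r : ℝ≥0∞) (c : ℕ → ℂ)
    (K : WSeq → WSeq) : Prop where
  pos : 0 < s
  le_one : 4 * s ≤ 1
  bound : ∀ τ, s ≤ τ → τ ≤ 4 * s → ∀ y, nrm τ w (K y) ≤ κ * nrm τ w y
  add : ∀ y y', nrm s w y ≠ ⊤ → nrm s w y' ≠ ⊤ → K (y + y') = K y + K y'
  smul : ∀ (a : ℂ) y, nrm s w y ≠ ⊤ → K (a • y) = a • K y
  kappa_ne_top : κ ≠ ⊤
  r_ne_zero : r ≠ 0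
  r_ne_top : r ≠ ⊤
  coefSum_ne_top : coefSum c r ≠ ⊤
  t_le : 4 * t ≤ r
  contr : κ * (4 * (4 * t * coefSum c r)) ≤ 2⁻¹

/-- The nonlinear term of the fixed point problem. -/
def nonlin (c : ℕ → ℂ) (u v : WSeq) : WSeq := ser c (wdiff u + wdiff v) - ser c (wdiff u)

namespace Contractive
variable {w : AdmissibleWeight} {s : ℝ} {κ t r : ℝ≥0∞} {c : ℕ → ℂ} {K : WSeq → WSeq}
variable (H : Contractive w s κ t r c K)
include H

theorem t_ne_top : t ≠ ⊤ := by
  intro h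
  have := H.t_le
  rw [h, ENNReal.mul_top (by simp), top_le_iff] at this
  exact H.r_ne_top this

theorem sub {y y' : WSeq} (h : nrm s w y ≠ ⊤) (h' : nrm s w y' ≠ ⊤) :
    K (y - y') = K y - K y' := by
  rw [sub_eq_add_neg, ← neg_one_smul ℂ y', H.add _ _ h, H.smul _ _ h', neg_one_smul,
    sub_eq_add_neg]
  exact ne_top_of_le_ne_top (ENNReal.mul_ne_top enorm_ne_top h') (nrm_smul_le _ _)

omit H in
theorem mulBound_wdiff {u : WSeq} {t : ℝ≥0∞} (hu : nrm 0 w u ≤ t) :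
    MulBound w 0 (2 * t) (wdiff u) :=
  MulBound.of_nrm_le ((nrm_wdiff_le_two le_rfl w u).trans (by gcongr))

omit H in
theorem mulBound_wdiff' {u : WSeq} {t : ℝ≥0∞} (hu : nrm 0 w u ≤ t) :
    MulBound w 0 (4 * t) (wdiff u) :=
  (mulBound_wdiff hu).mono (by gcongr; norm_num)

omit H in
theorem mulBound_wdiff_add {u v : WSeq} {t : ℝ≥0∞} (hu : nrm 0 w u ≤ t) (hv : nrm 0 w v ≤ t) :
    MulBound w 0 (4 * t) (wdiff u + wdiff v) :=
  ((mulBound_wdiff hu).add (mulBound_wdiff hv)).mono (le_of_eq (by ring))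

theorem nrm_wdiff {τ : ℝ} (h2 : τ ≤ 4 * s) (z : WSeq) : nrm τ w (wdiff z) ≤ 4 * nrm τ w z :=
  nrm_wdiff_le (h2.trans H.le_one) w z

/-- All the decay sits in the factor `wdiff z`; the divided difference acts at rate 0 and is as
small as the ball, with bound 4t times `coefSum`. -/
theorem nrm_prod_le {τ : ℝ} (h2 : τ ≤ 4 * s) {x y : WSeq}
    (hx : MulBound w 0 (4 * t) x) (hy : MulBound w 0 (4 * t) y) (z : WSeq) :
    nrm τ w (wdiff z * serDiv c x y) ≤ 4 * (4 * t * coefSum c r) * nrm τ w z := by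
  have h := mulBound_serDiv H.r_ne_top H.coefSum_ne_top H.t_le hx hy τ (wdiff z)
  rw [add_zero] at h
  calc _ ≤ _ := h
    _ ≤ 4 * t * coefSum c r * (4 * nrm τ w z) := by gcongr; exact H.nrm_wdiff h2 z
    _ = _ := by ring

theorem prod_ne_top {τ : ℝ} (h2 : τ ≤ 4 * s) {x y : WSeq}
    (hx : MulBound w 0 (4 * t) x) (hy : MulBound w 0 (4 * t) y) {z : WSeq}
    (hz : nrm τ w z ≠ ⊤) : nrm τ w (wdiff z * serDiv c x y) ≠ ⊤ := by
  refine ne_top_of_le_ne_top (ENNReal.mul_ne_top ?_ hz) (H.nrm_prod_le h2 hx hy z)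
  exact ENNReal.mul_ne_top (by simp) (ENNReal.mul_ne_top
    (ENNReal.mul_ne_top (by simp) H.t_ne_top) H.coefSum_ne_top)

theorem nrm_K_prod_le {τ : ℝ} (h1 : s ≤ τ) (h2 : τ ≤ 4 * s) {x y : WSeq}
    (hx : MulBound w 0 (4 * t) x) (hy : MulBound w 0 (4 * t) y) (z : WSeq) :
    nrm τ w (K (wdiff z * serDiv c x y)) ≤ 2⁻¹ * nrm τ w z := by
  refine (H.bound τ h1 h2 _).trans ?_
  calc _ ≤ κ * (4 * (4 * t * coefSum c r) * nrm τ w z) := by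
        gcongr; exact H.nrm_prod_le h2 hx hy z
    _ = κ * (4 * (4 * t * coefSum c r)) * nrm τ w z := by ring
    _ ≤ _ := by gcongr; exact H.contr

theorem nonlin_sub_nonlin {u v v' : WSeq} (hu : nrm 0 w u ≤ t) (hv : nrm 0 w v ≤ t)
    (hv' : nrm 0 w v' ≤ t) : nonlin c u v - nonlin c u v'
      = wdiff (v - v') * serDiv c (wdiff u + wdiff v) (wdiff u + wdiff v') := by
  unfold nonlin
  rw [sub_sub_sub_cancel_right, ser_sub_ser H.r_ne_top H.coefSum_ne_top
    ((mulBound_wdiff_add hu hv).mono H.t_le) ((mulBound_wdiff_add hu hv').mono H.t_le),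
    add_sub_add_left_eq_sub, wdiff_sub]

theorem nonlin_eq {u v : WSeq} (hu : nrm 0 w u ≤ t) (hv : nrm 0 w v ≤ t) :
    nonlin c u v = wdiff v * serDiv c (wdiff u + wdiff v) (wdiff u) := by
  unfold nonlin
  rw [ser_sub_ser H.r_ne_top H.coefSum_ne_top
    ((mulBound_wdiff_add hu hv).mono H.t_le) ((mulBound_wdiff' hu).mono H.t_le),
    add_sub_cancel_left]

theorem nonlin_ne_top {τ : ℝ} (h2 : τ ≤ 4 * s) {u v : WSeq} (hu : nrm 0 w u ≤ t)
    (hv : nrm 0 w v ≤ t) (hτ : nrm τ w v ≠ ⊤) : nrm τ w (nonlin c u v) ≠ ⊤ := by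
  rw [H.nonlin_eq hu hv]
  exact H.prod_ne_top h2 (mulBound_wdiff_add hu hv) (mulBound_wdiff' hu) hτ

theorem four_pos : 0 ≤ 4 * s := by linarith [H.pos]

theorem s_le_four : s ≤ 4 * s := by linarith [H.pos]

theorem nrm_zero_le {v : WSeq} {e : ℝ≥0∞} (hv : nrm (4 * s) w v ≤ e) : nrm 0 w v ≤ e :=
  (nrm_mono H.four_pos v).trans hv

theorem K_nonlin_sub_le {τ : ℝ} (h1 : s ≤ τ) (h2 : τ ≤ 4 * s) {u v v' : WSeq}
    (hu : nrm 0 w u ≤ t) (hv : nrm (4 * s) w v ≤ t) (hv' : nrm (4 * s) w v' ≤ t) :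
    nrm τ w (K (nonlin c u v) - K (nonlin c u v')) ≤ 2⁻¹ * nrm τ w (v - v') := by
  have h0 := H.nrm_zero_le hv
  have h0' := H.nrm_zero_le hv'
  have hs : ∀ {v}, nrm (4 * s) w v ≤ t → nrm s w v ≠ ⊤ := fun {v} h =>
    ne_top_of_le_ne_top H.t_ne_top ((nrm_mono H.s_le_four v).trans h)
  rw [← H.sub (H.nonlin_ne_top H.s_le_four hu h0 (hs hv))
    (H.nonlin_ne_top H.s_le_four hu h0' (hs hv')), H.nonlin_sub_nonlin hu h0 h0']
  exact H.nrm_K_prod_le h1 h2 (mulBound_wdiff_add hu h0) (mulBound_wdiff_add hu h0') _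

/-- The radius 2e is invariant because the boundary term contributes e and the contraction half of
2e. -/
theorem exists_solution {u B : WSeq} {e : ℝ≥0∞} (hu : nrm 0 w u ≤ t)
    (hB : nrm (4 * s) w B ≤ e) (he : 2 * e ≤ t) :
    ∃ v, nrm (4 * s) w v ≤ 2 * e ∧ v = B + K (nonlin c u v) := by
  obtain ⟨v, hv, h⟩ := exists_fixedPoint (σ := 4 * s) (w := w) (ρ := 2 * e)
    (Φ := fun v => B + K (nonlin c u v)) (ne_top_of_le_ne_top H.t_ne_top he)
    (fun v hv => by
      have hv0 := H.nrm_zero_le (hv.trans he)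
      refine (nrm_add_le _ _).trans ?_
      rw [two_mul]
      refine add_le_add hB ?_
      rw [H.nonlin_eq hu hv0]
      refine (H.nrm_K_prod_le H.s_le_four le_rfl (mulBound_wdiff_add hu hv0)
        (mulBound_wdiff' hu) v).trans ?_
      calc _ ≤ 2⁻¹ * (2 * e) := by gcongr
        _ = e := by rw [← mul_assoc, ENNReal.inv_mul_cancel (by simp) (by simp), one_mul])
    (fun v v' hv hv' => by
      rw [add_sub_add_left_eq_sub]
      exact H.K_nonlin_sub_le H.s_le_four le_rfl hu (hv.trans he) (hv'.trans he))
  exact ⟨v, hv, h.symm⟩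

/-- The contraction estimate holds on the whole ball of radius t, so uniqueness reaches beyond the
smaller ball in which the solution is found. -/
theorem solution_unique {u B v v' : WSeq} (hu : nrm 0 w u ≤ t)
    (hv : nrm (4 * s) w v ≤ t) (hv' : nrm (4 * s) w v' ≤ t) (h : v = B + K (nonlin c u v))
    (h' : v' = B + K (nonlin c u v')) : v = v' := by
  have h1 := H.K_nonlin_sub_le H.s_le_four le_rfl hu hv hv'
  have h2 : v - v' = K (nonlin c u v) - K (nonlin c u v') := by
    conv_lhs => rw [h, h']
    rw [add_sub_add_left_eq_sub]
  rw [← h2] at h1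
  have hf : nrm (4 * s) w (v - v') ≠ ⊤ := ne_top_of_le_ne_top
    (ENNReal.add_ne_top.2 ⟨ne_top_of_le_ne_top H.t_ne_top hv,
      ne_top_of_le_ne_top H.t_ne_top hv'⟩) (nrm_sub_le v v')
  have h3 := le_two_mul_of_le_add_half hf (e := 0) (by simpa using h1)
  rw [mul_zero, nonpos_iff_eq_zero] at h3
  exact sub_eq_zero.1 (eq_zero_of_nrm_eq_zero h3)

end Contractive

end
end DrivenLattice

namespace DrivenLattice
noncomputable section
open scoped ENNReal

/-! ### Fixed points and their linearization -/

/-- `v` solves the fixed point problem with parameter `u` and boundary term `B`. -/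
structure IsFix (w : AdmissibleWeight) (s : ℝ) (t : ℝ≥0∞) (c : ℕ → ℂ) (K : WSeq → WSeq)
    (u B v : WSeq) : Prop where
  param_le : nrm 0 w u ≤ t
  le : nrm (4 * s) w v ≤ t
  eq : v = B + K (nonlin c u v)

/-- `d` solves the linearization of the fixed point problem at `(u, v)` in the direction `η` of
the parameter and `β` of the boundary term. -/
structure IsTangent (w : AdmissibleWeight) (s : ℝ) (c : ℕ → ℂ) (K : WSeq → WSeq)
    (u v η β d : WSeq) : Prop where
  ne_top : nrm (3 * s) w d ≠ ⊤
  param_ne_top : nrm (-s) w η ≠ ⊤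
  bdry_ne_top : nrm (3 * s) w β ≠ ⊤
  eq : d = β + K (wdiff v * (wdiff η * serMix c (wdiff u) (wdiff u) (wdiff v)))
    + K (wdiff d * serDiv c (wdiff u + wdiff v) (wdiff u + wdiff v))

namespace Contractive
variable {w : AdmissibleWeight} {s : ℝ} {κ t r : ℝ≥0∞} {c : ℕ → ℂ} {K : WSeq → WSeq}
variable (H : Contractive w s κ t r c K)
include H

theorem nrm_wdiff_mul_le {τ ρ : ℝ} {μ : ℝ≥0∞} {M : WSeq} (hM : MulBound w (-s) μ M)
    (h2 : τ ≤ 4 * s) (hρ : ρ = τ - s) (z : WSeq) :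
    nrm ρ w (wdiff z * M) ≤ 4 * μ * nrm τ w z := by
  have h := hM τ (wdiff z)
  rw [← sub_eq_add_neg, ← hρ] at h
  calc _ ≤ μ * nrm τ w (wdiff z) := h
    _ ≤ μ * (4 * nrm τ w z) := by gcongr; exact H.nrm_wdiff h2 z
    _ = _ := by ring

theorem mulBound_wdiff_neg (η : WSeq) : MulBound w (-s) (2 * nrm (-s) w η) (wdiff η) :=
  MulBound.of_nrm_le (nrm_wdiff_le_two (by linarith [H.pos]) w η)

theorem nrm_mix_le {τ ρ : ℝ} {μ : ℝ≥0∞} {M : WSeq} (hM : MulBound w 0 μ M)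
    (h2 : τ ≤ 4 * s) (hρ : ρ = τ - s) (v η : WSeq) :
    nrm ρ w (wdiff v * (wdiff η * M)) ≤ 8 * μ * nrm (-s) w η * nrm τ w v := by
  refine (H.nrm_wdiff_mul_le ((H.mulBound_wdiff_neg η).mul hM) h2 hρ v).trans (le_of_eq ?_)
  ring

/-- The version for a multiplier M that itself loses s: the growing direction η and M together cost
2s. -/
theorem nrm_mix_le' {τ ρ : ℝ} {μ : ℝ≥0∞} {M : WSeq} (hM : MulBound w (-s) μ M)
    (h2 : τ ≤ 4 * s) (hρ : ρ = τ - 2 * s) (v η : WSeq) :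
    nrm ρ w (wdiff v * (wdiff η * M)) ≤ 8 * μ * nrm (-s) w η * nrm τ w v := by
  have h := hM (τ - s) (wdiff v * wdiff η)
  rw [show τ - s + -s = ρ by rw [hρ]; ring] at h
  rw [← mul_assoc]
  calc _ ≤ _ := h
    _ ≤ μ * (4 * (2 * nrm (-s) w η) * nrm τ w v) := by
        gcongr
        exact H.nrm_wdiff_mul_le (H.mulBound_wdiff_neg η) h2 rfl v
    _ = _ := by ring

theorem mulBound_wdiff_r {u : WSeq} (hu : nrm 0 w u ≤ t) : MulBound w 0 r (wdiff u) :=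
  (mulBound_wdiff' hu).mono H.t_le

theorem mulBound_wdiff_add_r {u v : WSeq} (hu : nrm 0 w u ≤ t) (hv : nrm 0 w v ≤ t) :
    MulBound w 0 r (wdiff u + wdiff v) :=
  (mulBound_wdiff_add hu hv).mono H.t_le

theorem mulBound_mix {u u' v : WSeq} (hu : nrm 0 w u ≤ t) (hu' : nrm 0 w u' ≤ t)
    (hv : nrm 0 w v ≤ t) :
    MulBound w 0 (2 * coefSum c r) (serMix c (wdiff u) (wdiff u') (wdiff v)) :=
  mulBound_serMix H.coefSum_ne_top (H.mulBound_wdiff_r hu) (H.mulBound_wdiff_r hu')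
    (H.mulBound_wdiff_add_r hu hv) (H.mulBound_wdiff_add_r hu' hv)

/-- The factor `wdiff v` survives when the parameter is varied. Its rate 4s compensates the possible
growth of u' - u, which is controlled only at rate -s. -/
theorem nonlin_param_sub {u u' v : WSeq} (hu : nrm 0 w u ≤ t) (hu' : nrm 0 w u' ≤ t)
    (hv : nrm 0 w v ≤ t) : nonlin c u' v - nonlin c u v
      = wdiff v * (wdiff (u' - u) * serMix c (wdiff u) (wdiff u') (wdiff v)) := by
  rw [H.nonlin_eq hu' hv, H.nonlin_eq hu hv, ← mul_sub,
    serDiv_sub_serDiv H.r_ne_top H.coefSum_ne_top (H.mulBound_wdiff_r hu) (H.mulBound_wdiff_r hu')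
    (H.mulBound_wdiff_add_r hu hv) (H.mulBound_wdiff_add_r hu' hv), wdiff_sub]

theorem nonlin_sub_eq {u u' v v' : WSeq} (hu : nrm 0 w u ≤ t) (hu' : nrm 0 w u' ≤ t)
    (hv : nrm 0 w v ≤ t) (hv' : nrm 0 w v' ≤ t) : nonlin c u' v' - nonlin c u v
      = wdiff v * (wdiff (u' - u) * serMix c (wdiff u) (wdiff u') (wdiff v))
        + wdiff (v' - v) * serDiv c (wdiff u' + wdiff v') (wdiff u' + wdiff v) := by
  rw [← H.nonlin_param_sub hu hu' hv, ← H.nonlin_sub_nonlin hu' hv' hv]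
  ring

theorem fix_nonlin_ne_top {u B v : WSeq} (h : IsFix w s t c K u B v) :
    nrm s w (nonlin c u v) ≠ ⊤ :=
  H.nonlin_ne_top H.s_le_four h.param_le (H.nrm_zero_le h.le)
    (ne_top_of_le_ne_top H.t_ne_top ((nrm_mono H.s_le_four v).trans h.le))

/-- The a priori estimate behind every bound on differences, tangents and remainders: each of these
solves an equation of this linear form, with its own source S, at some rate in [s, 4s]. -/
theorem le_of_add_half {S d : WSeq} {τ : ℝ} (h1 : s ≤ τ) (h2 : τ ≤ 4 * s) {x y : WSeq}
    (hx : MulBound w 0 (4 * t) x) (hy : MulBound w 0 (4 * t) y) (hd : nrm τ w d ≠ ⊤)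
    (h : d = S + K (wdiff d * serDiv c x y)) : nrm τ w d ≤ 2 * nrm τ w S := by
  refine le_two_mul_of_le_add_half hd ?_
  calc nrm τ w d ≤ nrm τ w S + nrm τ w (K (wdiff d * serDiv c x y)) := by
        conv_lhs => rw [h]
        exact nrm_add_le _ _
    _ ≤ _ := by gcongr; exact H.nrm_K_prod_le h1 h2 hx hy d

theorem mix_source_le {u u' v B η : WSeq} {E : ℝ≥0∞} (hu : nrm 0 w u ≤ t)
    (hu' : nrm 0 w u' ≤ t) (hv : nrm (4 * s) w v ≤ t) (hB : nrm (3 * s) w B ≤ E)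
    (hη : nrm (-s) w η ≤ E) :
    nrm (3 * s) w (B + K (wdiff v * (wdiff η * serMix c (wdiff u) (wdiff u') (wdiff v))))
      ≤ (1 + κ * (8 * (2 * coefSum c r) * t)) * E := by
  have hs := H.pos
  refine (nrm_add_le _ _).trans ?_
  rw [add_mul, one_mul]
  refine add_le_add hB ((H.bound _ (by linarith) (by linarith) _).trans ?_)
  have h := H.nrm_mix_le (ρ := 3 * s) (H.mulBound_mix hu hu' (H.nrm_zero_le hv)) le_rfl (by ring)
    v η
  calc _ ≤ κ * (8 * (2 * coefSum c r) * E * t) := by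
        gcongr
        exact h.trans (by gcongr)
    _ = _ := by ring

theorem mix_ne_top {u u' v η : WSeq} (hu : nrm 0 w u ≤ t)
    (hu' : nrm 0 w u' ≤ t) (hv : nrm (4 * s) w v ≤ t) (hη : nrm (-s) w η ≠ ⊤) :
    nrm s w (wdiff v * (wdiff η * serMix c (wdiff u) (wdiff u') (wdiff v))) ≠ ⊤ := by
  have hs := H.pos
  have hA := H.coefSum_ne_top
  have hv' := ne_top_of_le_ne_top H.t_ne_top hv
  refine ne_top_of_le_ne_top ?_ ((nrm_mono (by linarith : s ≤ 3 * s) _).trans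
    (H.nrm_mix_le (H.mulBound_mix hu hu' (H.nrm_zero_le hv)) le_rfl (by ring) v η))
  finiteness

/-- The Lipschitz constant of the solution with respect to the parameters. -/
def lipConst (κ t r : ℝ≥0∞) (c : ℕ → ℂ) : ℝ≥0∞ := 2 * (1 + κ * (8 * (2 * coefSum c r) * t))

theorem lipConst_ne_top : lipConst κ t r c ≠ ⊤ := by
  have hA := H.coefSum_ne_top
  have ht := H.t_ne_top
  have hκ := H.kappa_ne_top
  unfold lipConst
  finiteness

/-- By the exact divided difference identity, v' - v solves a linear equation whose source is linear
in B' - B and u' - u. Pairing v with the latter lowers the rate from 4s to 3s. -/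
theorem nrm_fix_sub_le {u u' B B' v v' : WSeq} {E : ℝ≥0∞} (h : IsFix w s t c K u B v)
    (h' : IsFix w s t c K u' B' v') (hE : nrm (-s) w (u' - u) ≤ E)
    (hB : nrm (3 * s) w (B' - B) ≤ E) (hE' : E ≠ ⊤) :
    nrm (3 * s) w (v' - v) ≤ lipConst κ t r c * E := by
  have hs := H.pos
  have hv := H.nrm_zero_le h.le
  have hv' := H.nrm_zero_le h'.le
  have hfin : ∀ {τ}, τ ≤ 4 * s → nrm τ w (v' - v) ≠ ⊤ := fun {τ} hτ =>
    ne_top_of_le_ne_top (ENNReal.add_ne_top.2 ⟨ne_top_of_le_ne_top H.t_ne_top h'.le,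
      ne_top_of_le_ne_top H.t_ne_top h.le⟩) ((nrm_mono hτ _).trans (nrm_sub_le v' v))
  have hx := mulBound_wdiff_add h'.param_le hv'
  have hy := mulBound_wdiff_add h'.param_le hv
  have e : v' - v = (B' - B
      + K (wdiff v * (wdiff (u' - u) * serMix c (wdiff u) (wdiff u') (wdiff v))))
      + K (wdiff (v' - v) * serDiv c (wdiff u' + wdiff v') (wdiff u' + wdiff v)) := by
    rw [add_assoc, ← H.add _ _ (H.mix_ne_top h.param_le h'.param_le h.le
      (ne_top_of_le_ne_top hE' hE)) (H.prod_ne_top H.s_le_four hx hy (hfin H.s_le_four)),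
      ← H.nonlin_sub_eq h.param_le h'.param_le hv hv',
      H.sub (H.fix_nonlin_ne_top h') (H.fix_nonlin_ne_top h)]
    conv_lhs => rw [h.eq, h'.eq]
    abel
  refine (H.le_of_add_half (by linarith) (by linarith) hx hy (hfin (by linarith)) e).trans ?_
  rw [lipConst, mul_assoc]
  gcongr
  exact H.mix_source_le h.param_le h'.param_le h.le hB hE

/-! ### The linearized fixed point problem -/

theorem exists_tangent {u v η β : WSeq} (hu : nrm 0 w u ≤ t) (hv : nrm (4 * s) w v ≤ t)
    (hη : nrm (-s) w η ≠ ⊤) (hβ : nrm (3 * s) w β ≠ ⊤) :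
    ∃ d, IsTangent w s c K u v η β d := by
  have hs := H.pos
  set S := β + K (wdiff v * (wdiff η * serMix c (wdiff u) (wdiff u) (wdiff v))) with hS
  have hx := mulBound_wdiff_add hu (H.nrm_zero_le hv)
  have hSt : nrm (3 * s) w S ≠ ⊤ := by
    have hA := H.coefSum_ne_top
    have ht := H.t_ne_top
    have hκ := H.kappa_ne_top
    refine ne_top_of_le_ne_top ?_ (H.mix_source_le hu hu hv (E := nrm (3 * s) w β + nrm (-s) w η)
      le_self_add le_add_self)
    finiteness
  have h2S : 2 * nrm (3 * s) w S ≠ ⊤ := by finiteness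
  have hK : ∀ z, nrm (3 * s) w (K (wdiff z * serDiv c (wdiff u + wdiff v) (wdiff u + wdiff v)))
      ≤ 2⁻¹ * nrm (3 * s) w z := H.nrm_K_prod_le (by linarith) (by linarith) hx hx
  have hf : ∀ {z}, nrm (3 * s) w z ≤ 2 * nrm (3 * s) w S →
      nrm s w (wdiff z * serDiv c (wdiff u + wdiff v) (wdiff u + wdiff v)) ≠ ⊤ := fun {z} hz =>
    H.prod_ne_top H.s_le_four hx hx
      (ne_top_of_le_ne_top h2S ((nrm_mono (by linarith) z).trans hz))
  obtain ⟨d, hd, h⟩ := exists_fixedPoint (σ := 3 * s) (w := w) (ρ := 2 * nrm (3 * s) w S)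
    (Φ := fun d => S + K (wdiff d * serDiv c (wdiff u + wdiff v) (wdiff u + wdiff v))) h2S
    (fun z hz => by
      refine (nrm_add_le _ _).trans ?_
      conv_rhs => rw [two_mul]
      gcongr
      refine (hK z).trans ?_
      calc _ ≤ 2⁻¹ * (2 * nrm (3 * s) w S) := by gcongr
        _ = _ := by rw [← mul_assoc, ENNReal.inv_mul_cancel (by simp) (by simp), one_mul])
    (fun z z' hz hz' => by
      rw [add_sub_add_left_eq_sub, ← H.sub (hf hz) (hf hz'), ← sub_mul, ← wdiff_sub]
      exact hK _)
  exact ⟨d, ne_top_of_le_ne_top h2S hd, hη, hβ, h.symm⟩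

theorem tangent_le {u v η β d : WSeq} {G : ℝ≥0∞} (hu : nrm 0 w u ≤ t)
    (hv : nrm (4 * s) w v ≤ t) (h : IsTangent w s c K u v η β d) (hη : nrm (-s) w η ≤ G)
    (hβ : nrm (3 * s) w β ≤ G) : nrm (3 * s) w d ≤ lipConst κ t r c * G := by
  have hs := H.pos
  have hx := mulBound_wdiff_add hu (H.nrm_zero_le hv)
  refine (H.le_of_add_half (by linarith) (by linarith) hx hx h.ne_top h.eq).trans ?_
  rw [lipConst, mul_assoc]
  gcongr
  exact H.mix_source_le hu hu hv hβ hη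

/-- Together with the closure under sums and multiples below, this makes the tangent a linear
function of its direction. -/
theorem tangent_unique {u v η β d d' : WSeq} (hu : nrm 0 w u ≤ t)
    (hv : nrm (4 * s) w v ≤ t) (h : IsTangent w s c K u v η β d)
    (h' : IsTangent w s c K u v η β d') : d = d' := by
  have hs := H.pos
  have hx := mulBound_wdiff_add hu (H.nrm_zero_le hv)
  have hf : ∀ {z}, nrm (3 * s) w z ≠ ⊤ →
      nrm s w (wdiff z * serDiv c (wdiff u + wdiff v) (wdiff u + wdiff v)) ≠ ⊤ := fun {z} hz =>
    H.prod_ne_top H.s_le_four hx hx (ne_top_of_le_ne_top hz (nrm_mono (by linarith) z))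
  have e : d - d' = 0
      + K (wdiff (d - d') * serDiv c (wdiff u + wdiff v) (wdiff u + wdiff v)) := by
    conv_lhs => rw [h.eq, h'.eq]
    rw [add_sub_add_left_eq_sub, zero_add, ← H.sub (hf h.ne_top) (hf h'.ne_top), ← sub_mul,
      ← wdiff_sub]
  have h0 := H.le_of_add_half (τ := 3 * s) (by linarith) (by linarith) hx hx
    (ne_top_of_le_ne_top (ENNReal.add_ne_top.2 ⟨h.ne_top, h'.ne_top⟩) (nrm_sub_le d d')) e
  rw [nrm_zero, mul_zero, nonpos_iff_eq_zero] at h0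
  exact sub_eq_zero.1 (eq_zero_of_nrm_eq_zero h0)

theorem tangent_prod_ne_top {u v η β d : WSeq} (hu : nrm 0 w u ≤ t)
    (hv : nrm (4 * s) w v ≤ t) (h : IsTangent w s c K u v η β d) :
    nrm s w (wdiff d * serDiv c (wdiff u + wdiff v) (wdiff u + wdiff v)) ≠ ⊤ := by
  have hs := H.pos
  have hx := mulBound_wdiff_add hu (H.nrm_zero_le hv)
  exact H.prod_ne_top H.s_le_four hx hx (ne_top_of_le_ne_top h.ne_top (nrm_mono (by linarith) d))

theorem tangent_add {u v η β d η' β' d' : WSeq} (hu : nrm 0 w u ≤ t)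
    (hv : nrm (4 * s) w v ≤ t) (h : IsTangent w s c K u v η β d)
    (h' : IsTangent w s c K u v η' β' d') :
    IsTangent w s c K u v (η + η') (β + β') (d + d') where
  ne_top := ne_top_of_le_ne_top (ENNReal.add_ne_top.2 ⟨h.ne_top, h'.ne_top⟩) (nrm_add_le _ _)
  param_ne_top := ne_top_of_le_ne_top
    (ENNReal.add_ne_top.2 ⟨h.param_ne_top, h'.param_ne_top⟩) (nrm_add_le _ _)
  bdry_ne_top := ne_top_of_le_ne_top
    (ENNReal.add_ne_top.2 ⟨h.bdry_ne_top, h'.bdry_ne_top⟩) (nrm_add_le _ _)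
  eq := by
    rw [wdiff_add, wdiff_add, add_mul, mul_add, add_mul,
      H.add _ _ (H.mix_ne_top hu hu hv h.param_ne_top) (H.mix_ne_top hu hu hv h'.param_ne_top),
      H.add _ _ (H.tangent_prod_ne_top hu hv h) (H.tangent_prod_ne_top hu hv h')]
    conv_lhs => rw [h.eq, h'.eq]
    abel

theorem tangent_smul {u v η β d : WSeq} (a : ℂ) (hu : nrm 0 w u ≤ t)
    (hv : nrm (4 * s) w v ≤ t) (h : IsTangent w s c K u v η β d) :
    IsTangent w s c K u v (a • η) (a • β) (a • d) where
  ne_top := ne_top_of_le_ne_top (ENNReal.mul_ne_top enorm_ne_top h.ne_top) (nrm_smul_le _ _)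
  param_ne_top := ne_top_of_le_ne_top
    (ENNReal.mul_ne_top enorm_ne_top h.param_ne_top) (nrm_smul_le _ _)
  bdry_ne_top := ne_top_of_le_ne_top
    (ENNReal.mul_ne_top enorm_ne_top h.bdry_ne_top) (nrm_smul_le _ _)
  eq := by
    rw [wdiff_smul, wdiff_smul, smul_mul_assoc, smul_mul_assoc, mul_smul_comm,
      H.smul _ _ (H.mix_ne_top hu hu hv h.param_ne_top),
      H.smul _ _ (H.tangent_prod_ne_top hu hv h), ← smul_add, ← smul_add, ← h.eq]

end Contractive

end
end DrivenLattice

namespace DrivenLattice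
noncomputable section
open scoped ENNReal

/-! ### Quantitative differentiability of the fixed point -/

namespace Contractive
variable {w : AdmissibleWeight} {s : ℝ} {κ t r : ℝ≥0∞} {c : ℕ → ℂ} {K : WSeq → WSeq}
variable (H : Contractive w s κ t r c K)
include H

theorem nrm_argument_sub_le {u u' v v' : WSeq} {E : ℝ≥0∞} (hE : nrm (-s) w (u' - u) ≤ E)
    (hv : nrm (3 * s) w (v' - v) ≤ lipConst κ t r c * E) :
    nrm (-s) w (wdiff u' + wdiff v' - (wdiff u + wdiff v)) ≤ 2 * (1 + lipConst κ t r c) * E := by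
  have hs := H.pos
  have e : wdiff u' + wdiff v' - (wdiff u + wdiff v) = wdiff ((u' - u) + (v' - v)) := by
    rw [wdiff_add, wdiff_sub, wdiff_sub]; ring
  rw [e]
  calc _ ≤ 2 * nrm (-s) w ((u' - u) + (v' - v)) := nrm_wdiff_le_two (by linarith) w _
    _ ≤ 2 * (E + lipConst κ t r c * E) := by
        gcongr
        refine (nrm_add_le _ _).trans (add_le_add hE ?_)
        exact (nrm_mono (by linarith) _).trans hv
    _ = _ := by ring

theorem nrm_wdiff_sub_le {u u' : WSeq} {E : ℝ≥0∞} (hE : nrm (-s) w (u' - u) ≤ E) :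
    nrm (-s) w (wdiff u' - wdiff u) ≤ 2 * (1 + lipConst κ t r c) * E := by
  have hs := H.pos
  rw [← wdiff_sub]
  calc _ ≤ 2 * nrm (-s) w (u' - u) := nrm_wdiff_le_two (by linarith) w _
    _ ≤ 2 * 1 * E := by rw [mul_one]; gcongr
    _ ≤ _ := by gcongr; exact le_self_add

/-- Puts a bound D into the shape r * L expected by the divided difference estimates. -/
theorem mulBound_of_nrm_le_r {z : WSeq} {D : ℝ≥0∞} (h : nrm (-s) w z ≤ D) :
    MulBound w (-s) (r * (D / r)) z := by
  rw [ENNReal.mul_div_cancel H.r_ne_zero H.r_ne_top]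
  exact MulBound.of_nrm_le h

/-- The solution is differentiable along the scale of spaces, with a quadratic remainder. -/
theorem exists_remainder_bound : ∃ C : ℝ≥0∞, C ≠ ⊤ ∧
    ∀ {u u' B B' v v' η β d : WSeq} {E e : ℝ≥0∞}, IsFix w s t c K u B v →
      IsFix w s t c K u' B' v' → IsTangent w s c K u v η β d → E ≠ ⊤ →
      nrm (-s) w (u' - u) ≤ E → nrm (3 * s) w (B' - B) ≤ E →
      nrm (-s) w (u' - u - η) ≤ e → nrm (3 * s) w (B' - B - β) ≤ e → e ≠ ⊤ →
      nrm (2 * s) w (v' - v - d) ≤ C * (e + E * E) := by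
  set A := coefSum c r with hA
  set L := lipConst κ t r c with hL
  set D := 2 * (1 + L) with hD
  have hA' : A ≠ ⊤ := H.coefSum_ne_top
  have hL' : L ≠ ⊤ := H.lipConst_ne_top
  have hκ := H.kappa_ne_top
  have ht := H.t_ne_top
  have hr' : r⁻¹ ≠ ⊤ := ENNReal.inv_ne_top.2 H.r_ne_zero
  have hs := H.pos
  refine ⟨2 * (1 + κ * (4 * (D * A) * L + 8 * (2 * A) * t + 8 * (2 * (D * r⁻¹) * A) * t)),
    by finiteness, ?_⟩
  intro u u' B B' v v' η β d E e h h' hd hEt hE hB he hβ het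
  have hv := H.nrm_zero_le h.le
  have hv' := H.nrm_zero_le h'.le
  have hvv : nrm (3 * s) w (v' - v) ≤ L * E := H.nrm_fix_sub_le h h' hE hB hEt
  have hvt : nrm (3 * s) w (v' - v) ≠ ⊤ := ne_top_of_le_ne_top (by finiteness) hvv
  have hrt : nrm (3 * s) w (v' - v - d) ≠ ⊤ :=
    ne_top_of_le_ne_top (ENNReal.add_ne_top.2 ⟨hvt, hd.ne_top⟩) (nrm_sub_le _ _)
  have hx := mulBound_wdiff_add h.param_le hv
  have hx' := mulBound_wdiff_add h'.param_le hv'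
  have hy := mulBound_wdiff_add h'.param_le hv
  set M := serMix c (wdiff u) (wdiff u) (wdiff v) with hM
  set M' := serMix c (wdiff u) (wdiff u') (wdiff v) with hM'
  set G := serDiv c (wdiff u + wdiff v) (wdiff u + wdiff v) with hG
  set G' := serDiv c (wdiff u' + wdiff v') (wdiff u' + wdiff v) with hG'
  -- Q collects the defects of the linearization at (u, v). The first term pairs rate 3s with a loss
  -- s, the third pairs rate 4s with two losses s, and both are quadratic in E. The second is linear
  -- in the remainder of u and keeps rate 3s. The common rate is 2s.
  set Q := wdiff (v' - v) * (G' - G) + wdiff v * (wdiff (u' - u - η) * M)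
    + wdiff v * (wdiff (u' - u) * (M' - M)) with hQ
  have hQle : nrm (2 * s) w Q
      ≤ (4 * (D * A) * L + 8 * (2 * A) * t + 8 * (2 * (D * r⁻¹) * A) * t) * (e + E * E) := by
    have q1 : nrm (2 * s) w (wdiff (v' - v) * (G' - G)) ≤ 4 * (D * A) * L * (E * E) := by
      have hm : MulBound w (-s) (D * E * A) (G' - G) := by
        have e1 := H.mulBound_of_nrm_le_r (H.nrm_argument_sub_le hE hvv)
        have e2 : nrm (-s) w (wdiff u' + wdiff v - (wdiff u + wdiff v)) ≤ D * E := by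
          rw [add_sub_add_right_eq_sub]; exact H.nrm_wdiff_sub_le hE
        have := mulBound_serDiv_sub H.r_ne_top H.coefSum_ne_top (hx'.mono H.t_le)
          (hx.mono H.t_le) (hy.mono H.t_le) (hx.mono H.t_le) e1 (H.mulBound_of_nrm_le_r e2)
        rwa [ENNReal.mul_div_cancel H.r_ne_zero H.r_ne_top] at this
      refine (H.nrm_wdiff_mul_le (τ := 3 * s) hm (by linarith) (by ring) _).trans ?_
      calc _ ≤ 4 * (D * E * A) * (L * E) := by gcongr
        _ = _ := by ring
    have q2 : nrm (2 * s) w (wdiff v * (wdiff (u' - u - η) * M)) ≤ 8 * (2 * A) * t * e := by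
      refine (nrm_mono (by linarith : 2 * s ≤ 3 * s) _).trans ?_
      refine (H.nrm_mix_le (H.mulBound_mix h.param_le h.param_le hv) le_rfl (by ring) v _).trans ?_
      calc _ ≤ 8 * (2 * A) * e * t := by gcongr; exact h.le
        _ = _ := by ring
    have q3 : nrm (2 * s) w (wdiff v * (wdiff (u' - u) * (M' - M)))
        ≤ 8 * (2 * (D * r⁻¹) * A) * t * (E * E) := by
      have hm : MulBound w (-s) (2 * (D * E / r) * A) (M' - M) := by
        have e0 : ∀ z : WSeq, MulBound w (-s) (r * (D * E / r)) (z - z) := fun z =>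
          H.mulBound_of_nrm_le_r (by simp)
        have e1 : MulBound w (-s) (r * (D * E / r)) (wdiff u' - wdiff u) :=
          H.mulBound_of_nrm_le_r (H.nrm_wdiff_sub_le hE)
        have e2 : MulBound w (-s) (r * (D * E / r)) (wdiff u' + wdiff v - (wdiff u + wdiff v)) := by
          rw [add_sub_add_right_eq_sub]; exact e1
        have ba := H.mulBound_wdiff_r h.param_le
        exact mulBound_serMix_sub H.coefSum_ne_top ba
          (H.mulBound_wdiff_r h'.param_le) (hx.mono H.t_le) (hy.mono H.t_le) ba ba
          (hx.mono H.t_le) (hx.mono H.t_le) (e0 _) e1 (e0 _) e2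
      refine (H.nrm_mix_le' hm le_rfl (by ring) v _).trans ?_
      calc _ ≤ 8 * (2 * (D * E / r) * A) * E * t := by gcongr; exact h.le
        _ = _ := by rw [div_eq_mul_inv]; ring
    calc nrm (2 * s) w Q ≤ 4 * (D * A) * L * (E * E) + 8 * (2 * A) * t * e
          + 8 * (2 * (D * r⁻¹) * A) * t * (E * E) :=
          (nrm_add_le _ _).trans (add_le_add ((nrm_add_le _ _).trans (add_le_add q1 q2)) q3)
      _ ≤ 4 * (D * A) * L * (e + E * E) + 8 * (2 * A) * t * (e + E * E)
          + 8 * (2 * (D * r⁻¹) * A) * t * (e + E * E) := by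
          gcongr
          · exact le_add_self
          · exact le_self_add
          · exact le_add_self
      _ = _ := by ring
  have hQt : nrm s w Q ≠ ⊤ :=
    ne_top_of_le_ne_top (by finiteness) ((nrm_mono (by linarith) _).trans hQle)
  have hrs : nrm s w (wdiff (v' - v - d) * G) ≠ ⊤ := H.prod_ne_top H.s_le_four hx hx
    (ne_top_of_le_ne_top hrt (nrm_mono (by linarith) _))
  -- The remainder solves the equation linearized at the old point, with the defects as source, so
  -- absorption applies at rate 2s.
  have key : v' - v - d = (B' - B - β + K Q) + K (wdiff (v' - v - d) * G) := by
    have hη := H.mix_ne_top h.param_le h.param_le h.le hd.param_ne_top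
    have hdG := H.tangent_prod_ne_top h.param_le h.le hd
    have n1 := H.fix_nonlin_ne_top h
    have n1' := H.fix_nonlin_ne_top h'
    have n2 : nrm s w (nonlin c u' v' - nonlin c u v) ≠ ⊤ :=
      ne_top_of_le_ne_top (ENNReal.add_ne_top.2 ⟨n1', n1⟩) (nrm_sub_le _ _)
    have n3 := ne_top_of_le_ne_top (ENNReal.add_ne_top.2 ⟨hη, hdG⟩) (nrm_add_le _ _)
    have eQ : Q + wdiff (v' - v - d) * G = (nonlin c u' v' - nonlin c u v)
        - (wdiff v * (wdiff η * M) + wdiff d * G) := by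
      rw [H.nonlin_sub_eq h.param_le h'.param_le hv hv', hQ, wdiff_sub (v' - v) d,
        wdiff_sub (u' - u) η]
      ring
    rw [add_assoc, ← H.add _ _ hQt hrs, eQ, H.sub n2 n3, H.sub n1' n1, H.add _ _ hη hdG]
    conv_lhs => rw [h.eq, h'.eq, hd.eq]
    abel
  refine (H.le_of_add_half (by linarith) (by linarith) hx hx
    (ne_top_of_le_ne_top hrt (nrm_mono (by linarith) _)) key).trans ?_
  rw [mul_assoc]
  gcongr
  refine (nrm_add_le _ _).trans ?_
  rw [add_mul, one_mul]
  refine add_le_add ((nrm_mono (by linarith) _).trans (hβ.trans le_self_add))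
    ((H.bound _ (by linarith) (by linarith) _).trans ?_)
  rw [mul_assoc]
  gcongr

/-- The tangent depends continuously on the base point, along the scale of spaces. -/
theorem exists_tangent_sub_bound : ∃ C : ℝ≥0∞, C ≠ ⊤ ∧
    ∀ {u u' B B' v v' η η' β β' d d' : WSeq} {E e G : ℝ≥0∞}, IsFix w s t c K u B v →
      IsFix w s t c K u' B' v' → IsTangent w s c K u v η β d →
      IsTangent w s c K u' v' η' β' d' → E ≠ ⊤ → e ≠ ⊤ → G ≠ ⊤ →
      nrm (-s) w (u' - u) ≤ E → nrm (3 * s) w (B' - B) ≤ E →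
      nrm (-s) w η' ≤ G → nrm (3 * s) w β' ≤ G →
      nrm (-s) w (η' - η) ≤ e → nrm (3 * s) w (β' - β) ≤ e →
      nrm (2 * s) w (d' - d) ≤ C * (e + E * G) := by
  set A := coefSum c r with hA
  set L := lipConst κ t r c with hL
  set D := 2 * (1 + L) with hD
  have hA' : A ≠ ⊤ := H.coefSum_ne_top
  have hL' : L ≠ ⊤ := H.lipConst_ne_top
  have hκ := H.kappa_ne_top
  have ht := H.t_ne_top
  have hr' : r⁻¹ ≠ ⊤ := ENNReal.inv_ne_top.2 H.r_ne_zero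
  have hs := H.pos
  refine ⟨2 * (1 + κ * (4 * (D * A) * L + 8 * (2 * A) * L + 8 * (2 * (D * r⁻¹) * A) * t
    + 8 * (2 * A) * t)), by finiteness, ?_⟩
  intro u u' B B' v v' η η' β β' d d' E e G h h' hd hd' hEt het hGt hE hB hη hβ he hβe
  have hv := H.nrm_zero_le h.le
  have hv' := H.nrm_zero_le h'.le
  have hvv : nrm (3 * s) w (v' - v) ≤ L * E := H.nrm_fix_sub_le h h' hE hB hEt
  have hd'L : nrm (3 * s) w d' ≤ L * G := H.tangent_le h'.param_le h'.le hd' hη hβ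
  have hdt : nrm (3 * s) w (d' - d) ≠ ⊤ :=
    ne_top_of_le_ne_top (ENNReal.add_ne_top.2 ⟨hd'.ne_top, hd.ne_top⟩) (nrm_sub_le _ _)
  have hx := mulBound_wdiff_add h.param_le hv
  have hx' := mulBound_wdiff_add h'.param_le hv'
  have ba := H.mulBound_wdiff_r h.param_le
  have ba' := H.mulBound_wdiff_r h'.param_le
  have dx := H.mulBound_of_nrm_le_r (H.nrm_argument_sub_le hE hvv)
  have da := H.mulBound_of_nrm_le_r (H.nrm_wdiff_sub_le hE)
  set M := serMix c (wdiff u) (wdiff u) (wdiff v) with hM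
  set M' := serMix c (wdiff u') (wdiff u') (wdiff v') with hM'
  set X := serDiv c (wdiff u + wdiff v) (wdiff u + wdiff v) with hX
  set X' := serDiv c (wdiff u' + wdiff v') (wdiff u' + wdiff v') with hX'
  -- The coefficients and the direction of the linearized equation are changed one at a time. Three
  -- terms are of size E G at rate 2s; the last carries η' - η and has rate 3s.
  set Q := wdiff d' * (X' - X) + wdiff (v' - v) * (wdiff η' * M')
    + wdiff v * (wdiff η' * (M' - M)) + wdiff v * (wdiff (η' - η) * M) with hQ
  have hQle : nrm (2 * s) w Q ≤ (4 * (D * A) * L + 8 * (2 * A) * L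
      + 8 * (2 * (D * r⁻¹) * A) * t + 8 * (2 * A) * t) * (e + E * G) := by
    have q1 : nrm (2 * s) w (wdiff d' * (X' - X)) ≤ 4 * (D * A) * L * (E * G) := by
      have hm : MulBound w (-s) (D * E * A) (X' - X) := by
        have := mulBound_serDiv_sub H.r_ne_top H.coefSum_ne_top (hx'.mono H.t_le)
          (hx.mono H.t_le) (hx'.mono H.t_le) (hx.mono H.t_le) dx dx
        rwa [ENNReal.mul_div_cancel H.r_ne_zero H.r_ne_top] at this
      refine (H.nrm_wdiff_mul_le (τ := 3 * s) hm (by linarith) (by ring) _).trans ?_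
      calc _ ≤ 4 * (D * E * A) * (L * G) := by gcongr
        _ = _ := by ring
    have q2 : nrm (2 * s) w (wdiff (v' - v) * (wdiff η' * M')) ≤ 8 * (2 * A) * L * (E * G) := by
      refine (H.nrm_mix_le (τ := 3 * s) (H.mulBound_mix h'.param_le h'.param_le hv')
        (by linarith) (by ring) _ _).trans ?_
      calc _ ≤ 8 * (2 * A) * G * (L * E) := by gcongr
        _ = _ := by ring
    have q3 : nrm (2 * s) w (wdiff v * (wdiff η' * (M' - M)))
        ≤ 8 * (2 * (D * r⁻¹) * A) * t * (E * G) := by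
      have hm : MulBound w (-s) (2 * (D * E / r) * A) (M' - M) :=
        mulBound_serMix_sub H.coefSum_ne_top ba' ba' (hx'.mono H.t_le) (hx'.mono H.t_le)
          ba ba (hx.mono H.t_le) (hx.mono H.t_le) da da dx dx
      refine (H.nrm_mix_le' hm le_rfl (by ring) v _).trans ?_
      calc _ ≤ 8 * (2 * (D * E / r) * A) * G * t := by gcongr; exact h.le
        _ = _ := by rw [div_eq_mul_inv]; ring
    have q4 : nrm (2 * s) w (wdiff v * (wdiff (η' - η) * M)) ≤ 8 * (2 * A) * t * e := by
      refine (nrm_mono (by linarith : 2 * s ≤ 3 * s) _).trans ?_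
      refine (H.nrm_mix_le (H.mulBound_mix h.param_le h.param_le hv) le_rfl (by ring) v _).trans ?_
      calc _ ≤ 8 * (2 * A) * e * t := by gcongr; exact h.le
        _ = _ := by ring
    calc nrm (2 * s) w Q ≤ 4 * (D * A) * L * (E * G) + 8 * (2 * A) * L * (E * G)
          + 8 * (2 * (D * r⁻¹) * A) * t * (E * G) + 8 * (2 * A) * t * e :=
          (nrm_add_le _ _).trans (add_le_add ((nrm_add_le _ _).trans (add_le_add
            ((nrm_add_le _ _).trans (add_le_add q1 q2)) q3)) q4)
      _ ≤ 4 * (D * A) * L * (e + E * G) + 8 * (2 * A) * L * (e + E * G)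
          + 8 * (2 * (D * r⁻¹) * A) * t * (e + E * G) + 8 * (2 * A) * t * (e + E * G) := by
          gcongr
          · exact le_add_self
          · exact le_add_self
          · exact le_add_self
          · exact le_self_add
      _ = _ := by ring
  have hQt : nrm s w Q ≠ ⊤ :=
    ne_top_of_le_ne_top (by finiteness) ((nrm_mono (by linarith) _).trans hQle)
  have hrs : nrm s w (wdiff (d' - d) * X) ≠ ⊤ := H.prod_ne_top H.s_le_four hx hx
    (ne_top_of_le_ne_top hdt (nrm_mono (by linarith) _))
  have key : d' - d = (β' - β + K Q) + K (wdiff (d' - d) * X) := by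
    have hη := H.mix_ne_top h.param_le h.param_le h.le hd.param_ne_top
    have hdX := H.tangent_prod_ne_top h.param_le h.le hd
    have hη' := H.mix_ne_top h'.param_le h'.param_le h'.le hd'.param_ne_top
    have hdX' := H.tangent_prod_ne_top h'.param_le h'.le hd'
    have n1 := ne_top_of_le_ne_top (ENNReal.add_ne_top.2 ⟨hη, hdX⟩) (nrm_add_le _ _)
    have n1' := ne_top_of_le_ne_top (ENNReal.add_ne_top.2 ⟨hη', hdX'⟩) (nrm_add_le _ _)
    have eQ : Q + wdiff (d' - d) * X = (wdiff v' * (wdiff η' * M') + wdiff d' * X')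
        - (wdiff v * (wdiff η * M) + wdiff d * X) := by
      rw [hQ, wdiff_sub d' d, wdiff_sub v' v, wdiff_sub η' η]
      ring
    rw [add_assoc, ← H.add _ _ hQt hrs, eQ, H.sub n1' n1, H.add _ _ hη hdX, H.add _ _ hη' hdX']
    conv_lhs => rw [hd.eq, hd'.eq]
    abel
  refine (H.le_of_add_half (by linarith) (by linarith) hx hx
    (ne_top_of_le_ne_top hdt (nrm_mono (by linarith) _)) key).trans ?_
  rw [mul_assoc]
  gcongr
  refine (nrm_add_le _ _).trans ?_
  rw [add_mul, one_mul]
  refine add_le_add ((nrm_mono (by linarith) _).trans (hβe.trans le_self_add))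
    ((H.bound _ (by linarith) (by linarith) _).trans ?_)
  rw [mul_assoc]
  gcongr

end Contractive

end
end DrivenLattice

namespace DrivenLattice
noncomputable section
open scoped ENNReal

/-! ### The coefficients of the force -/

/-- The normalized Taylor coefficients of the nonlinear part of the force. -/
def forceCoef (F : ℝ → ℝ) (c : ℝ) (k : ℕ) : ℂ :=
  1 / (alpha F c 1 : ℂ) * ((alpha F c (k + 2) : ℂ) / ((k + 2).factorial : ℂ))

section Coef
variable {F : ℝ → ℝ} {c : ℝ}

theorem min_radius_ne_top : min 1 (FormalMultilinearSeries.ofScalars ℝ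
    (fun k : ℕ => alpha F c k / (k.factorial : ℝ))).radius ≠ ⊤ :=
  ne_top_of_le_ne_top ENNReal.one_ne_top (min_le_left _ _)

theorem rhoF_pos (hF : AnalyticAt ℝ F (-c)) : 0 < rhoF F c := by
  unfold rhoF
  refine ENNReal.toReal_pos (ne_of_gt ?_) min_radius_ne_top
  exact lt_min one_pos hF.hasFPowerSeriesAt.radius_pos

theorem coefSum_forceCoef_ne_top (hF : AnalyticAt ℝ F (-c)) :
    coefSum (forceCoef F c) (ENNReal.ofReal (rhoF F c / 2)) ≠ ⊤ := by
  have hρ := rhoF_pos hF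
  set p := FormalMultilinearSeries.ofScalars ℝ
    (fun k : ℕ => alpha F c k / (k.factorial : ℝ)) with hp
  -- A radius strictly between ρ_F/2 and the radius of convergence: the coefficients are O(R^{-k}),
  -- and the ratio (ρ_F/2)/R = 2/3 dominates the cubic factor.
  set R : NNReal := ⟨3 / 4 * rhoF F c, by positivity⟩ with hR
  have hRlt : (R : ℝ≥0∞) < p.radius := by
    refine lt_of_lt_of_le ?_ (min_le_right 1 _)
    rw [← ENNReal.ofReal_toReal (min_radius_ne_top (F := F) (c := c)), ← ENNReal.ofReal_coe_nnreal]
    refine (ENNReal.ofReal_lt_ofReal_iff hρ).2 ?_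
    change 3 / 4 * rhoF F c < rhoF F c
    linarith
  obtain ⟨C, hC, hCn⟩ := p.norm_mul_pow_le_of_lt_radius hRlt
  have hR0 : 0 < 3 / 4 * rhoF F c := by positivity
  have hb : ∀ n, |alpha F c n / (n.factorial : ℝ)| ≤ C / (3 / 4 * rhoF F c) ^ n := fun n => by
    rw [le_div_iff₀ (by positivity)]
    have := hCn n
    rwa [hp, FormalMultilinearSeries.ofScalars_norm] at this
  have hs : Summable fun k : ℕ => ((k + 2 : ℕ) : ℝ) ^ 3 * (2 / 3 : ℝ) ^ (k + 2) :=
    (summable_nat_add_iff 2).2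
      (summable_pow_mul_geometric_of_norm_lt_one 3 (r := (2 / 3 : ℝ)) (by norm_num))
  have hs2 : Summable fun k : ℕ => ‖forceCoef F c k‖ * ((k + 2) ^ 3 * (rhoF F c / 2) ^ k) := by
    refine Summable.of_nonneg_of_le (fun k => by positivity) (fun k => ?_)
      (hs.mul_left (|1 / alpha F c 1| * C / (rhoF F c / 2) ^ 2))
    have e : ‖forceCoef F c k‖
        = |1 / alpha F c 1| * |alpha F c (k + 2) / ((k + 2).factorial : ℝ)| := by
      rw [← abs_mul, ← Real.norm_eq_abs, ← Complex.norm_real, forceCoef]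
      push_cast
      rfl
    rw [e]
    calc _ ≤ |1 / alpha F c 1| * (C / (3 / 4 * rhoF F c) ^ (k + 2))
          * ((k + 2) ^ 3 * (rhoF F c / 2) ^ k) := by gcongr; exact hb (k + 2)
      _ = _ := by
        have h1 : (2 / 3 : ℝ) ^ (k + 2) = (rhoF F c / 2) ^ (k + 2) / (3 / 4 * rhoF F c) ^ (k + 2) := by
          rw [← div_pow]
          congr 1
          field_simp
          norm_num
        rw [h1, pow_add (rhoF F c / 2)]
        push_cast
        field_simp
  unfold coefSum
  have e : ∀ k : ℕ, ‖forceCoef F c k‖ₑ * ((k + 2) ^ 3 * ENNReal.ofReal (rhoF F c / 2) ^ k)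
      = ENNReal.ofReal (‖forceCoef F c k‖ * ((k + 2) ^ 3 * (rhoF F c / 2) ^ k)) := fun k => by
    rw [ENNReal.ofReal_mul (norm_nonneg _), ofReal_norm, ENNReal.ofReal_mul (by positivity),
      ENNReal.ofReal_pow (by positivity), ENNReal.ofReal_pow (by positivity)]
    congr 3
    rw [show ((k : ℝ) + 2) = ((k + 2 : ℕ) : ℝ) by push_cast; rfl, ENNReal.ofReal_natCast]
    push_cast
    rfl
  simp only [e]
  rw [← ENNReal.ofReal_tsum_of_nonneg (fun k => by positivity) hs2]
  exact ENNReal.ofReal_ne_top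

/-- The constant `C_F`, which depends only on the force. -/
def forceConst (F : ℝ → ℝ) (c : ℝ) : ℝ :=
  64 * (coefSum (forceCoef F c) (ENNReal.ofReal (rhoF F c / 2))).toReal + 1

theorem forceConst_pos : 0 < forceConst F c := by unfold forceConst; positivity

theorem c1_pos (hF : AnalyticAt ℝ F (-c)) (hF' : 0 < deriv F (-c)) {γ : ℝ} (hγ : 0 < γ) :
    0 < c1 F c γ (forceConst F c) := by
  have h1 := CK_pos (c := c) hF' hγ
  have h2 := forceConst_pos (F := F) (c := c)
  have h3 := rhoF_pos hF
  exact lt_min (by positivity) (by positivity)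

/-- Here the constants meet, with A the value of `coefSum` at r = ρ_F/2. From c₁ ≤ ρ_F/8 follows 4c₁
≤ r. From c₁ ≤ 1/(4 C_K C_F), the contraction factor 8 C_K · 16 c₁ A is at most 32A/C_F, which is
below 1/2 for C_F = 64A + 1. -/
theorem contractive_linOp (hF : AnalyticAt ℝ F (-c)) (hF' : 0 < deriv F (-c)) {γ : ℝ}
    (hγ : 0 < γ) (hres : ∀ m : ℤ, ((m : ℝ) * γ) ^ 2 / deriv F (-c) ≠ 4) (w : AdmissibleWeight) :
    Contractive w (sigma1 F c γ) (ENNReal.ofReal (8 * CK F c γ))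
      (ENNReal.ofReal (c1 F c γ (forceConst F c))) (ENNReal.ofReal (rhoF F c / 2))
      (forceCoef F c) (linOp F c γ) := by
  have hs := sigma1_pos (c := c) hF' hγ
  have h01 := sigma0_eq (F := F) (c := c) (γ := γ)
  have hCK := CK_pos (c := c) hF' hγ
  have hρ := rhoF_pos hF
  have hc1 := c1_pos hF hF' hγ
  have hA := coefSum_forceCoef_ne_top hF
  refine
    { pos := hs
      le_one := by rw [← h01]; exact sigma0_le_one
      bound := fun τ h1 h2 y => nrm_linOp_le hF' hγ hres h1 (by rw [h01]; exact h2) w y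
      add := fun y y' h h' => linOp_add hF' hγ hres le_rfl (by linarith) h h'
      smul := fun a y h => linOp_smul hF' hγ hres le_rfl (by linarith) a h
      kappa_ne_top := ENNReal.ofReal_ne_top
      r_ne_zero := by simpa using hρ
      r_ne_top := ENNReal.ofReal_ne_top
      coefSum_ne_top := hA
      t_le := ?_
      contr := ?_ }
  · rw [show (4 : ℝ≥0∞) = ENNReal.ofReal 4 by norm_num, ← ENNReal.ofReal_mul (by norm_num)]
    apply ENNReal.ofReal_le_ofReal
    have : c1 F c γ (forceConst F c) ≤ rhoF F c / 8 := min_le_right _ _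
    linarith
  · rw [← ENNReal.ofReal_toReal hA, show (4 : ℝ≥0∞) = ENNReal.ofReal 4 by norm_num,
      ← ENNReal.ofReal_mul (by norm_num), ← ENNReal.ofReal_mul (by positivity),
      ← ENNReal.ofReal_mul (by norm_num), ← ENNReal.ofReal_mul (by positivity),
      show (2⁻¹ : ℝ≥0∞) = ENNReal.ofReal 2⁻¹ by
        rw [ENNReal.ofReal_inv_of_pos (by norm_num)]; norm_num]
    apply ENNReal.ofReal_le_ofReal
    have h1 : c1 F c γ (forceConst F c) ≤ 1 / (4 * CK F c γ * forceConst F c) := min_le_left _ _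
    have h2 := forceConst_pos (F := F) (c := c)
    have h3 : forceConst F c = 64 * (coefSum (forceCoef F c)
      (ENNReal.ofReal (rhoF F c / 2))).toReal + 1 := rfl
    have h4 := ENNReal.toReal_nonneg (a := coefSum (forceCoef F c) (ENNReal.ofReal (rhoF F c / 2)))
    generalize (coefSum (forceCoef F c) (ENNReal.ofReal (rhoF F c / 2))).toReal = A at *
    rw [le_div_iff₀ (by positivity)] at h1
    generalize c1 F c γ (forceConst F c) = t at *
    generalize CK F c γ = k at *
    rw [h3] at h1
    nlinarith [mul_pos hCK hc1]

end Coef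

/-! ### The nonlinear terms of the lattice equation -/

section Nonlin
variable {F : ℝ → ℝ} {c : ℝ} {w : AdmissibleWeight}

theorem ser_apply {r : ℝ≥0∞} {a : ℕ → ℂ} (hr : r ≠ ⊤) (hA : coefSum a r ≠ ⊤) {x : WSeq}
    (hx : MulBound w 0 r x) (n : ℕ) (m : ℤ) :
    HasSum (fun k => a k * convPow (raw x n) (k + 2) m) (ser a x n m) := by
  have h := summable_ser hr hA hx
  have h1 := ((Pi.hasSum.1 h.hasSum) n)
  have h2 := (Wiener.coeff m).hasSum h1
  have e : ∀ k, (Wiener.coeff m) ((a k • x ^ (k + 2)) n) = a k * convPow (raw x n) (k + 2) m :=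
    fun k => by
      rw [show raw x n = (x n : ℤ → ℂ) from rfl, Wiener.convPow_eq]
      rfl
  simp only [e] at h2
  exact h2

theorem nonlinY_eq {r : ℝ≥0∞} (hr : r ≠ ⊤) (hA : coefSum (forceCoef F c) r ≠ ⊤) {u v : WSeq}
    (h1 : MulBound w 0 r (wdiff u + wdiff v)) (h2 : MulBound w 0 r (wdiff u)) :
    nonlinY F c (raw u) (raw v) = raw (nonlin (forceCoef F c) u v) := by
  funext n m
  have e := (ser_apply hr hA h1 n m).sub (ser_apply hr hA h2 n m)
  have e0 : raw (wdiff u + wdiff v) = diff (raw u + raw v) := by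
    rw [← wdiff_add, raw_wdiff]; rfl
  rw [e0, raw_wdiff] at e
  change _ = (ser (forceCoef F c) (wdiff u + wdiff v)) n m - (ser (forceCoef F c) (wdiff u)) n m
  rw [← e.tsum_eq]
  unfold nonlinY
  cases n with
  -- At n = 0 both difference rows are zero, so the series cancel and agree with the convention Y(0,
  -- m) = 0.
  | zero => simp [diff]
  | succ n =>
    rw [if_neg (Nat.succ_ne_zero n), ← tsum_mul_left]
    refine tsum_congr fun k => ?_
    rw [forceCoef]
    ring

end Nonlin

/-- The lattice equation and the boundary condition are equivalent to the fixed point problem. -/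
theorem eq_fix_iff {F : ℝ → ℝ} {c γ : ℝ} (hF : AnalyticAt ℝ F (-c)) (hF' : 0 < deriv F (-c))
    (hγ : 0 < γ) (hres : ∀ m : ℤ, ((m : ℝ) * γ) ^ 2 / deriv F (-c) ≠ 4) {w : AdmissibleWeight}
    {u v : WSeq} (hu : nrm 0 w u ≤ ENNReal.ofReal (c1 F c γ (forceConst F c)))
    (hv : nrm (sigma0 F c γ) w v ≤ ENNReal.ofReal (c1 F c γ (forceConst F c)))
    {f : ℤ → ℂ} (hf : eN (sigma0 F c γ) w (bdrySol F c γ f) ≠ ⊤) :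
    v = lift (bdrySol F c γ f) + linOp F c γ (nonlin (forceCoef F c) u v) ↔
      (∀ (m : ℤ) (n : ℕ), 1 ≤ n → raw v (n - 1) m + (delta F c γ m : ℂ) * raw v n m
        + raw v (n + 1) m + nonlinW F c (raw u) (raw v) n m = 0) ∧
      ∀ m : ℤ, m0 F c γ < |m| → raw v 0 m = f m := by
  have H := contractive_linOp hF hF' hγ hres w
  have hσ := sigma0_eq (F := F) (c := c) (γ := γ)
  have hv4 : nrm (4 * sigma1 F c γ) w v ≤ ENNReal.ofReal (c1 F c γ (forceConst F c)) := by
    rwa [← hσ]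
  have hv0 := H.nrm_zero_le hv4
  have hvt : nrm (sigma0 F c γ) w v ≠ ⊤ := ne_top_of_le_ne_top ENNReal.ofReal_ne_top hv
  have hN : nrm (sigma0 F c γ) w (nonlin (forceCoef F c) u v) ≠ ⊤ :=
    H.nonlin_ne_top hσ.le hu hv0 hvt
  have hY : nonlinY F c (raw u) (raw v) = raw (nonlin (forceCoef F c) u v) :=
    nonlinY_eq H.r_ne_top H.coefSum_ne_top (H.mulBound_wdiff_add_r hu hv0)
      (H.mulBound_wdiff_r hu)
  have hs1 : sigma1 F c γ ≤ sigma0 F c γ := by linarith [H.pos]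
  have hs0 := sigma0_pos (c := c) hF' hγ
  have hL := raw_linOp hF' hγ hres hs1 le_rfl hN
  have hLeq := linSol_eq hF' hγ hres hs0 hN
  have hraw : raw (lift (bdrySol F c γ f) + linOp F c γ (nonlin (forceCoef F c) u v))
      = bdrySol F c γ f + linSol F c γ (raw (nonlin (forceCoef F c) u v)) := by
    change raw (lift (bdrySol F c γ f)) + raw (linOp F c γ (nonlin (forceCoef F c) u v)) = _
    rw [hL, raw_lift hf]
  have hW : ∀ n m, nonlinW F c (raw u) (raw v) (n + 1) m
      = raw (nonlin (forceCoef F c) u v) (n + 1) m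
        - raw (nonlin (forceCoef F c) u v) (n + 2) m := fun n m => by
    rw [nonlinW, if_neg (Nat.succ_ne_zero n), hY]
  constructor
  · intro h
    have hr := congrArg raw h
    rw [hraw] at hr
    constructor
    · intro m n hn
      obtain ⟨n, rfl⟩ := Nat.exists_eq_add_of_le' hn
      rw [hW, Nat.add_sub_cancel, hr]
      have e1 := hLeq n m
      have e2 := bdrySol_eq hF' hγ f n m
      simp only [Pi.add_apply]
      linear_combination e1 + e2
    · intro m hm
      rw [hr]
      simp only [Pi.add_apply]
      rw [bdrySol_zero_apply hm, linSol_zero_apply hm, add_zero]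
  -- The difference of the two sides decays, solves the homogeneous linear recurrence and vanishes
  -- at n = 0 for |m| > m₀, so it is zero.
  · rintro ⟨h1, h2⟩
    apply raw_injective
    rw [hraw, ← sub_eq_zero]
    have hd : eN (sigma0 F c γ) w (raw v - (bdrySol F c γ f
        + linSol F c γ (raw (nonlin (forceCoef F c) u v)))) ≠ ⊤ := by
      have hLt := nrm_linOp_le hF' hγ hres hs1 le_rfl w (nonlin (forceCoef F c) u v)
      rw [nrm, hL] at hLt
      refine ne_top_of_le_ne_top ?_ ((eN_sub_le _ _ _ _).trans
        (add_le_add_right (eN_add_le _ _ _ _) _))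
      exact ENNReal.add_ne_top.2 ⟨hvt, ENNReal.add_ne_top.2 ⟨hf, ne_top_of_le_ne_top
        (ENNReal.mul_ne_top ENNReal.ofReal_ne_top hN) hLt⟩⟩
    refine eq_zero_of_homogeneous hF' hγ hs0 hd (fun n m => ?_) (fun m hm => ?_)
    · have e0 := h1 m (n + 1) (Nat.le_add_left _ _)
      rw [hW, Nat.add_sub_cancel] at e0
      have e1 := hLeq n m
      have e2 := bdrySol_eq hF' hγ f n m
      simp only [Pi.add_apply, Pi.sub_apply]
      linear_combination e0 - e1 - e2
    · simp only [Pi.add_apply, Pi.sub_apply]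
      rw [h2 m hm, bdrySol_zero_apply hm, linSol_zero_apply hm, add_zero, sub_self]

end
end DrivenLattice

namespace DrivenLattice
noncomputable section
open scoped ENNReal Topology
open Filter

/-! ### A criterion for continuous differentiability -/

/-- A criterion for continuous differentiability in terms of a map `U` that is already known to
be continuously differentiable. -/
theorem contDiffOn_of_bounds {P Y Z : Type*} [NormedAddCommGroup P] [NormedSpace ℝ P]
    [NormedAddCommGroup Y] [NormedSpace ℝ Y] [NormedAddCommGroup Z] [NormedSpace ℝ Z]
    {U : P → Z} {U' : P → P →L[ℝ] Z} {V : P → Y} {D : P → P →L[ℝ] Y} {S : Set P}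
    (hS : UniqueDiffOn ℝ S) (hU : ∀ p ∈ S, HasFDerivWithinAt U (U' p) S p)
    (hU' : ContinuousOn U' S) {C : ℝ} (hC : 0 ≤ C)
    (h1 : ∀ p ∈ S, ∀ p' ∈ S, ‖V p' - V p - D p (p' - p)‖
      ≤ C * (‖U p' - U p - U' p (p' - p)‖ + (‖U p' - U p‖ + ‖p' - p‖) * (‖U p' - U p‖ + ‖p' - p‖)))
    (h2 : ∀ p ∈ S, ∀ p' ∈ S, ∀ h, ‖D p' h - D p h‖
      ≤ C * (‖U' p' - U' p‖ * ‖h‖ + (‖U p' - U p‖ + ‖p' - p‖) * ((‖U' p'‖ + 1) * ‖h‖))) :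
    ContDiffOn ℝ 1 V S := by
  have hV : ∀ p ∈ S, HasFDerivWithinAt V (D p) S p := fun p hp => by
    rw [hasFDerivWithinAt_iff_isLittleO]
    have hmem : ∀ᶠ p' in 𝓝[S] p, p' ∈ S := self_mem_nhdsWithin
    have e1 : (fun p' => U p' - U p - U' p (p' - p)) =o[𝓝[S] p] fun p' => p' - p :=
      hasFDerivWithinAt_iff_isLittleO.1 (hU p hp)
    have e2 : (fun p' => ‖U p' - U p‖ + ‖p' - p‖) =O[𝓝[S] p] fun p' => p' - p :=
      (hU p hp).isBigO_sub.norm_left.add (Asymptotics.isBigO_refl _ _).norm_left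
    have e3 : (fun p' => ‖U p' - U p‖ + ‖p' - p‖) =o[𝓝[S] p] fun _ => (1 : ℝ) := by
      refine e2.trans_isLittleO ?_
      rw [Asymptotics.isLittleO_one_iff]
      have : Tendsto (fun p' => p' - p) (𝓝 p) (𝓝 0) := by
        simpa using (tendsto_id (α := P) (x := 𝓝 p)).sub_const p
      exact this.mono_left nhdsWithin_le_nhds
    -- One factor of the square is O(p' - p) and the other tends to zero by continuity of U.
    have e4 : (fun p' => (‖U p' - U p‖ + ‖p' - p‖) * (‖U p' - U p‖ + ‖p' - p‖))
        =o[𝓝[S] p] fun p' => p' - p := by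
      have := e3.mul_isBigO e2.norm_right
      simp only [one_mul] at this
      exact this.of_norm_right
    refine Asymptotics.IsBigO.trans_isLittleO ?_ ((e1.norm_left.add e4).const_mul_left C)
    refine Asymptotics.IsBigO.of_bound 1 ?_
    filter_upwards [hmem] with p' hp'
    rw [one_mul]
    exact (h1 p hp p' hp').trans (le_abs_self _)
  have hD : ContinuousOn D S := fun p hp => by
    rw [ContinuousWithinAt, tendsto_iff_norm_sub_tendsto_zero]
    have cU : Tendsto U (𝓝[S] p) (𝓝 (U p)) := (hU p hp).continuousWithinAt
    have cU' : Tendsto U' (𝓝[S] p) (𝓝 (U' p)) := hU' p hp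
    have cp : Tendsto (fun p' : P => p') (𝓝[S] p) (𝓝 p) := nhdsWithin_le_nhds
    have a1 : Tendsto (fun p' => ‖U' p' - U' p‖) (𝓝[S] p) (𝓝 0) :=
      tendsto_iff_norm_sub_tendsto_zero.1 cU'
    have a2 : Tendsto (fun p' => ‖U p' - U p‖ + ‖p' - p‖) (𝓝[S] p) (𝓝 0) := by
      simpa using (tendsto_iff_norm_sub_tendsto_zero.1 cU).add
        (tendsto_iff_norm_sub_tendsto_zero.1 cp)
    have a3 : Tendsto (fun p' => C * (‖U' p' - U' p‖
        + (‖U p' - U p‖ + ‖p' - p‖) * (‖U' p'‖ + 1))) (𝓝[S] p) (𝓝 0) := by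
      have := (a1.add (a2.mul (cU'.norm.add_const 1))).const_mul C
      simpa using this
    refine squeeze_zero' (Eventually.of_forall fun _ => norm_nonneg _) ?_ a3
    filter_upwards [self_mem_nhdsWithin] with p' hp'
    refine ContinuousLinearMap.opNorm_le_bound _ (by positivity) fun h => ?_
    rw [_root_.sub_apply]
    exact (h2 p hp p' hp' h).trans (le_of_eq (by ring))
  rw [show (1 : WithTop ℕ∞) = 0 + 1 by rfl, contDiffOn_succ_iff_fderivWithin hS]
  refine ⟨fun p hp => (hV p hp).differentiableWithinAt, by simp, ?_⟩
  rw [contDiffOn_zero]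
  exact hD.congr fun p hp => (hV p hp).fderivWithin (hS p hp)

/-! ### Elements of the weighted spaces as sequences in the Wiener algebra -/

namespace SeqSpace
variable {σ : ℝ} {w : AdmissibleWeight}

/-- An element of the weighted space as a sequence in the Wiener algebra. -/
def toW (x : SeqSpace σ w) : WSeq := lift x

theorem raw_toW (x : SeqSpace σ w) : raw x.toW = x := raw_lift x.eN_ne_top

theorem nrm_toW (x : SeqSpace σ w) : nrm σ w x.toW = ‖x‖ₑ := by
  rw [nrm, raw_toW, enorm_eq_eN]

theorem toW_sub (x y : SeqSpace σ w) : (x - y).toW = x.toW - y.toW := by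
  apply raw_injective
  change raw (x - y).toW = raw x.toW - raw y.toW
  rw [raw_toW, raw_toW, raw_toW]
  rfl

theorem toW_add (x y : SeqSpace σ w) : (x + y).toW = x.toW + y.toW := by
  apply raw_injective
  change raw (x + y).toW = raw x.toW + raw y.toW
  rw [raw_toW, raw_toW, raw_toW]
  rfl

theorem toW_real_smul (a : ℝ) (x : SeqSpace σ w) : (a • x).toW = (a : ℂ) • x.toW := by
  apply raw_injective
  change raw (a • x).toW = (a : ℂ) • raw x.toW
  rw [raw_toW, raw_toW]
  rfl

/-- A sequence in the Wiener algebra of finite norm, as an element of the weighted space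
(and zero if the norm is infinite). -/
def ofW (σ : ℝ) (w : AdmissibleWeight) (x : WSeq) : SeqSpace σ w :=
  open Classical in if h : nrm σ w x ≠ ⊤ then mk (raw x) h else 0

theorem coe_ofW {x : WSeq} (h : nrm σ w x ≠ ⊤) :
    ((ofW σ w x : SeqSpace σ w) : ℕ → ℤ → ℂ) = raw x := by
  rw [ofW, dif_pos h]
  rfl

theorem toW_ofW {x : WSeq} (h : nrm σ w x ≠ ⊤) : (ofW σ w x).toW = x := by
  apply raw_injective
  rw [raw_toW, coe_ofW h]

theorem toW_injective : Function.Injective (toW : SeqSpace σ w → WSeq) := fun x y h => by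
  have := congrArg raw h
  rw [raw_toW, raw_toW] at this
  exact Subtype.ext this

/-- Identifies the parameter in 𝓛_{0,w} with the same parameter in the larger space where it is
differentiable. -/
theorem toW_eq_of_coe_eq {τ : ℝ} {x : SeqSpace σ w} {y : SeqSpace τ w}
    (h : ∀ n m, x n m = y n m) : x.toW = y.toW := by
  apply raw_injective
  rw [raw_toW, raw_toW]
  funext n m
  exact h n m

end SeqSpace

/-! ### Boundary terms -/

section Boundary
variable {F : ℝ → ℝ} {c γ τ : ℝ} {w : AdmissibleWeight} {b : ℤ → ℂ}

/-- The boundary values `ε b - g`. -/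
def bdryVal (b : ℤ → ℂ) (ε : ℝ) (g : ℤ → ℂ) : ℤ → ℂ := fun m => (ε : ℂ) * b m - g m

theorem eN_bdrySol_bdryVal_le (hF' : 0 < deriv F (-c)) (hγ : 0 < γ)
    (hb : HasSum (fun m : ℤ => w m * ‖b m‖) 1) (h2 : τ ≤ sigma0 F c γ) (ε : ℝ) (g : ℤ → ℂ) :
    eN τ w (bdrySol F c γ (bdryVal b ε g)) ≤ ‖ε‖ₑ +
      ∑' m : ℤ, ENNReal.ofReal (w m) * if m0 F c γ < |m| then ‖g m‖ₑ else 0 := by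
  refine (eN_bdrySol_le hF' hγ h2 w _).trans ?_
  have e : ∑' m : ℤ, ENNReal.ofReal (w m) * ‖b m‖ₑ = 1 := by
    rw [← ENNReal.ofReal_one, ← hb.tsum_eq, ENNReal.ofReal_tsum_of_nonneg
      (fun m => mul_nonneg (w.pos m).le (norm_nonneg _)) hb.summable]
    refine tsum_congr fun m => ?_
    rw [ENNReal.ofReal_mul (w.pos m).le, ofReal_norm]
  calc _ ≤ ∑' m : ℤ, (‖ε‖ₑ * (ENNReal.ofReal (w m) * ‖b m‖ₑ)
        + ENNReal.ofReal (w m) * if m0 F c γ < |m| then ‖g m‖ₑ else 0) := by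
        refine ENNReal.tsum_le_tsum fun m => ?_
        split_ifs
        · have : ‖bdryVal b ε g m‖ₑ ≤ ‖ε‖ₑ * ‖b m‖ₑ + ‖g m‖ₑ := by
            refine enorm_sub_le.trans ?_
            rw [enorm_mul]
            gcongr
            rw [← ofReal_norm, ← ofReal_norm, Complex.norm_real]
          calc _ ≤ ENNReal.ofReal (w m) * (‖ε‖ₑ * ‖b m‖ₑ + ‖g m‖ₑ) := by gcongr
            _ = _ := by ring
        · simp
    _ = _ := by rw [ENNReal.tsum_add, ENNReal.tsum_mul_left, e, mul_one]

theorem tsum_bdry_le_eN (σ : ℝ) (w : AdmissibleWeight) (x : ℕ → ℤ → ℂ) :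
    ∑' m : ℤ, ENNReal.ofReal (w m) * (if m0 F c γ < |m| then ‖x 0 m‖ₑ else 0) ≤ eN σ w x := by
  refine ENNReal.tsum_le_tsum fun m => ?_
  gcongr
  split_ifs
  · simpa using le_rowE σ x 0 m
  · exact zero_le

theorem tsum_bdry_eq_rhoU (x : SeqSpace τ w) :
    ∑' m : ℤ, ENNReal.ofReal (w m) * (if m0 F c γ < |m| then ‖x 0 m‖ₑ else 0)
      = ENNReal.ofReal (rhoU F c γ w x) := by
  have e : ∀ m : ℤ, ENNReal.ofReal (w m) * (if m0 F c γ < |m| then ‖x 0 m‖ₑ else 0)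
      = ENNReal.ofReal (if m0 F c γ < |m| then w m * ‖x 0 m‖ else 0) := fun m => by
    split_ifs
    · rw [ENNReal.ofReal_mul (w.pos m).le, ofReal_norm]
    · simp
  have h0 : ∀ m : ℤ, 0 ≤ (if m0 F c γ < |m| then w m * ‖x 0 m‖ else 0) := fun m => by
    split_ifs
    · exact mul_nonneg (w.pos m).le (norm_nonneg _)
    · exact le_rfl
  have hs : Summable fun m : ℤ => if m0 F c γ < |m| then w m * ‖x 0 m‖ else 0 := by
    have ht := ne_top_of_le_ne_top x.eN_ne_top (tsum_bdry_le_eN (F := F) (c := c) (γ := γ) τ w x)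
    simp only [e] at ht
    refine (ENNReal.summable_toReal ht).congr fun m => ?_
    rw [ENNReal.toReal_ofReal (h0 m)]
  rw [rhoU, ENNReal.ofReal_tsum_of_nonneg h0 hs]
  exact tsum_congr e

theorem rhoU_nonneg (x : ℕ → ℤ → ℂ) : 0 ≤ rhoU F c γ w x := tsum_nonneg fun m => by
  split_ifs
  · exact mul_nonneg (w.pos m).le (norm_nonneg _)
  · exact le_rfl

theorem bdryVal_sub (ε ε' : ℝ) (g g' : ℤ → ℂ) :
    bdryVal b ε g - bdryVal b ε' g' = bdryVal b (ε - ε') (g - g') := by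
  funext m
  simp only [bdryVal, Pi.sub_apply]
  push_cast
  ring

theorem bdryVal_add (ε ε' : ℝ) (g g' : ℤ → ℂ) :
    bdryVal b ε g + bdryVal b ε' g' = bdryVal b (ε + ε') (g + g') := by
  funext m
  simp only [bdryVal, Pi.add_apply]
  push_cast
  ring

theorem bdryVal_smul (a ε : ℝ) (g : ℤ → ℂ) :
    (a : ℂ) • bdryVal b ε g = bdryVal b (a * ε) ((a : ℂ) • g) := by
  funext m
  simp only [bdryVal, Pi.smul_apply, smul_eq_mul]
  push_cast
  ring

/-- The boundary term of the fixed point problem, for the parameter `x`. -/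
def bdryTerm (F : ℝ → ℝ) (c γ : ℝ) (b : ℤ → ℂ) (ε : ℝ) (x : WSeq) : WSeq :=
  lift (bdrySol F c γ (bdryVal b ε (raw x 0)))

/-- Only the values at n = 0 enter, where e^{σn} = 1. Any rate σ may therefore be used for x, even a
negative one, while the boundary term still decays at rate τ. -/
theorem eN_bdryTerm_le (hF' : 0 < deriv F (-c)) (hγ : 0 < γ)
    (hb : HasSum (fun m : ℤ => w m * ‖b m‖) 1) (h2 : τ ≤ sigma0 F c γ) (σ ε : ℝ) (x : WSeq) :
    eN τ w (bdrySol F c γ (bdryVal b ε (raw x 0))) ≤ ‖ε‖ₑ + nrm σ w x :=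
  (eN_bdrySol_bdryVal_le hF' hγ hb h2 ε _).trans
    (add_le_add_right (tsum_bdry_le_eN σ w (raw x)) _)

theorem nrm_bdryTerm_le (hF' : 0 < deriv F (-c)) (hγ : 0 < γ)
    (hb : HasSum (fun m : ℤ => w m * ‖b m‖) 1) (h2 : τ ≤ sigma0 F c γ) (σ ε : ℝ) (x : WSeq) :
    nrm τ w (bdryTerm F c γ b ε x) ≤ ‖ε‖ₑ + nrm σ w x :=
  (nrm_lift_le _ _ _).trans (eN_bdryTerm_le hF' hγ hb h2 σ ε x)

theorem raw_bdryTerm (hF' : 0 < deriv F (-c)) (hγ : 0 < γ)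
    (hb : HasSum (fun m : ℤ => w m * ‖b m‖) 1) {σ : ℝ} (ε : ℝ) {x : WSeq} (hx : nrm σ w x ≠ ⊤) :
    raw (bdryTerm F c γ b ε x) = bdrySol F c γ (bdryVal b ε (raw x 0)) :=
  raw_lift (ne_top_of_le_ne_top (ENNReal.add_ne_top.2 ⟨enorm_ne_top, hx⟩)
    (eN_bdryTerm_le hF' hγ hb le_rfl σ ε x))

/-- The boundary term is jointly linear in (ε, x), so it is its own derivative and contributes no
quadratic error. -/
theorem bdryTerm_sub (hF' : 0 < deriv F (-c)) (hγ : 0 < γ)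
    (hb : HasSum (fun m : ℤ => w m * ‖b m‖) 1) {σ : ℝ} (ε ε' : ℝ) {x x' : WSeq}
    (hx : nrm σ w x ≠ ⊤) (hx' : nrm σ w x' ≠ ⊤) :
    bdryTerm F c γ b ε x - bdryTerm F c γ b ε' x' = bdryTerm F c γ b (ε - ε') (x - x') := by
  apply raw_injective
  rw [raw_bdryTerm hF' hγ hb _ (ne_top_of_le_ne_top (ENNReal.add_ne_top.2 ⟨hx, hx'⟩)
    (nrm_sub_le x x'))]
  change raw (bdryTerm F c γ b ε x) - raw (bdryTerm F c γ b ε' x') = _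
  rw [raw_bdryTerm hF' hγ hb _ hx, raw_bdryTerm hF' hγ hb _ hx', ← bdrySol_sub, bdryVal_sub]
  rfl

theorem bdryTerm_add (hF' : 0 < deriv F (-c)) (hγ : 0 < γ)
    (hb : HasSum (fun m : ℤ => w m * ‖b m‖) 1) {σ : ℝ} (ε ε' : ℝ) {x x' : WSeq}
    (hx : nrm σ w x ≠ ⊤) (hx' : nrm σ w x' ≠ ⊤) :
    bdryTerm F c γ b ε x + bdryTerm F c γ b ε' x' = bdryTerm F c γ b (ε + ε') (x + x') := by
  apply raw_injective
  rw [raw_bdryTerm hF' hγ hb _ (ne_top_of_le_ne_top (ENNReal.add_ne_top.2 ⟨hx, hx'⟩)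
    (nrm_add_le x x'))]
  change raw (bdryTerm F c γ b ε x) + raw (bdryTerm F c γ b ε' x') = _
  rw [raw_bdryTerm hF' hγ hb _ hx, raw_bdryTerm hF' hγ hb _ hx', ← bdrySol_add, bdryVal_add]
  rfl

theorem bdryTerm_smul (hF' : 0 < deriv F (-c)) (hγ : 0 < γ)
    (hb : HasSum (fun m : ℤ => w m * ‖b m‖) 1) {σ : ℝ} (a ε : ℝ) {x : WSeq}
    (hx : nrm σ w x ≠ ⊤) :
    (a : ℂ) • bdryTerm F c γ b ε x = bdryTerm F c γ b (a * ε) ((a : ℂ) • x) := by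
  apply raw_injective
  rw [raw_bdryTerm hF' hγ hb _ (ne_top_of_le_ne_top (ENNReal.mul_ne_top enorm_ne_top hx)
    (nrm_smul_le (a : ℂ) x))]
  change (a : ℂ) • raw (bdryTerm F c γ b ε x) = _
  rw [raw_bdryTerm hF' hγ hb _ hx, ← bdrySol_smul, bdryVal_smul]
  rfl

end Boundary

end
end DrivenLattice

namespace DrivenLattice
noncomputable section
open scoped ENNReal ComplexConjugate

/-! ### Reality -/

/-- The constant weight. -/
def oneWeight : AdmissibleWeight := ⟨fun _ => 1, fun _ => le_rfl, fun _ _ => by norm_num⟩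

/-- The reflected complex conjugate of a sequence. -/
def reflect (x : ℕ → ℤ → ℂ) : ℕ → ℤ → ℂ := fun n m => conj (x n (-m))

theorem isRealSeq_iff (x : ℕ → ℤ → ℂ) : IsRealSeq x ↔ reflect x = x := by
  constructor
  · intro h
    funext n m
    rw [reflect, h n m, Complex.conj_conj]
  · intro h n m
    conv_lhs => rw [← h]
    rw [reflect, neg_neg]

/-- Reflection exchanges m and -m, which the constant weight does not notice; a general admissible
weight may. -/
theorem eN_reflect (σ : ℝ) (x : ℕ → ℤ → ℂ) : eN σ oneWeight (reflect x) = eN σ oneWeight x := by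
  unfold eN
  rw [← (Equiv.neg ℤ).tsum_eq]
  refine tsum_congr fun m => ?_
  congr 1
  unfold rowE reflect
  congr 1
  funext n
  rw [Equiv.neg_apply, neg_neg, ← ofReal_norm, ← ofReal_norm, Complex.norm_conj]

theorem convPow_reflect (f : ℤ → ℂ) (k : ℕ) (m : ℤ) :
    convPow (fun m => conj (f (-m))) k m = conj (convPow f k (-m)) := by
  induction k generalizing m with
  | zero =>
    simp only [convPow, neg_eq_zero]
    split_ifs <;> simp
  | succ k ih =>
    change conv (convPow (fun m => conj (f (-m))) k) (fun m => conj (f (-m))) m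
      = conj (conv (convPow f k) f (-m))
    unfold conv
    rw [Complex.conj_tsum, ← (Equiv.neg ℤ).tsum_eq]
    refine tsum_congr fun l => ?_
    rw [Equiv.neg_apply, ih, map_mul]
    beta_reduce
    rw [neg_neg, show -(m - -l) = -m - l by ring]

theorem diff_reflect (x : ℕ → ℤ → ℂ) (n : ℕ) :
    diff (reflect x) n = fun m => conj (diff x n (-m)) := by
  funext m
  cases n with
  | zero => simp [diff]
  | succ n => simp [diff, reflect]

theorem nonlinY_reflect (F : ℝ → ℝ) (c : ℝ) (u v : ℕ → ℤ → ℂ) (n : ℕ) (m : ℤ) :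
    nonlinY F c (reflect u) (reflect v) n m = conj (nonlinY F c u v n (-m)) := by
  have e : reflect u + reflect v = reflect (u + v) := by
    funext n m
    simp [reflect]
  unfold nonlinY
  rw [e, diff_reflect, diff_reflect]
  split_ifs
  · simp
  · rw [map_mul, Complex.conj_tsum]
    simp only [convPow_reflect, map_mul, map_sub, map_div₀, map_one, Complex.conj_ofReal,
      map_natCast]

theorem nonlinW_reflect (F : ℝ → ℝ) (c : ℝ) (u v : ℕ → ℤ → ℂ) (n : ℕ) (m : ℤ) :
    nonlinW F c (reflect u) (reflect v) n m = conj (nonlinW F c u v n (-m)) := by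
  unfold nonlinW
  split_ifs
  · simp
  · rw [nonlinY_reflect, nonlinY_reflect, map_sub]

section
variable {F : ℝ → ℝ} {c γ : ℝ} {w : AdmissibleWeight} {b : ℤ → ℂ}

/-- Solutions of the lattice equation with given boundary values are unique among small ones. -/
theorem eq_of_equation (hF : AnalyticAt ℝ F (-c)) (hF' : 0 < deriv F (-c))
    (hγ : 0 < γ) (hres : ∀ m : ℤ, ((m : ℝ) * γ) ^ 2 / deriv F (-c) ≠ 4)
    {u v v' : WSeq} (hu : nrm 0 w u ≤ ENNReal.ofReal (c1 F c γ (forceConst F c)))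
    (hv : nrm (sigma0 F c γ) w v ≤ ENNReal.ofReal (c1 F c γ (forceConst F c)))
    (hv' : nrm (sigma0 F c γ) w v' ≤ ENNReal.ofReal (c1 F c γ (forceConst F c)))
    {f : ℤ → ℂ} (hf : eN (sigma0 F c γ) w (bdrySol F c γ f) ≠ ⊤)
    (h : (∀ (m : ℤ) (n : ℕ), 1 ≤ n → raw v (n - 1) m + (delta F c γ m : ℂ) * raw v n m
        + raw v (n + 1) m + nonlinW F c (raw u) (raw v) n m = 0) ∧
      ∀ m : ℤ, m0 F c γ < |m| → raw v 0 m = f m)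
    (h' : (∀ (m : ℤ) (n : ℕ), 1 ≤ n → raw v' (n - 1) m + (delta F c γ m : ℂ) * raw v' n m
        + raw v' (n + 1) m + nonlinW F c (raw u) (raw v') n m = 0) ∧
      ∀ m : ℤ, m0 F c γ < |m| → raw v' 0 m = f m) : v = v' := by
  have H := contractive_linOp hF hF' hγ hres w
  have hσ := sigma0_eq (F := F) (c := c) (γ := γ)
  exact H.solution_unique hu (hσ ▸ hv) (hσ ▸ hv')
    ((eq_fix_iff hF hF' hγ hres hu hv hf).2 h) ((eq_fix_iff hF hF' hγ hres hu hv' hf).2 h')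

theorem oneWeight_le (w : AdmissibleWeight) (m : ℤ) : oneWeight m ≤ w m := w.one_le' m

/-- Since the coefficients are real and δ is even, the reflected conjugate of v solves the same
equation with the same boundary values. Uniqueness is applied with the constant weight, under which
all smallness hypotheses persist because w ≥ 1. -/
theorem isRealSeq_of_equation (hF : AnalyticAt ℝ F (-c)) (hF' : 0 < deriv F (-c))
    (hγ : 0 < γ) (hres : ∀ m : ℤ, ((m : ℝ) * γ) ^ 2 / deriv F (-c) ≠ 4)
    {u v : WSeq} (hu : nrm 0 w u ≤ ENNReal.ofReal (c1 F c γ (forceConst F c)))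
    (hv : nrm (sigma0 F c γ) w v ≤ ENNReal.ofReal (c1 F c γ (forceConst F c)))
    {f : ℤ → ℂ} (hf : eN (sigma0 F c γ) w (bdrySol F c γ f) ≠ ⊤)
    (h : (∀ (m : ℤ) (n : ℕ), 1 ≤ n → raw v (n - 1) m + (delta F c γ m : ℂ) * raw v n m
        + raw v (n + 1) m + nonlinW F c (raw u) (raw v) n m = 0) ∧
      ∀ m : ℤ, m0 F c γ < |m| → raw v 0 m = f m)
    (hur : IsRealSeq (raw u)) (hfr : ∀ m, f (-m) = conj (f m)) : IsRealSeq (raw v) := by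
  rw [isRealSeq_iff] at hur ⊢
  have hu1 := (eN_mono_weight (oneWeight_le w) _ _).trans hu
  have hv1 := (eN_mono_weight (oneWeight_le w) _ _).trans hv
  have hf1 := ne_top_of_le_ne_top hf (eN_mono_weight (oneWeight_le w) _ _)
  have hrt : eN (sigma0 F c γ) oneWeight (reflect (raw v)) ≠ ⊤ := by
    rw [eN_reflect]
    exact ne_top_of_le_ne_top ENNReal.ofReal_ne_top hv1
  have hr : raw (lift (reflect (raw v))) = reflect (raw v) := raw_lift hrt
  have hvr : nrm (sigma0 F c γ) oneWeight (lift (reflect (raw v)))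
      ≤ ENNReal.ofReal (c1 F c γ (forceConst F c)) := by
    rw [nrm, hr, eN_reflect]
    exact hv1
  have := eq_of_equation hF hF' hγ hres hu1 hvr hv1 hf1 (by
    rw [hr]
    refine ⟨fun m n hn => ?_, fun m hm => ?_⟩
    · have e := congrArg conj (h.1 (-m) n hn)
      have eW := nonlinW_reflect F c (raw u) (raw v) n m
      rw [hur] at eW
      rw [eW]
      rw [delta_neg] at e
      simpa [reflect] using e
    · rw [reflect, h.2 (-m) (by rwa [abs_neg]), hfr, Complex.conj_conj]) h
  rw [← hr, this]

/-- Small parameters and boundary data give a solution of the fixed point problem. -/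
theorem exists_isFix (hF : AnalyticAt ℝ F (-c)) (hF' : 0 < deriv F (-c))
    (hγ : 0 < γ) (hres : ∀ m : ℤ, ((m : ℝ) * γ) ^ 2 / deriv F (-c) ≠ 4)
    (hb : HasSum (fun m : ℤ => w m * ‖b m‖) 1) {x : SeqSpace 0 w} {ε : ℝ}
    (hx : ‖x‖ ≤ c1 F c γ (forceConst F c))
    (he : 2 * (rhoU F c γ w x + |ε|) ≤ c1 F c γ (forceConst F c)) :
    ∃ v : WSeq, nrm (sigma0 F c γ) w v ≤ ENNReal.ofReal (2 * (rhoU F c γ w x + |ε|)) ∧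
      IsFix w (sigma1 F c γ) (ENNReal.ofReal (c1 F c γ (forceConst F c))) (forceCoef F c)
        (linOp F c γ) x.toW (bdryTerm F c γ b ε x.toW) v := by
  have H := contractive_linOp hF hF' hγ hres w
  have hσ := sigma0_eq (F := F) (c := c) (γ := γ)
  have hρ := rhoU_nonneg (F := F) (c := c) (γ := γ) (w := w) x
  have hu : nrm 0 w x.toW ≤ ENNReal.ofReal (c1 F c γ (forceConst F c)) := by
    rw [SeqSpace.nrm_toW, ← ofReal_norm]
    exact ENNReal.ofReal_le_ofReal hx
  have hB : nrm (sigma0 F c γ) w (bdryTerm F c γ b ε x.toW)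
      ≤ ENNReal.ofReal (rhoU F c γ w x + |ε|) := by
    refine (nrm_lift_le _ _ _).trans ((eN_bdrySol_bdryVal_le hF' hγ hb le_rfl _ _).trans ?_)
    rw [SeqSpace.raw_toW, tsum_bdry_eq_rhoU, ENNReal.ofReal_add hρ (abs_nonneg _), add_comm,
      ← ofReal_norm, Real.norm_eq_abs]
  have e2 : ENNReal.ofReal (2 * (rhoU F c γ w x + |ε|))
      = 2 * ENNReal.ofReal (rhoU F c γ w x + |ε|) := by
    rw [ENNReal.ofReal_mul (by norm_num)]
    norm_num
  have he' : 2 * ENNReal.ofReal (rhoU F c γ w x + |ε|)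
      ≤ ENNReal.ofReal (c1 F c γ (forceConst F c)) := by
    rw [← e2]
    exact ENNReal.ofReal_le_ofReal he
  rw [hσ] at hB
  obtain ⟨v, hv, hfix⟩ := H.exists_solution hu hB he'
  refine ⟨v, ?_, hu, hv.trans he', hfix⟩
  rw [e2, hσ]
  exact hv

theorem norm_le_of_enorm_le {E : Type*} [SeminormedAddCommGroup E] {x : E} {C : ℝ≥0∞} {a : ℝ}
    (hC : C ≠ ⊤) (ha : 0 ≤ a) (h : ‖x‖ₑ ≤ C * ENNReal.ofReal a) : ‖x‖ ≤ C.toReal * a := by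
  have := ENNReal.toReal_mono (ENNReal.mul_ne_top hC ENNReal.ofReal_ne_top) h
  rwa [toReal_enorm, ENNReal.toReal_mul, ENNReal.toReal_ofReal ha] at this

/-- The solution of the linearized problem, as a continuous linear map of the direction. -/
theorem exists_tangent_map {Q : Type*} [NormedAddCommGroup Q] [NormedSpace ℝ Q]
    (hF : AnalyticAt ℝ F (-c)) (hF' : 0 < deriv F (-c))
    (hγ : 0 < γ) (hres : ∀ m : ℤ, ((m : ℝ) * γ) ^ 2 / deriv F (-c) ≠ 4)
    (hb : HasSum (fun m : ℤ => w m * ‖b m‖) 1) {u B v : WSeq}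
    (h : IsFix w (sigma1 F c γ) (ENNReal.ofReal (c1 F c γ (forceConst F c))) (forceCoef F c)
      (linOp F c γ) u B v) (L : Q × ℝ →L[ℝ] SeqSpace (-sigma1 F c γ) w) :
    ∃ D : Q × ℝ →L[ℝ] SeqSpace (sigma1 F c γ) w, ∀ p,
      IsTangent w (sigma1 F c γ) (forceCoef F c) (linOp F c γ) u v (L p).toW
        (bdryTerm F c γ b p.2 (L p).toW) (D p).toW := by
  have H := contractive_linOp hF hF' hγ hres w
  have hs := H.pos
  have h3 : 3 * sigma1 F c γ ≤ sigma0 F c γ := by rw [sigma0_eq]; linarith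
  have hLt : ∀ p, nrm (-sigma1 F c γ) w (L p).toW ≠ ⊤ := fun p => by
    rw [SeqSpace.nrm_toW]; exact enorm_ne_top
  have hβ : ∀ p, nrm (3 * sigma1 F c γ) w (bdryTerm F c γ b p.2 (L p).toW)
      ≤ ‖p.2‖ₑ + nrm (-sigma1 F c γ) w (L p).toW := fun p => nrm_bdryTerm_le hF' hγ hb h3 _ _ _
  have hβt : ∀ p, nrm (3 * sigma1 F c γ) w (bdryTerm F c γ b p.2 (L p).toW) ≠ ⊤ := fun p =>
    ne_top_of_le_ne_top (ENNReal.add_ne_top.2 ⟨enorm_ne_top, hLt p⟩) (hβ p)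
  choose d hd using fun p => H.exists_tangent h.param_le h.le (hLt p) (hβt p)
  have hdt : ∀ p, nrm (sigma1 F c γ) w (d p) ≠ ⊤ := fun p =>
    ne_top_of_le_ne_top (hd p).ne_top (nrm_mono (by linarith) _)
  let T : Q × ℝ →ₗ[ℝ] SeqSpace (sigma1 F c γ) w :=
    { toFun := fun p => SeqSpace.ofW _ _ (d p)
      map_add' := fun p p' => by
        apply SeqSpace.toW_injective
        rw [SeqSpace.toW_add, SeqSpace.toW_ofW (hdt _), SeqSpace.toW_ofW (hdt _),
          SeqSpace.toW_ofW (hdt _)]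
        -- The sum of two tangents is a tangent in the sum of the directions, hence equal to the
        -- chosen one by uniqueness.
        refine H.tangent_unique h.param_le h.le (hd _) ?_
        have := H.tangent_add h.param_le h.le (hd p) (hd p')
        rwa [bdryTerm_add hF' hγ hb _ _ (hLt p) (hLt p'), ← SeqSpace.toW_add, ← map_add] at this
      map_smul' := fun a p => by
        apply SeqSpace.toW_injective
        rw [RingHom.id_apply, SeqSpace.toW_real_smul, SeqSpace.toW_ofW (hdt _),
          SeqSpace.toW_ofW (hdt _)]
        refine H.tangent_unique h.param_le h.le (hd _) ?_
        have := H.tangent_smul (a : ℂ) h.param_le h.le (hd p)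
        rwa [bdryTerm_smul hF' hγ hb _ _ (hLt p), ← SeqSpace.toW_real_smul, ← map_smul] at this }
  refine ⟨T.mkContinuous ((Contractive.lipConst (ENNReal.ofReal (8 * CK F c γ))
    (ENNReal.ofReal (c1 F c γ (forceConst F c))) (ENNReal.ofReal (rhoF F c / 2))
    (forceCoef F c)).toReal * (1 + ‖L‖)) fun p => ?_, fun p => ?_⟩
  · rw [mul_assoc]
    refine norm_le_of_enorm_le H.lipConst_ne_top (by positivity) ?_
    rw [← SeqSpace.nrm_toW, show T p = SeqSpace.ofW _ _ (d p) from rfl, SeqSpace.toW_ofW (hdt p)]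
    have hG : ‖p.2‖ₑ + nrm (-sigma1 F c γ) w (L p).toW ≤ ENNReal.ofReal ((1 + ‖L‖) * ‖p‖) := by
      rw [SeqSpace.nrm_toW, ← ofReal_norm, ← ofReal_norm,
        ← ENNReal.ofReal_add (norm_nonneg _) (norm_nonneg _)]
      apply ENNReal.ofReal_le_ofReal
      rw [add_mul, one_mul]
      exact add_le_add (norm_snd_le p) (L.le_opNorm p)
    exact (nrm_mono (by linarith) _).trans (H.tangent_le h.param_le h.le (hd p)
      (le_add_self.trans hG) ((hβ p).trans hG))
  · rw [show T.mkContinuous _ _ p = SeqSpace.ofW _ _ (d p) from rfl, SeqSpace.toW_ofW (hdt p)]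
    exact hd p

end

end
end DrivenLattice

namespace DrivenLattice
noncomputable section
open scoped ENNReal ComplexConjugate

/-! ### Differentiable dependence on the parameters -/

section
variable {F : ℝ → ℝ} {c γ : ℝ} {w : AdmissibleWeight} {b : ℤ → ℂ}

/-- The solution of the fixed point problem depends continuously differentiably on the data. -/
theorem contDiffOn_of_isFix {Q : Type*} [NormedAddCommGroup Q] [NormedSpace ℝ Q]
    (hF : AnalyticAt ℝ F (-c)) (hF' : 0 < deriv F (-c))
    (hγ : 0 < γ) (hres : ∀ m : ℤ, ((m : ℝ) * γ) ^ 2 / deriv F (-c) ≠ 4)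
    (hb : HasSum (fun m : ℤ => w m * ‖b m‖) 1) {S : Set (Q × ℝ)} (hS : UniqueDiffOn ℝ S)
    {U : Q × ℝ → SeqSpace (-sigma1 F c γ) w} (hU : ContDiffOn ℝ 1 U S) {v : Q × ℝ → WSeq}
    (h : ∀ p ∈ S, IsFix w (sigma1 F c γ) (ENNReal.ofReal (c1 F c γ (forceConst F c)))
      (forceCoef F c) (linOp F c γ) (U p).toW (bdryTerm F c γ b p.2 (U p).toW) (v p)) :
    ContDiffOn ℝ 1 (fun p => SeqSpace.ofW (sigma1 F c γ) w (v p)) S := by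
  classical
  have H := contractive_linOp hF hF' hγ hres w
  have hs := H.pos
  have h3 : 3 * sigma1 F c γ ≤ sigma0 F c γ := by rw [sigma0_eq]; linarith
  have ht : ∀ x : SeqSpace (-sigma1 F c γ) w, nrm (-sigma1 F c γ) w x.toW ≠ ⊤ := fun x => by
    rw [SeqSpace.nrm_toW]; exact enorm_ne_top
  have hβ : ∀ (ε : ℝ) (x : SeqSpace (-sigma1 F c γ) w),
      nrm (3 * sigma1 F c γ) w (bdryTerm F c γ b ε x.toW) ≤ ‖ε‖ₑ + ‖x‖ₑ := fun ε x => by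
    rw [← SeqSpace.nrm_toW]
    exact nrm_bdryTerm_le hF' hγ hb h3 _ _ _
  have hsub : ∀ (ε ε' : ℝ) (x x' : SeqSpace (-sigma1 F c γ) w),
      bdryTerm F c γ b ε x.toW - bdryTerm F c γ b ε' x'.toW
        = bdryTerm F c γ b (ε - ε') (x - x').toW := fun ε ε' x x' => by
    rw [bdryTerm_sub hF' hγ hb _ _ (ht x) (ht x'), SeqSpace.toW_sub]
  have hvt : ∀ p ∈ S, nrm (sigma1 F c γ) w (v p) ≠ ⊤ := fun p hp =>
    ne_top_of_le_ne_top ENNReal.ofReal_ne_top ((nrm_mono (by linarith) _).trans (h p hp).le)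
  set U' : Q × ℝ → Q × ℝ →L[ℝ] SeqSpace (-sigma1 F c γ) w := fun p => fderivWithin ℝ U S p
  have hD : ∀ p, ∃ D : Q × ℝ →L[ℝ] SeqSpace (sigma1 F c γ) w, p ∈ S → ∀ k,
      IsTangent w (sigma1 F c γ) (forceCoef F c) (linOp F c γ) (U p).toW (v p) (U' p k).toW
        (bdryTerm F c γ b k.2 (U' p k).toW) (D k).toW := fun p => by
    by_cases hp : p ∈ S
    · obtain ⟨D, hD⟩ := exists_tangent_map hF hF' hγ hres hb (h p hp) (U' p)
      exact ⟨D, fun _ => hD⟩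
    · exact ⟨0, fun hp' => absurd hp' hp⟩
  choose D hD using hD
  obtain ⟨C₁, hC₁, bound₁⟩ := H.exists_remainder_bound
  obtain ⟨C₂, hC₂, bound₂⟩ := H.exists_tangent_sub_bound
  have hE : ∀ p p', nrm (-sigma1 F c γ) w ((U p').toW - (U p).toW)
      ≤ ENNReal.ofReal (‖U p' - U p‖ + ‖p' - p‖) := fun p p' => by
    rw [← SeqSpace.toW_sub, SeqSpace.nrm_toW, ← ofReal_norm]
    exact ENNReal.ofReal_le_ofReal (le_add_of_nonneg_right (norm_nonneg _))
  -- The boundary term varies with both ε and U, which is why the size of the increment is measured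
  -- by ‖U p' - U p‖ + ‖p' - p‖.
  have hEB : ∀ p p', nrm (3 * sigma1 F c γ) w
      (bdryTerm F c γ b p'.2 (U p').toW - bdryTerm F c γ b p.2 (U p).toW)
      ≤ ENNReal.ofReal (‖U p' - U p‖ + ‖p' - p‖) := fun p p' => by
    rw [hsub]
    refine (hβ _ _).trans ?_
    rw [← ofReal_norm, ← ofReal_norm, ← ENNReal.ofReal_add (norm_nonneg _) (norm_nonneg _)]
    apply ENNReal.ofReal_le_ofReal
    rw [add_comm]
    gcongr
    exact norm_snd_le (p' - p)
  refine contDiffOn_of_bounds (U := U) (U' := U') (D := D) (C := max C₁.toReal C₂.toReal) hS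
    (fun p hp => (hU.differentiableOn one_ne_zero p hp).hasFDerivWithinAt)
    (hU.continuousOn_fderivWithin hS le_rfl)
    (ENNReal.toReal_nonneg.trans (le_max_left _ _)) ?_ ?_
  · intro p hp p' hp'
    refine le_trans ?_ (mul_le_mul_of_nonneg_right (le_max_left _ _) (by positivity))
    refine norm_le_of_enorm_le hC₁ (by positivity) ?_
    rw [← SeqSpace.nrm_toW, SeqSpace.toW_sub, SeqSpace.toW_sub, SeqSpace.toW_ofW (hvt p hp),
      SeqSpace.toW_ofW (hvt p' hp'), ENNReal.ofReal_add (norm_nonneg _) (by positivity),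
      ENNReal.ofReal_mul (by positivity)]
    refine (nrm_mono (by linarith) _).trans (bound₁ (h p hp) (h p' hp') (hD p hp (p' - p))
      ENNReal.ofReal_ne_top (hE p p') (hEB p p') ?_ ?_ ENNReal.ofReal_ne_top)
    · rw [← SeqSpace.toW_sub, ← SeqSpace.toW_sub, SeqSpace.nrm_toW, ← ofReal_norm]
    -- The contributions of ε cancel exactly, and only the Taylor remainder of U is left.
    · rw [hsub, hsub]
      refine (hβ _ _).trans (le_of_eq ?_)
      rw [Prod.snd_sub, sub_self, enorm_zero, zero_add, ← ofReal_norm]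
  · intro p hp p' hp' k
    refine le_trans ?_ (mul_le_mul_of_nonneg_right (le_max_right _ _) (by positivity))
    refine norm_le_of_enorm_le hC₂ (by positivity) ?_
    rw [← SeqSpace.nrm_toW, SeqSpace.toW_sub, ENNReal.ofReal_add (by positivity) (by positivity),
      ENNReal.ofReal_mul (by positivity : 0 ≤ ‖U p' - U p‖ + ‖p' - p‖)]
    have hk : ‖U' p' k - U' p k‖ ≤ ‖U' p' - U' p‖ * ‖k‖ := (U' p' - U' p).le_opNorm k
    refine (nrm_mono (by linarith) _).trans (bound₂ (h p hp) (h p' hp') (hD p hp k)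
      (hD p' hp' k) ENNReal.ofReal_ne_top ENNReal.ofReal_ne_top ENNReal.ofReal_ne_top
      (hE p p') (hEB p p') ?_ ?_ ?_ ?_)
    · rw [SeqSpace.nrm_toW, ← ofReal_norm]
      apply ENNReal.ofReal_le_ofReal
      rw [add_mul]
      exact ((U' p').le_opNorm k).trans (le_add_of_nonneg_right (by positivity))
    · refine (hβ _ _).trans ?_
      rw [← ofReal_norm, ← ofReal_norm, ← ENNReal.ofReal_add (norm_nonneg _) (norm_nonneg _)]
      apply ENNReal.ofReal_le_ofReal
      rw [add_mul, one_mul, add_comm]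
      exact add_le_add ((U' p').le_opNorm k) (norm_snd_le k)
    · rw [← SeqSpace.toW_sub, SeqSpace.nrm_toW, ← ofReal_norm]
      exact ENNReal.ofReal_le_ofReal hk
    · rw [hsub]
      refine (hβ _ _).trans ?_
      rw [sub_self, enorm_zero, zero_add, ← ofReal_norm]
      exact ENNReal.ofReal_le_ofReal hk

/-- The domain of the parameters is a set of unique differentiability. -/
theorem uniqueDiffOn_norm_le_abs_le {Q : Type*} [NormedAddCommGroup Q] [NormedSpace ℝ Q]
    {μ : ℝ} (hμ : 0 < μ) : UniqueDiffOn ℝ {p : Q × ℝ | ‖p.1‖ ≤ μ ∧ |p.2| ≤ μ} := by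
  -- The product carries the maximum norm, so the domain is a closed ball: convex with nonempty
  -- interior.
  have e : {p : Q × ℝ | ‖p.1‖ ≤ μ ∧ |p.2| ≤ μ} = Metric.closedBall 0 μ := by
    ext p
    simp [Prod.norm_def]
  rw [e]
  refine uniqueDiffOn_convex (convex_closedBall _ _) ⟨0, ?_⟩
  exact Metric.ball_subset_interior_closedBall (Metric.mem_ball_self hμ)

end

end
end DrivenLattice


/-! ### Assembly of the theorem -/

theorem theorem3 (F : ℝ → ℝ) (c : ℝ)
    (hF : AnalyticAt ℝ F (-c)) (hF' : 0 < deriv F (-c)) :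
    ∃ CF : ℝ, 0 < CF ∧
      ∀ (γ : ℝ), 0 < γ → (∀ m : ℤ, ((m : ℝ) * γ) ^ 2 / deriv F (-c) ≠ 4) →
      ∀ (w : AdmissibleWeight) (b : ℤ → ℂ), HasSum (fun m : ℤ => w m * ‖b m‖) 1 →
      ∀ (N : ℕ) (c₀ C₀ : ℝ), 0 < c₀ → 1 < C₀ →
      ∀ (u : EuclideanSpace ℝ (Fin N) → SeqSpace 0 w)
        -- the same family, regarded as a map into the larger space
        (u' : EuclideanSpace ℝ (Fin N) → SeqSpace (-sigma1 F c γ) w),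
        (∀ q, ‖q‖ ≤ c₀ → ∀ (n : ℕ) (m : ℤ), u' q n m = u q n m) →
        (∀ q, ‖q‖ ≤ c₀ → ‖u q‖ ≤ c1 F c γ CF ∧ rhoU F c γ w (u q) ≤ c1 F c γ CF / 4) →
        ContDiffOn ℝ 1 u' {q | ‖q‖ ≤ c₀} →
        (∀ q, ‖q‖ ≤ c₀ → ∀ j : Fin N,
          ‖fderivWithin ℝ u' {q | ‖q‖ ≤ c₀} q (EuclideanSpace.single j (1 : ℝ))‖ ≤ C₀) →
        (∀ q, ‖q‖ ≤ c₀ → IsRealSeq (u q)) →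
        ∃ v : EuclideanSpace ℝ (Fin N) × ℝ → SeqSpace (sigma0 F c γ) w,
          (∀ (q : EuclideanSpace ℝ (Fin N)) (ε : ℝ),
            ‖q‖ ≤ min c₀ (c1 F c γ CF / (4 * C₀)) → |ε| ≤ min c₀ (c1 F c γ CF / (4 * C₀)) →
              IsSolution F c γ CF w b (u q) ε (v (q, ε)) ∧
              (∀ v₂ : SeqSpace (sigma0 F c γ) w,
                IsSolution F c γ CF w b (u q) ε v₂ → v₂ = v (q, ε)) ∧
              ((∀ m : ℤ, b (-m) = (starRingEnd ℂ) (b m)) → IsRealSeq (v (q, ε)))) ∧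
          ∃ v' : EuclideanSpace ℝ (Fin N) × ℝ → SeqSpace (sigma1 F c γ) w,
            (∀ (q : EuclideanSpace ℝ (Fin N)) (ε : ℝ),
              ‖q‖ ≤ min c₀ (c1 F c γ CF / (4 * C₀)) → |ε| ≤ min c₀ (c1 F c γ CF / (4 * C₀)) →
                ∀ (n : ℕ) (m : ℤ), v' (q, ε) n m = v (q, ε) n m) ∧
            ContDiffOn ℝ 1 v'
              {p | ‖p.1‖ ≤ min c₀ (c1 F c γ CF / (4 * C₀)) ∧
                |p.2| ≤ min c₀ (c1 F c γ CF / (4 * C₀))} := by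
  refine ⟨forceConst F c, forceConst_pos, ?_⟩
  intro γ hγ hres w b hb N c₀ C₀ hc₀ hC₀ u u' huu' hu hu'C _ hur
  set c₁ := c1 F c γ (forceConst F c) with hc₁
  have hc₁0 : 0 < c₁ := c1_pos hF hF' hγ
  set μ := min c₀ (c₁ / (4 * C₀)) with hμ
  have hμ0 : 0 < μ := lt_min hc₀ (by positivity)
  -- Here C₀ > 1 is used.
  have hμ1 : μ ≤ c₁ / 4 := (min_le_right _ _).trans
    (div_le_div_of_nonneg_left hc₁0.le (by norm_num) (by linarith))
  -- Both ρ_u and |ε| are at most c₁/4, so twice their sum is at most c₁.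
  have hsmall : ∀ (q : EuclideanSpace ℝ (Fin N)) (ε : ℝ), ‖q‖ ≤ μ → |ε| ≤ μ →
      2 * (rhoU F c γ w (u q) + |ε|) ≤ c₁ := fun q ε hq hε => by
    have := (hu q (hq.trans (min_le_left _ _))).2
    linarith
  have hex : ∀ p : EuclideanSpace ℝ (Fin N) × ℝ, ∃ v : WSeq, ‖p.1‖ ≤ μ ∧ |p.2| ≤ μ →
      nrm (sigma0 F c γ) w v ≤ ENNReal.ofReal (2 * (rhoU F c γ w (u p.1) + |p.2|)) ∧
      IsFix w (sigma1 F c γ) (ENNReal.ofReal c₁) (forceCoef F c) (linOp F c γ) (u p.1).toW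
        (bdryTerm F c γ b p.2 (u p.1).toW) v := fun p => by
    by_cases hp : ‖p.1‖ ≤ μ ∧ |p.2| ≤ μ
    · obtain ⟨v, hv⟩ := exists_isFix hF hF' hγ hres hb
        (hu p.1 (hp.1.trans (min_le_left _ _))).1 (hsmall p.1 p.2 hp.1 hp.2)
      exact ⟨v, fun _ => hv⟩
    · exact ⟨0, fun hp' => absurd hp' hp⟩
  choose V hV using hex
  have hVt : ∀ p : EuclideanSpace ℝ (Fin N) × ℝ, ‖p.1‖ ≤ μ ∧ |p.2| ≤ μ →
      nrm (sigma0 F c γ) w (V p) ≠ ⊤ := fun p hp =>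
    ne_top_of_le_ne_top ENNReal.ofReal_ne_top (hV p hp).1
  refine ⟨fun p => SeqSpace.ofW _ w (V p), ?_, fun p => SeqSpace.ofW _ w (V p), ?_, ?_⟩
  · intro q ε hq hε
    have hρ := rhoU_nonneg (F := F) (c := c) (γ := γ) (w := w) (u q)
    have hle := hsmall q ε hq hε
    obtain ⟨hn, hfix⟩ := hV (q, ε) ⟨hq, hε⟩
    have hVle := hn.trans (ENNReal.ofReal_le_ofReal hle)
    have ht := hVt (q, ε) ⟨hq, hε⟩
    have hf : eN (sigma0 F c γ) w (bdrySol F c γ (bdryVal b ε (u q 0))) ≠ ⊤ := by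
      have := eN_bdryTerm_le hF' hγ hb le_rfl 0 ε (u q).toW
      rw [SeqSpace.raw_toW] at this
      exact ne_top_of_le_ne_top
        (ENNReal.add_ne_top.2 ⟨enorm_ne_top, ne_top_of_le_ne_top ENNReal.ofReal_ne_top
          hfix.param_le⟩) this
    have heq := hfix.eq
    rw [bdryTerm, SeqSpace.raw_toW] at heq
    have hsol := (eq_fix_iff hF hF' hγ hres hfix.param_le hVle hf).1 heq
    refine ⟨⟨?_, ⟨?_, hle, min_le_right _ _⟩, ?_⟩, ?_, ?_⟩
    · have := hsol.1
      rw [SeqSpace.raw_toW] at this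
      rwa [SeqSpace.coe_ofW ht]
    · have hx : ‖SeqSpace.ofW (sigma0 F c γ) w (V (q, ε))‖ₑ
          ≤ ENNReal.ofReal (2 * (rhoU F c γ w (u q) + |ε|)) := by
        rw [← SeqSpace.nrm_toW, SeqSpace.toW_ofW ht]
        exact hn
      rw [← ofReal_norm] at hx
      exact (ENNReal.ofReal_le_ofReal_iff (by positivity)).1 hx
    · rw [SeqSpace.coe_ofW ht]
      exact hsol.2
    -- The bound (ii) places any competitor in the ball of radius c₁, where the contraction forces
    -- uniqueness.
    · intro v₂ hv₂
      apply SeqSpace.toW_injective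
      rw [SeqSpace.toW_ofW ht]
      refine eq_of_equation hF hF' hγ hres hfix.param_le ?_ hVle hf ?_ hsol
      · rw [SeqSpace.nrm_toW, ← ofReal_norm]
        exact ENNReal.ofReal_le_ofReal (hv₂.bound.1.trans hle)
      · rw [SeqSpace.raw_toW, SeqSpace.raw_toW]
        exact ⟨hv₂.equation, hv₂.boundary⟩
    · intro hbr
      have hr := hur q (hq.trans (min_le_left _ _))
      rw [SeqSpace.coe_ofW ht]
      refine isRealSeq_of_equation hF hF' hγ hres hfix.param_le hVle hf hsol ?_ fun m => ?_
      · rwa [SeqSpace.raw_toW]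
      · rw [bdryVal, bdryVal, hbr, hr 0 m, map_sub, map_mul, Complex.conj_ofReal]
  · intro q ε hq hε n m
    have ht := hVt (q, ε) ⟨hq, hε⟩
    have hs := (contractive_linOp hF hF' hγ hres w).pos
    rw [SeqSpace.coe_ofW ht, SeqSpace.coe_ofW (ne_top_of_le_ne_top ht
      (nrm_mono (by rw [sigma0_eq]; linarith) _))]
  -- The fixed points were constructed from u at rate 0; read with the parameter in 𝓛_{-σ₁,w}, the
  -- same sequences solve the same equation, and there the parameter is C¹.
  · refine contDiffOn_of_isFix (U := fun p => u' p.1) hF hF' hγ hres hb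
      (uniqueDiffOn_norm_le_abs_le hμ0)
      (hu'C.comp contDiff_fst.contDiffOn fun p hp => hp.1.trans (min_le_left _ _)) fun p hp => ?_
    have := (hV p hp).2
    rwa [← SeqSpace.toW_eq_of_coe_eq (huu' p.1 (hp.1.trans (min_le_left _ _)))] at this
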